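/- Let $d\ge 1$, $T>0$, $\tfrac12\le s\le 1$. Let $\beta\in C^1(\mathbb R)$ with $\beta(0)=0$, $D\in L^\infty(\mathbb R^d;\mathbb R^d)$, $b\in C^1(\mathbb R)$, and assume that either (a) $s>\tfrac12$ and $\beta'(r)>0$ for all $r\in\mathbb R$, or (b) $D=0$ a.e. and $\beta'(r)\ge 0$ for all $r\in\mathbb R$. Call $u\in L^\infty((0,T)\times\mathbb R^d)$ a distributional solution on $(0,T)\times\mathbb R^d$ of $$u_t+(-\Delta)^s\beta(u)+\operatorname{div}(D\,b(u)\,u)=0$$ if for all $\varphi\in C_0^\infty((0,T)\times\mathbb R^d)$ $$\int_0^T\!\!\int_{\mathbb R^d}\Big(u\,\varphi_t-\beta(u)\,(-\Delta)^s\varphi+b(u)\,u\,D\cdot\nabla\varphi\Big)\,dx\,dt=0,$$ where $(-\Delta)^s$ acts in $x$ and is the Fourier multiplier with symbol $|\xi|^{2s}$. Let $y_1,y_2\in L^\infty((0,T)\times\mathbb R^d)$ be two distributional solutions such that $y_1-y_2\in L^1((0,T)\times\mathbb R^d)\cap L^\infty(0,T;L^2(\mathbb R^d))$ and $$\lim_{t\to0^+}\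 \operatorname*{ess\,sup}_{r\in(0,t)}\Big|\int_{\mathbb R^d}(y_1(r,x)-y_2(r,x))\,\varphi(x)\,dx\Big|=0\qquad\text{for all }\varphi\in C_0^\infty(\mathbb R^d).$$ Then $y_1=y_2$ a.e. on $(0,T)\times\mathbb R^d$. -/

import Mathlib

open MeasureTheory Set Filter Topology
open scoped ENNReal NNReal ContDiff FourierTransform

noncomputable section

/-- Lebesgue measure on the space-time slab `(0,T) × ℝ^d`. -/
def slabMeasure (d : ℕ) (T : ℝ) : Measure (ℝ × EuclideanSpace ℝ (Fin d)) :=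
  volume.restrict (Ioo (0 : ℝ) T ×ˢ univ)

/-- The fractional Laplacian `(-Δ)^s φ` of a real function on `ℝ^d`, as the Fourier multiplier
with symbol `|ξ|^{2s}` in the angular frequency. Mathlib's `𝓕` uses `exp (-2πi⟪x, ξ⟫)`, so the
symbol reads `(2π|ξ|)^{2s}`. It is applied to smooth compactly supported `φ` only; then both
transforms are convergent integrals, and the result is real because the symbol is even. -/
def fracLaplacian {d : ℕ} (s : ℝ) (φ : EuclideanSpace ℝ (Fin d) → ℝ)
    (x : EuclideanSpace ℝ (Fin d)) : ℝ :=
  (𝓕⁻ (fun ξ : EuclideanSpace ℝ (Fin d) =>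
    (((2 * Real.pi * ‖ξ‖) ^ (2 * s) : ℝ) : ℂ) *
      𝓕 (fun x' : EuclideanSpace ℝ (Fin d) => (φ x' : ℂ)) ξ) x).re

/-- `φ ∈ C_0^∞((0,T) × ℝ^d)`. -/
structure IsSlabTestFunction {d : ℕ} (T : ℝ) (φ : ℝ × EuclideanSpace ℝ (Fin d) → ℝ) : Prop where
  smooth : ContDiff ℝ ∞ φ
  compact : HasCompactSupport φ
  support : tsupport φ ⊆ Ioo (0 : ℝ) T ×ˢ univ

/-- `u` is a distributional solution on `(0,T) × ℝ^d` of
`u_t + (-Δ)^s β(u) + div (D b(u) u) = 0`. -/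
def IsDistributionalSolution {d : ℕ} (s T : ℝ) (β b : ℝ → ℝ)
    (D : EuclideanSpace ℝ (Fin d) → EuclideanSpace ℝ (Fin d))
    (u : ℝ × EuclideanSpace ℝ (Fin d) → ℝ) : Prop :=
  ∀ φ : ℝ × EuclideanSpace ℝ (Fin d) → ℝ, IsSlabTestFunction T φ →
    ∫ p, (u p * deriv (fun t => φ (t, p.2)) p.1
        - fracLaplacian s (fun x => φ (p.1, x)) p.2 * β (u p)
        + b (u p) * u p * inner ℝ (D p.2) (gradient (fun x => φ (p.1, x)) p.2))
      ∂(slabMeasure d T) = 0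

/-- `z ∈ L^∞(0,T; L²(ℝ^d))`, for a function `z` that is measurable on the slab. -/
def MemLinftyL2 {d : ℕ} (T : ℝ) (z : ℝ × EuclideanSpace ℝ (Fin d) → ℝ) : Prop :=
  ∃ C : ℝ≥0, ∀ᵐ t ∂(volume.restrict (Ioo (0 : ℝ) T)),
    MemLp (fun x => z (t, x)) 2 volume ∧ eLpNorm (fun x => z (t, x)) 2 volume ≤ C

/-- `lim_{t → 0+} ess sup_{r ∈ (0,t)} |(z(r), φ)_2| = 0` for all `φ ∈ C_0^∞(ℝ^d)`. -/
def VanishesWeaklyAtZero {d : ℕ} (z : ℝ × EuclideanSpace ℝ (Fin d) → ℝ) : Prop :=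
  ∀ φ : EuclideanSpace ℝ (Fin d) → ℝ, ContDiff ℝ ∞ φ → HasCompactSupport φ →
    Tendsto (fun t : ℝ => essSup (fun r : ℝ => ‖∫ x, z (r, x) * φ x‖ₑ)
        (volume.restrict (Ioo (0 : ℝ) t)))
      (𝓝[>] (0 : ℝ)) (𝓝 0)

end

/-! Put z = y₁ - y₂, w = β(y₁) - β(y₂), F = (b(y₁)y₁ - b(y₂)y₂) D. Then z_t + (-Δ)^s w + div F = 0
with zero initial value in the weak sense. On the bounded range of y₁, y₂ the mean value theorem
gives the pointwise relations z w ≥ α w² + c z² and |F|² ≤ L z², with α, c > 0 in case (a); in case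
(b), c = 0 and F = 0. Uniqueness is then an energy estimate in the negative norm given by the
resolvent (1 + (-Δ)^s)⁻¹, carried out by `IsWeakLinearSolution.ae_eq_zero`.

Let m(ξ) = (2π|ξ|)^{2s} and ρ = 1/(1 + m), and differentiate ∫ ρ|ẑ|² in time. Since ρm = 1 - ρ, the
diffusion contributes -2 Re(conj ẑ · ŵ), whose integral is -2∫ z w ≤ -2α∫ w² - 2c∫ z² by Plancherel,
plus 2ρ Re(conj ẑ · ŵ), which is at most 2α|ŵ|² + (2α)⁻¹ρ|ẑ|². The drift is controlled by
2(2π|ξ|ρ)|ẑ||F̂|. For s > 1/2 one has (2π|ξ|ρ)² ≤ δ + Cρ with δ as small as desired, so Young's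
inequality absorbs the drift into 2c∫ z² up to K∫ ρ|ẑ|² (`exists_drift_bound`). What remains is a
Grönwall inequality for ∫ ρ|ẑ|², used in integrated form with the weight e^{-λt} and λ > (2α)⁻¹ + K.
It forces ẑ = 0, hence z = 0.

Two points need care. The equation for ẑ(·,ξ) comes from testing with a plane wave, which has no
compact support; plane waves are replaced by cutoffs at scale r → ∞, whose gradients and fractional
Laplacians stay bounded and converge pointwise (`fracLaplacian_cutoffWave_limit`). Together with
`ae_eq_primitive_of_weak_deriv` this makes ẑ(·,ξ) the primitive of `fourierVelocity`
(`IsWeakLinearSolution.re_mul_partialFourier`). Secondly, β(yᵢ) is only bounded, so subtracting the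
two weak formulations requires (-Δ)^s ψ ∈ L¹ for test functions ψ (`integrable_fracLaplacian`); for
s < 1 this comes from the second-difference formula for (-Δ)^s. -/

open scoped SchwartzMap
set_option linter.unusedSectionVars false

/-! ### The second-difference form of the fractional Laplacian, and its integrability on test
functions. -/

section FractionalKernel

variable {V : Type*} [NormedAddCommGroup V] [InnerProductSpace ℝ V] [FiniteDimensional ℝ V]
  [MeasurableSpace V] [BorelSpace V]

/-- The singular kernel `‖y‖ ^ (-(n + p))` of the fractional Laplacian of order `p`. -/
noncomputable def fracKernel (V : Type*) [NormedAddCommGroup V] [InnerProductSpace ℝ V] (p : ℝ)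
    (y : V) : ℝ :=
  ‖y‖ ^ (-(Module.finrank ℝ V + p))

lemma fracKernel_nonneg (p : ℝ) (y : V) : 0 ≤ fracKernel V p y :=
  Real.rpow_nonneg (norm_nonneg _) _

lemma measurable_fracKernel (p : ℝ) : Measurable (fracKernel V p) := by
  unfold fracKernel; fun_prop

/-- In polar coordinates the kernel becomes r^{-1-p}. Near 0 the factor r² turns it into r^{1-p},
integrable as p < 2; at infinity p > 0 suffices. -/
lemma integrable_min_one_sq_mul_fracKernel [Nontrivial V] {p : ℝ} (hp0 : 0 < p) (hp2 : p < 2) :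
    Integrable (fun y : V => min 1 (‖y‖ ^ 2) * fracKernel V p y) := by
  have hn : 1 ≤ Module.finrank ℝ V := Module.finrank_pos
  set n := Module.finrank ℝ V with hn_def
  refine (integrable_fun_norm_addHaar (volume : Measure V)
    (f := fun r : ℝ => min 1 (r ^ 2) * r ^ (-((n : ℝ) + p)))).2 ?_
  have key : ∀ r : ℝ, 0 < r → r ^ (n - 1) * r ^ (-((n : ℝ) + p)) = r ^ (-1 - p) := by
    intro r hr
    rw [← Real.rpow_natCast r (n - 1), ← Real.rpow_add hr, Nat.cast_sub hn]
    congr 1; push_cast; ring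
  rw [← Ioc_union_Ioi_eq_Ioi (zero_le_one : (0 : ℝ) ≤ 1)]
  refine IntegrableOn.union ?_ ?_
  · have h : IntegrableOn (fun r : ℝ => r ^ (1 - p)) (Ioc 0 1) := by
      have := intervalIntegral.intervalIntegrable_rpow' (a := 0) (b := 1) (r := 1 - p) (by linarith)
      rwa [intervalIntegrable_iff_integrableOn_Ioc_of_le zero_le_one] at this
    refine h.congr_fun (fun r hr => ?_) measurableSet_Ioc
    have h1 : r ^ 2 ≤ 1 := by nlinarith [hr.1, hr.2]
    simp only [smul_eq_mul]
    rw [min_eq_right h1, mul_left_comm, key r hr.1, ← Real.rpow_natCast r 2,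
      ← Real.rpow_add hr.1]
    congr 1; push_cast; ring
  · refine (integrableOn_Ioi_rpow_of_lt (a := -1 - p) (by linarith) zero_lt_one).congr_fun
      (fun r hr => ?_) measurableSet_Ioi
    have hr' : (1 : ℝ) < r := hr
    have h1 : 1 ≤ r ^ 2 := by nlinarith
    simp only [smul_eq_mul]
    rw [min_eq_left h1, one_mul, key r (by linarith)]

/-- The symbol of the second difference `2 ψ(x) - ψ(x + y) - ψ(x - y)`. -/
noncomputable def diffSymbol (y ξ : V) : ℝ := 2 - 2 * Real.cos (2 * Real.pi * inner ℝ y ξ)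

lemma diffSymbol_nonneg (y ξ : V) : 0 ≤ diffSymbol y ξ := by
  unfold diffSymbol; linarith [Real.cos_le_one (2 * Real.pi * inner ℝ y ξ)]

/-- The quadratic vanishing at y = 0, from 1 - cos a ≤ a²/2, is what compensates the singularity of
the kernel. -/
lemma diffSymbol_le (y ξ : V) :
    diffSymbol y ξ ≤ (4 + (2 * Real.pi * ‖ξ‖) ^ 2) * min 1 (‖y‖ ^ 2) := by
  have h1 : diffSymbol y ξ ≤ 4 := by
    unfold diffSymbol; linarith [Real.neg_one_le_cos (2 * Real.pi * inner ℝ y ξ)]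
  have h2 : diffSymbol y ξ ≤ (2 * Real.pi * ‖ξ‖) ^ 2 * ‖y‖ ^ 2 := by
    have := Real.one_sub_sq_div_two_le_cos (x := 2 * Real.pi * inner ℝ y ξ)
    have h3 : (inner ℝ y ξ) ^ 2 ≤ (‖y‖ * ‖ξ‖) ^ 2 := by
      rw [← sq_abs]
      exact pow_le_pow_left₀ (abs_nonneg _) (abs_real_inner_le_norm y ξ) 2
    have h4 : (2 * Real.pi) ^ 2 * (inner ℝ y ξ) ^ 2 ≤ (2 * Real.pi) ^ 2 * (‖y‖ * ‖ξ‖) ^ 2 := by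
      gcongr
    unfold diffSymbol
    nlinarith
  rcases le_total 1 (‖y‖ ^ 2) with h | h
  · rw [min_eq_left h]; nlinarith [sq_nonneg (2 * Real.pi * ‖ξ‖)]
  · rw [min_eq_right h]; nlinarith [sq_nonneg ‖y‖]

lemma integrable_diffSymbol_mul_fracKernel [Nontrivial V] {p : ℝ} (hp0 : 0 < p) (hp2 : p < 2)
    (ξ : V) : Integrable (fun y : V => diffSymbol y ξ * fracKernel V p y) := by
  refine ((integrable_min_one_sq_mul_fracKernel (V := V) hp0 hp2).const_mul
    (4 + (2 * Real.pi * ‖ξ‖) ^ 2)).mono' ?_ (Eventually.of_forall fun y => ?_)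
  · refine AEStronglyMeasurable.mul ?_ (measurable_fracKernel p).aestronglyMeasurable
    unfold diffSymbol
    exact Continuous.aestronglyMeasurable (by fun_prop)
  · rw [Real.norm_of_nonneg (mul_nonneg (diffSymbol_nonneg _ _) (fracKernel_nonneg _ _)),
      ← mul_assoc]
    exact mul_le_mul_of_nonneg_right (diffSymbol_le y ξ) (fracKernel_nonneg _ _)

/-- The reflection in the hyperplane orthogonal to ξ - η is a measure-preserving linear isometry
that sends ξ to η and leaves the radial kernel unchanged. -/
lemma integral_diffSymbol_eq_of_norm_eq (p : ℝ) {ξ η : V} (h : ‖ξ‖ = ‖η‖) :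
    ∫ y, diffSymbol y ξ * fracKernel V p y = ∫ y, diffSymbol y η * fracKernel V p y := by
  let R : V ≃ₗᵢ[ℝ] V := (ℝ ∙ (ξ - η))ᗮ.reflection
  have hR : R ξ = η := Submodule.reflection_sub h
  rw [← R.measurePreserving.integral_comp R.toHomeomorph.measurableEmbedding
    (fun y => diffSymbol y η * fracKernel V p y)]
  refine integral_congr_ae (Eventually.of_forall fun y => ?_)
  simp only [diffSymbol, fracKernel, ← hR, LinearIsometryEquiv.inner_map_map,
    LinearIsometryEquiv.norm_map]

/-- Substitute r • y for y: the symbol only sees the inner product, so the dilation passes to ξ. The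
kernel contributes r^{-(n+p)} and the Jacobian r^{-n}, which leaves r^p. -/
lemma integral_diffSymbol_smul (p : ℝ) {r : ℝ} (hr : 0 < r) (ξ : V) :
    ∫ y, diffSymbol y (r • ξ) * fracKernel V p y
      = r ^ p * ∫ y, diffSymbol y ξ * fracKernel V p y := by
  have h := Measure.integral_comp_smul (volume : Measure V)
    (fun y => diffSymbol y ξ * fracKernel V p y) r
  have h2 : ∀ y : V, diffSymbol (r • y) ξ * fracKernel V p (r • y)
      = r ^ (-((Module.finrank ℝ V : ℝ) + p)) * (diffSymbol y (r • ξ) * fracKernel V p y) := by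
    intro y
    simp only [diffSymbol, fracKernel, inner_smul_left, inner_smul_right, norm_smul,
      Real.norm_of_nonneg hr.le, Real.mul_rpow hr.le (norm_nonneg y)]
    simp only [conj_trivial]; ring
  simp only [h2, integral_const_mul, smul_eq_mul] at h
  have hpos : 0 < r ^ Module.finrank ℝ V := pow_pos hr _
  rw [abs_of_pos (inv_pos.2 hpos), neg_add, Real.rpow_add hr, Real.rpow_neg hr.le,
    Real.rpow_neg hr.le, Real.rpow_natCast, mul_assoc] at h
  have h3 := mul_left_cancel₀ (inv_pos.2 hpos).ne' h
  rw [← h3, ← mul_assoc, mul_inv_cancel₀ (Real.rpow_pos_of_pos hr p).ne', one_mul]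

lemma integral_diffSymbol_pos [Nontrivial V] {p : ℝ} (hp0 : 0 < p) (hp2 : p < 2) {ξ : V}
    (hξ : ξ ≠ 0) : 0 < ∫ y, diffSymbol y ξ * fracKernel V p y := by
  refine (integral_pos_iff_support_of_nonneg
    (fun y => mul_nonneg (diffSymbol_nonneg _ _) (fracKernel_nonneg _ _))
    (integrable_diffSymbol_mul_fracKernel hp0 hp2 ξ)).2 ?_
  have hsub : {y : V | Real.cos (2 * Real.pi * inner ℝ y ξ) < 1} ⊆
      Function.support (fun y => diffSymbol y ξ * fracKernel V p y) := by
    intro y hy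
    have hy : Real.cos (2 * Real.pi * inner ℝ y ξ) < 1 := hy
    have hy0 : y ≠ 0 := by rintro rfl; simp at hy
    refine (mul_pos ?_ (Real.rpow_pos_of_pos (norm_pos_iff.2 hy0) _)).ne'
    unfold diffSymbol; linarith
  refine lt_of_lt_of_le (IsOpen.measure_pos _ ?_ ?_) (measure_mono hsub)
  · exact isOpen_lt (by fun_prop) continuous_const
  -- At this point the phase 2π⟪y, ξ⟫ equals π, so the cosine is -1.
  · refine ⟨(1 / (2 * ‖ξ‖ ^ 2)) • ξ, ?_⟩
    have h0 : ‖ξ‖ ≠ 0 := norm_ne_zero_iff.2 hξ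
    have : 2 * Real.pi * inner ℝ ((1 / (2 * ‖ξ‖ ^ 2)) • ξ) ξ = Real.pi := by
      rw [inner_smul_left, real_inner_self_eq_norm_sq]
      simp only [conj_trivial]; field_simp
    show Real.cos _ < 1
    rw [this, Real.cos_pi]; norm_num

/-- The Fourier symbol of the singular integral operator with kernel `fracKernel` is a positive
multiple of `‖ξ‖ ^ p`. -/
lemma exists_integral_diffSymbol_eq [Nontrivial V] {p : ℝ} (hp0 : 0 < p) (hp2 : p < 2) :
    ∃ c : ℝ, 0 < c ∧ ∀ ξ : V, ∫ y, diffSymbol y ξ * fracKernel V p y = c * ‖ξ‖ ^ p := by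
  obtain ⟨e, he⟩ := exists_norm_eq V (zero_le_one : (0 : ℝ) ≤ 1)
  refine ⟨_, integral_diffSymbol_pos hp0 hp2 (ξ := e) (by rintro rfl; simp at he), fun ξ => ?_⟩
  rcases eq_or_ne ξ 0 with rfl | hξ
  · simp [diffSymbol, Real.zero_rpow hp0.ne']
  · have h1 : ‖ξ‖ = ‖‖ξ‖ • e‖ := by simp [norm_smul, he]
    rw [integral_diffSymbol_eq_of_norm_eq p h1, integral_diffSymbol_smul p (norm_pos_iff.2 hξ),
      mul_comm]

/-- The symmetric second difference `2 ψ(x) - ψ(x + y) - ψ(x - y)`. -/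
def secondDiff (ψ : V → ℝ) (x y : V) : ℝ := 2 * ψ x - ψ (x + y) - ψ (x - y)

/-- In the second difference the first-order Taylor terms at y and -y cancel. Each remainder is at
most K‖y‖², where K is a Lipschitz constant of the derivative. -/
lemma exists_abs_secondDiff_le {ψ : V → ℝ} (hψ : ContDiff ℝ ∞ ψ) (hc : HasCompactSupport ψ) :
    ∃ C R : ℝ, 0 ≤ C ∧ ∀ x y : V, ‖y‖ ≤ 1 →
      |secondDiff ψ x y| ≤ (Metric.closedBall (0 : V) R).indicator (fun _ => C * ‖y‖ ^ 2) x := by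
  obtain ⟨K, hK⟩ := ContDiff.lipschitzWith_of_hasCompactSupport (𝕂 := ℝ) (n := 1)
    (hc.fderiv (𝕜 := ℝ)) (hψ.fderiv_right (by norm_cast)) one_ne_zero
  obtain ⟨R, hR⟩ := hc.isCompact.isBounded.subset_closedBall (0 : V)
  have h1 : ∀ x y : V, ‖ψ (x + y) - ψ x - fderiv ℝ ψ x y‖ ≤ K * ‖y‖ * ‖y‖ := by
    intro x y
    have := Convex.norm_image_sub_le_of_norm_fderiv_le' (𝕜 := ℝ) (f := ψ) (C := K * ‖y‖)
      (s := Metric.closedBall x ‖y‖) (x := x) (y := x + y) (φ := fderiv ℝ ψ x)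
      (fun z _ => (hψ.differentiable (by simp)).differentiableAt) (fun z hz => ?_)
      (convex_closedBall _ _) (by simp) (by simp)
    · simpa using this
    · rw [← dist_eq_norm]
      exact (hK.dist_le_mul z x).trans (by gcongr; exact hz)
  -- The support lies in the ball of radius R, and shifts of length at most 1 enlarge it to R + 1.
  refine ⟨2 * K, R + 1, by positivity, fun x y hy => ?_⟩
  by_cases hx : x ∈ Metric.closedBall (0 : V) (R + 1)
  · rw [indicator_of_mem hx]
    have ha := h1 x y
    have hb := h1 x (-y)
    rw [Real.norm_eq_abs, abs_le] at ha hb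
    simp only [map_neg, norm_neg, ← sub_eq_add_neg] at hb
    unfold secondDiff
    rw [abs_le]
    constructor <;> nlinarith [ha.1, ha.2, hb.1, hb.2]
  · rw [indicator_of_notMem hx]
    have hx' : R + 1 < ‖x‖ := by simpa using hx
    have hz : ∀ z : V, R < ‖z‖ → ψ z = 0 := by
      intro z hz
      refine image_eq_zero_of_notMem_tsupport fun h => ?_
      have := hR h
      simp at this; linarith
    have e1 : ‖x‖ ≤ ‖x + y‖ + ‖y‖ := by simpa using norm_sub_le (x + y) y
    have e2 : ‖x‖ ≤ ‖x - y‖ + ‖y‖ := by simpa using norm_add_le (x - y) y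
    simp [secondDiff, hz x (by linarith), hz (x + y) (by linarith), hz (x - y) (by linarith)]

/-- Integrate in x first: the L¹ norm of the second difference is O(‖y‖²) for small y and at most
four times the L¹ norm of ψ always, hence at most B min(1, ‖y‖²), which is integrable against the
kernel. -/
lemma integrable_secondDiff_mul_fracKernel [Nontrivial V] {p : ℝ} (hp0 : 0 < p) (hp2 : p < 2)
    {ψ : V → ℝ} (hψ : ContDiff ℝ ∞ ψ) (hc : HasCompactSupport ψ) :
    Integrable (fun q : V × V => secondDiff ψ q.1 q.2 * fracKernel V p q.2)
      (volume.prod volume) := by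
  obtain ⟨C, R, hC, hbd⟩ := exists_abs_secondDiff_le hψ hc
  have hint : Integrable ψ := hψ.continuous.integrable_of_hasCompactSupport hc
  have hcont : Continuous ψ := hψ.continuous
  have hsd : ∀ y, Integrable (fun x => secondDiff ψ x y) := fun y =>
    ((hint.const_mul 2).sub (hint.comp_add_right y)).sub (hint.comp_sub_right y)
  have hL1 : ∀ y, ∫ x, |secondDiff ψ x y| ≤ 4 * ∫ x, |ψ x| := by
    intro y
    have e1 : ∫ x, |ψ (x + y)| = ∫ x, |ψ x| := integral_add_right_eq_self (fun x => |ψ x|) y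
    have e2 : ∫ x, |ψ (x - y)| = ∫ x, |ψ x| := integral_sub_right_eq_self (fun x => |ψ x|) y
    have i1 := (hint.comp_add_right y).abs
    have i2 := (hint.comp_sub_right y).abs
    calc ∫ x, |secondDiff ψ x y| ≤ ∫ x, (2 * |ψ x| + |ψ (x + y)| + |ψ (x - y)|) := by
          refine integral_mono (hsd y).abs (((hint.abs.const_mul 2).add i1).add i2) fun x => ?_
          have := abs_sub (2 * ψ x - ψ (x + y)) (ψ (x - y))
          have h' := abs_sub (2 * ψ x) (ψ (x + y))
          rw [abs_mul, abs_two] at h'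
          simp only [secondDiff]; linarith
      _ = 4 * ∫ x, |ψ x| := by
          have j := integral_add ((hint.abs.const_mul 2).add i1) i2
          have j' := integral_add (hint.abs.const_mul 2) i1
          simp only [Pi.add_apply] at j j'
          rw [j, j', integral_const_mul, e1, e2]
          ring
  set B : ℝ := C * volume.real (Metric.closedBall (0 : V) R) + 4 * ∫ x, |ψ x|
  have hI0 : 0 ≤ ∫ x, |ψ x| := integral_nonneg fun x => abs_nonneg _
  have hv0 : 0 ≤ C * volume.real (Metric.closedBall (0 : V) R) := by positivity
  have hB : ∀ y : V, ∫ x, |secondDiff ψ x y| ≤ B * min 1 (‖y‖ ^ 2) := by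
    intro y
    rcases le_total ‖y‖ 1 with hy | hy
    · have h1 : ‖y‖ ^ 2 ≤ 1 := by nlinarith [norm_nonneg y]
      rw [min_eq_right h1]
      calc ∫ x, |secondDiff ψ x y|
          ≤ ∫ x, (Metric.closedBall (0 : V) R).indicator (fun _ => C * ‖y‖ ^ 2) x := by
            refine integral_mono (hsd y).abs ?_ fun x => hbd x y hy
            rw [integrable_indicator_iff Metric.isClosed_closedBall.measurableSet]
            exact integrableOn_const (measure_closedBall_lt_top.ne)
        _ = C * volume.real (Metric.closedBall (0 : V) R) * ‖y‖ ^ 2 := by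
            rw [integral_indicator Metric.isClosed_closedBall.measurableSet, setIntegral_const,
              smul_eq_mul]
            ring
        _ ≤ _ := by
            refine mul_le_mul_of_nonneg_right ?_ (by positivity)
            simp only [B]; linarith
    · have h1 : 1 ≤ ‖y‖ ^ 2 := by nlinarith
      rw [min_eq_left h1, mul_one]
      exact (hL1 y).trans (by simp only [B]; linarith)
  have hmeas : AEStronglyMeasurable
      (fun q : V × V => secondDiff ψ q.1 q.2 * fracKernel V p q.2) (volume.prod volume) := by
    refine AEStronglyMeasurable.mul ?_
      ((measurable_fracKernel p).comp measurable_snd).aestronglyMeasurable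
    unfold secondDiff
    exact Continuous.aestronglyMeasurable (by fun_prop)
  rw [integrable_prod_iff' hmeas]
  refine ⟨Eventually.of_forall fun y => (hsd y).mul_const (fracKernel V p y), ?_⟩
  refine ((integrable_min_one_sq_mul_fracKernel (V := V) hp0 hp2).const_mul B).mono'
    hmeas.norm.prod_swap.integral_prod_right' (Eventually.of_forall fun y => ?_)
  have : ∀ x, ‖secondDiff ψ x y * fracKernel V p y‖ = |secondDiff ψ x y| * fracKernel V p y := by
    intro x
    rw [norm_mul, Real.norm_eq_abs, Real.norm_of_nonneg (fracKernel_nonneg _ _)]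
  simp only [this, integral_mul_const]
  rw [Real.norm_of_nonneg (mul_nonneg (integral_nonneg fun x => abs_nonneg _)
    (fracKernel_nonneg _ _)), ← mul_assoc]
  exact mul_le_mul_of_nonneg_right (hB y) (fracKernel_nonneg _ _)

lemma rpow_le_one_add_sq {p : ℝ} (hp0 : 0 ≤ p) (hp2 : p ≤ 2) {r : ℝ} (hr : 0 ≤ r) :
    r ^ p ≤ 1 + r ^ 2 := by
  rcases le_total r 1 with h | h
  · exact (Real.rpow_le_one hr h hp0).trans (by nlinarith)
  · have := Real.rpow_le_rpow_of_exponent_le h hp2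
    rw [Real.rpow_two] at this; linarith

lemma SchwartzMap.integrable_rpow_norm_mul (f : 𝓢(V, ℂ)) {p : ℝ} (hp0 : 0 ≤ p) (hp2 : p ≤ 2) :
    Integrable (fun ξ : V => ((‖ξ‖ ^ p : ℝ) : ℂ) * f ξ) := by
  refine (f.integrable.norm.add (f.integrable_pow_mul volume 2)).mono' ?_
    (Eventually.of_forall fun ξ => ?_)
  · refine AEStronglyMeasurable.mul ?_ f.integrable.aestronglyMeasurable
    exact Measurable.aestronglyMeasurable (by fun_prop)
  · rw [norm_mul, Complex.norm_real, Real.norm_of_nonneg (Real.rpow_nonneg (norm_nonneg _) _)]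
    have := mul_le_mul_of_nonneg_right (rpow_le_one_add_sq hp0 hp2 (norm_nonneg ξ))
      (norm_nonneg (f ξ))
    simp only [Pi.add_apply]; linarith

/-- A smooth compactly supported real function, as a complex Schwartz function. -/
noncomputable def realToSchwartz (ψ : V → ℝ) (hψ : ContDiff ℝ ∞ ψ) (hc : HasCompactSupport ψ) :
    𝓢(V, ℂ) :=
  HasCompactSupport.toSchwartzMap (f := fun x => (ψ x : ℂ)) (hc.comp_left Complex.ofReal_zero)
    (Complex.ofRealCLM.contDiff.comp hψ)

@[simp]
lemma coe_realToSchwartz (ψ : V → ℝ) (hψ : ContDiff ℝ ∞ ψ) (hc : HasCompactSupport ψ) :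
    ⇑(realToSchwartz ψ hψ hc) = fun x => (ψ x : ℂ) := rfl

lemma exists_schwartz_fourier_eq {ψ : V → ℝ} (hψ : ContDiff ℝ ∞ ψ) (hc : HasCompactSupport ψ) :
    ∃ g : 𝓢(V, ℂ), 𝓕 (fun x : V => (ψ x : ℂ)) = ⇑g ∧ ∀ v, 𝓕⁻ (⇑g) v = ψ v := by
  refine ⟨𝓕 (realToSchwartz ψ hψ hc), (SchwartzMap.fourier_coe (realToSchwartz ψ hψ hc)).symm, fun v => ?_⟩
  rw [← SchwartzMap.fourierInv_coe, FourierTransform.fourierInv_fourier_eq]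
  rfl

lemma exp_add_exp_neg_eq (a : ℝ) :
    Complex.exp (((a : ℝ) : ℂ) * Complex.I) + Complex.exp (((-a : ℝ) : ℂ) * Complex.I)
      = 2 * (Real.cos a : ℂ) := by
  rw [Complex.ofReal_cos, Complex.two_cos]
  push_cast; ring_nf

/-- Fourier inversion at x, x + y and x - y; the two shifted exponentials combine to 2 cos(2π⟪y,
ξ⟫). -/
lemma secondDiff_eq_integral {ψ : V → ℝ} (hψ : ContDiff ℝ ∞ ψ) (hc : HasCompactSupport ψ)
    (x y : V) : ((secondDiff ψ x y : ℝ) : ℂ) = ∫ ξ, Complex.exp (((2 * Real.pi * inner ℝ ξ x : ℝ) : ℂ)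
      * Complex.I) * (((diffSymbol y ξ : ℝ) : ℂ) * 𝓕 (fun x : V => (ψ x : ℂ)) ξ) := by
  obtain ⟨g, hF, hgi⟩ := exists_schwartz_fourier_eq hψ hc
  have hinv : ∀ v : V, (ψ v : ℂ) = ∫ ξ, Complex.exp (((2 * Real.pi * inner ℝ ξ v : ℝ) : ℂ)
      * Complex.I) * g ξ := by
    intro v
    have h1 := hgi v
    rw [Real.fourierInv_eq'] at h1
    simpa using h1.symm
  have hint : ∀ v : V, Integrable (fun ξ => Complex.exp (((2 * Real.pi * inner ℝ ξ v : ℝ) : ℂ)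
      * Complex.I) * g ξ) := by
    intro v
    refine g.integrable.norm.mono' ?_ (Eventually.of_forall fun ξ => ?_)
    · exact Continuous.aestronglyMeasurable (by fun_prop)
    · rw [norm_mul, Complex.norm_exp_ofReal_mul_I, one_mul]
  rw [hF, secondDiff, Complex.ofReal_sub, Complex.ofReal_sub, Complex.ofReal_mul,
    Complex.ofReal_ofNat, hinv x, hinv (x + y), hinv (x - y), ← integral_const_mul,
    ← integral_sub ((hint x).const_mul 2) (hint _)]
  have j := integral_sub (((hint x).const_mul 2).sub (hint (x + y))) (hint (x - y))
  simp only [Pi.sub_apply] at j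
  rw [← j]
  refine integral_congr_ae (Eventually.of_forall fun ξ => ?_)
  have e := exp_add_exp_neg_eq (2 * Real.pi * inner ℝ ξ y)
  have e1 : Complex.exp (((2 * Real.pi * inner ℝ ξ (x + y) : ℝ) : ℂ) * Complex.I)
      = Complex.exp (((2 * Real.pi * inner ℝ ξ x : ℝ) : ℂ) * Complex.I)
        * Complex.exp (((2 * Real.pi * inner ℝ ξ y : ℝ) : ℂ) * Complex.I) := by
    rw [← Complex.exp_add, inner_add_right]; congr 1; push_cast; ring
  have e2 : Complex.exp (((2 * Real.pi * inner ℝ ξ (x - y) : ℝ) : ℂ) * Complex.I)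
      = Complex.exp (((2 * Real.pi * inner ℝ ξ x : ℝ) : ℂ) * Complex.I)
        * Complex.exp (((-(2 * Real.pi * inner ℝ ξ y) : ℝ) : ℂ) * Complex.I) := by
    rw [← Complex.exp_add, inner_sub_right]; congr 1; push_cast; ring
  simp only []
  rw [e1, e2, diffSymbol, real_inner_comm ξ y, Complex.ofReal_sub, Complex.ofReal_mul 2 (Real.cos _),
    Complex.ofReal_ofNat]
  linear_combination (-Complex.exp (((2 * Real.pi * inner ℝ ξ x : ℝ) : ℂ) * Complex.I)
    * g ξ) * e

/-- Insert the Fourier representation of the second difference and exchange the integrals;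
integrating the symbol against the kernel in y leaves c‖ξ‖^p. -/
lemma integral_secondDiff_eq [Nontrivial V] {p c : ℝ} (hp0 : 0 < p) (hp2 : p < 2)
    (hc : ∀ ξ : V, ∫ y, diffSymbol y ξ * fracKernel V p y = c * ‖ξ‖ ^ p)
    {ψ : V → ℝ} (hψ : ContDiff ℝ ∞ ψ) (hcs : HasCompactSupport ψ) (x : V) :
    ((∫ y, secondDiff ψ x y * fracKernel V p y : ℝ) : ℂ)
      = c * 𝓕⁻ (fun ξ : V => ((‖ξ‖ ^ p : ℝ) : ℂ) * 𝓕 (fun x : V => (ψ x : ℂ)) ξ) x := by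
  obtain ⟨g, hF, hgi⟩ := exists_schwartz_fourier_eq hψ hcs
  set G : V → V → ℂ := fun y ξ => Complex.exp (((2 * Real.pi * inner ℝ ξ x : ℝ) : ℂ) * Complex.I)
    * (((diffSymbol y ξ : ℝ) : ℂ) * g ξ) * ((fracKernel V p y : ℝ) : ℂ) with hG
  have hGn : ∀ y ξ, ‖G y ξ‖ = ‖g ξ‖ * (diffSymbol y ξ * fracKernel V p y) := by
    intro y ξ
    simp only [hG, norm_mul, Complex.norm_exp_ofReal_mul_I, Complex.norm_real,
      Real.norm_of_nonneg (fracKernel_nonneg p y), Real.norm_of_nonneg (diffSymbol_nonneg y ξ)]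
    ring
  have hmeas : AEStronglyMeasurable (Function.uncurry G) (volume.prod volume) := by
    refine AEStronglyMeasurable.mul ?_ ?_
    · have : Continuous fun q : V × V => diffSymbol q.1 q.2 := by unfold diffSymbol; fun_prop
      exact Continuous.aestronglyMeasurable (by fun_prop)
    · exact Measurable.aestronglyMeasurable
        (Complex.measurable_ofReal.comp ((measurable_fracKernel p).comp measurable_fst))
  have hGi : Integrable (Function.uncurry G) (volume.prod volume) := by
    rw [integrable_prod_iff' hmeas]
    refine ⟨Eventually.of_forall fun ξ => ?_, ?_⟩
    · have h : Integrable (fun y : V => ((diffSymbol y ξ * fracKernel V p y : ℝ) : ℂ)) :=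
        (integrable_diffSymbol_mul_fracKernel (V := V) hp0 hp2 ξ).ofReal
      convert h.const_mul (Complex.exp (((2 * Real.pi * inner ℝ ξ x : ℝ) : ℂ) * Complex.I)
        * g ξ) using 2 with y
      simp only [Function.uncurry, hG]
      push_cast
      ring
    -- By `hc` the y-integral of the absolute value is exactly c‖ξ‖^p‖g ξ‖.
    · have h := ((g.integrable_rpow_norm_mul hp0.le hp2.le).norm).const_mul c
      refine h.congr (Eventually.of_forall fun ξ => ?_)
      simp only [Function.uncurry, hGn, integral_const_mul, hc, norm_mul, Complex.norm_real,
        Real.norm_of_nonneg (Real.rpow_nonneg (norm_nonneg ξ) p)]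
      ring
  rw [← integral_complex_ofReal]
  calc ∫ y, ((secondDiff ψ x y * fracKernel V p y : ℝ) : ℂ) = ∫ y, ∫ ξ, G y ξ := by
        refine integral_congr_ae (Eventually.of_forall fun y => ?_)
        simp only [hG, integral_mul_const]
        rw [Complex.ofReal_mul, secondDiff_eq_integral hψ hcs, hF]
    _ = ∫ ξ, ∫ y, G y ξ := integral_integral_swap hGi
    _ = _ := by
        rw [Real.fourierInv_eq', ← integral_const_mul, hF]
        refine integral_congr_ae (Eventually.of_forall fun ξ => ?_)
        have e : ∀ y, G y ξ = (Complex.exp (((2 * Real.pi * inner ℝ ξ x : ℝ) : ℂ) * Complex.I)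
          * g ξ) * ((diffSymbol y ξ * fracKernel V p y : ℝ) : ℂ) := by
          intro y; simp only [hG]; push_cast; ring
        simp only [e, integral_const_mul, integral_complex_ofReal, hc]
        push_cast
        simp only [smul_eq_mul]
        ring

end FractionalKernel

/-- The fractional Laplacian of a test function is integrable. -/
lemma integrable_fracLaplacian {d : ℕ} (hd : 1 ≤ d) {s : ℝ} (hs0 : 0 < s) (hs1 : s ≤ 1)
    {ψ : EuclideanSpace ℝ (Fin d) → ℝ} (hψ : ContDiff ℝ ∞ ψ) (hc : HasCompactSupport ψ) :
    Integrable (fracLaplacian s ψ) := by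
  have : Nonempty (Fin d) := ⟨⟨0, hd⟩⟩
  -- For s < 1 the symbol need not be smooth at the origin, so decay is read off from the singular
  -- integral. At s = 1 the kernel estimate fails (p = 2), but the symbol is a polynomial and
  -- preserves Schwartz functions.
  rcases hs1.lt_or_eq with h1 | rfl
  · obtain ⟨c, hc0, hcc⟩ := exists_integral_diffSymbol_eq (V := EuclideanSpace ℝ (Fin d))
      (p := 2 * s) (by linarith) (by linarith)
    have hI := (integrable_secondDiff_mul_fracKernel (p := 2 * s) (by linarith) (by linarith)
      hψ hc).integral_prod_left
    refine (hI.const_mul ((2 * Real.pi) ^ (2 * s) / c)).congr (Eventually.of_forall fun x => ?_)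
    have h2 := integral_secondDiff_eq (p := 2 * s) (by linarith) (by linarith) hcc hψ hc x
    have h3 : (fun ξ : EuclideanSpace ℝ (Fin d) => (((2 * Real.pi * ‖ξ‖) ^ (2 * s) : ℝ) : ℂ) *
        𝓕 (fun x' : EuclideanSpace ℝ (Fin d) => (ψ x' : ℂ)) ξ)
        = (((2 * Real.pi) ^ (2 * s) : ℝ) : ℂ) • fun ξ => ((‖ξ‖ ^ (2 * s) : ℝ) : ℂ) *
        𝓕 (fun x' : EuclideanSpace ℝ (Fin d) => (ψ x' : ℂ)) ξ := by
      ext ξ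
      rw [Real.mul_rpow (by positivity) (norm_nonneg _)]
      simp [mul_assoc]
    have h4 : 𝓕⁻ (fun ξ : EuclideanSpace ℝ (Fin d) => (((2 * Real.pi * ‖ξ‖) ^ (2 * s) : ℝ) : ℂ) *
        𝓕 (fun x' : EuclideanSpace ℝ (Fin d) => (ψ x' : ℂ)) ξ) x
        = (((2 * Real.pi) ^ (2 * s) / c * ∫ y, secondDiff ψ x y * fracKernel _ (2 * s) y : ℝ) : ℂ)
        := by
      rw [Complex.ofReal_mul, h2, h3, Real.fourierInv_eq', Real.fourierInv_eq']
      simp only [Pi.smul_apply, smul_eq_mul]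
      rw [← integral_const_mul, ← integral_const_mul]
      refine integral_congr_ae (Eventually.of_forall fun ξ => ?_)
      have : (c : ℂ) ≠ 0 := by exact_mod_cast hc0.ne'
      push_cast
      field_simp
    rw [fracLaplacian, h4, Complex.ofReal_re]
  · obtain ⟨g, hF, -⟩ := exists_schwartz_fourier_eq hψ hc
    set m : EuclideanSpace ℝ (Fin d) → ℂ := fun ξ => (((2 * Real.pi) ^ 2 * ‖ξ‖ ^ 2 : ℝ) : ℂ)
    have hm : m.HasTemperateGrowth := by
      have h : Function.HasTemperateGrowth
          (fun ξ : EuclideanSpace ℝ (Fin d) => (2 * Real.pi) ^ 2 * ‖ξ‖ ^ 2) := by fun_prop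
      exact Function.HasTemperateGrowth.comp Complex.ofRealCLM.hasTemperateGrowth h
    have h3 : (fun ξ : EuclideanSpace ℝ (Fin d) => (((2 * Real.pi * ‖ξ‖) ^ (2 * (1 : ℝ)) : ℝ) : ℂ) *
        𝓕 (fun x' : EuclideanSpace ℝ (Fin d) => (ψ x' : ℂ)) ξ)
        = ⇑(SchwartzMap.smulLeftCLM ℂ m g) := by
      ext ξ
      rw [SchwartzMap.smulLeftCLM_apply_apply hm, hF, mul_one, Real.rpow_two]
      simp only [m, smul_eq_mul, mul_pow]
    have : fracLaplacian 1 ψ = fun x => (𝓕⁻ (SchwartzMap.smulLeftCLM ℂ m g) x).re := by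
      ext x
      rw [fracLaplacian, h3, SchwartzMap.fourierInv_coe]
    rw [this]
    exact (SchwartzMap.integrable (μ := volume) (𝓕⁻ (SchwartzMap.smulLeftCLM ℂ m g))).re

/-! ### Plane waves, their cutoffs, and the action of the symbol on a cutoff wave. -/

section PlaneWaves

variable {V : Type*} [NormedAddCommGroup V] [InnerProductSpace ℝ V] [FiniteDimensional ℝ V]
  [MeasurableSpace V] [BorelSpace V]

/-- The real plane wave `Re (a e^{2πi⟪x, ξ⟫})`. -/
noncomputable def planeWave (a : ℂ) (ξ x : V) : ℝ :=
  a.re * Real.cos (2 * Real.pi * inner ℝ x ξ) - a.im * Real.sin (2 * Real.pi * inner ℝ x ξ)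

lemma planeWave_eq_re (a : ℂ) (ξ x : V) : planeWave a ξ x
    = (a * Complex.exp (((2 * Real.pi * inner ℝ x ξ : ℝ) : ℂ) * Complex.I)).re := by
  rw [Complex.mul_re, Complex.exp_ofReal_mul_I_re, Complex.exp_ofReal_mul_I_im, planeWave]

lemma abs_planeWave_le (a : ℂ) (ξ x : V) : |planeWave a ξ x| ≤ ‖a‖ := by
  rw [planeWave_eq_re]
  refine (Complex.abs_re_le_norm _).trans ?_
  rw [norm_mul, Complex.norm_exp_ofReal_mul_I, mul_one]

lemma contDiff_planeWave (a : ℂ) (ξ : V) : ContDiff ℝ ∞ (planeWave a ξ) := by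
  have h : ContDiff ℝ ∞ (fun x : V => 2 * Real.pi * inner ℝ x ξ) :=
    contDiff_const.mul (contDiff_id.inner ℝ contDiff_const)
  exact (contDiff_const.mul (Real.contDiff_cos.comp h)).sub
    (contDiff_const.mul (Real.contDiff_sin.comp h))

lemma fderiv_planeWave (a : ℂ) (ξ x v : V) : fderiv ℝ (planeWave a ξ) x v
    = planeWave (a * Complex.I) ξ x * (2 * Real.pi * inner ℝ v ξ) := by
  have h : HasFDerivAt (fun x : V => 2 * Real.pi * inner ℝ x ξ)
      ((2 * Real.pi) • (innerSL ℝ ξ)) x := by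
    have := ((innerSL ℝ ξ).hasFDerivAt (x := x)).const_mul (2 * Real.pi)
    refine this.congr_of_eventuallyEq (Eventually.of_forall fun y => ?_)
    simp [real_inner_comm]
  have h2 := ((h.cos).const_mul a.re).sub ((h.sin).const_mul a.im)
  have h3 : HasFDerivAt (planeWave a ξ) _ x := h2
  rw [h3.fderiv]
  simp [planeWave, real_inner_comm ξ v]
  ring

lemma norm_fderiv_planeWave_le (a : ℂ) (ξ x : V) :
    ‖fderiv ℝ (planeWave a ξ) x‖ ≤ ‖a‖ * (2 * Real.pi * ‖ξ‖) := by
  refine ContinuousLinearMap.opNorm_le_bound _ (by positivity) fun v => ?_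
  rw [fderiv_planeWave, norm_mul, Real.norm_eq_abs, Real.norm_eq_abs, abs_mul,
    abs_of_pos Real.two_pi_pos]
  have h1 := abs_planeWave_le (a * Complex.I) ξ x
  rw [norm_mul, Complex.norm_I, mul_one] at h1
  have h2 := abs_real_inner_le_norm v ξ
  calc |planeWave (a * Complex.I) ξ x| * (2 * Real.pi * |inner ℝ v ξ|)
      ≤ ‖a‖ * (2 * Real.pi * (‖v‖ * ‖ξ‖)) := by gcongr
    _ = _ := by ring

/-- A smooth cutoff equal to `1` near the origin. -/
noncomputable def originBump (V : Type*) [NormedAddCommGroup V] [InnerProductSpace ℝ V] :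
    ContDiffBump (0 : V) := ⟨1, 2, one_pos, one_lt_two⟩

/-- The plane wave cut off at scale `r`. -/
noncomputable def cutoffWave (a : ℂ) (ξ : V) (r : ℝ) (x : V) : ℝ :=
  originBump V (r⁻¹ • x) * planeWave a ξ x

lemma contDiff_cutoffWave (a : ℂ) (ξ : V) (r : ℝ) : ContDiff ℝ ∞ (cutoffWave a ξ r) :=
  ((originBump V).contDiff.comp (contDiff_const_smul r⁻¹)).mul (contDiff_planeWave a ξ)

lemma hasCompactSupport_cutoffWave (a : ℂ) (ξ : V) {r : ℝ} (hr : r ≠ 0) :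
    HasCompactSupport (cutoffWave a ξ r) :=
  ((originBump V).hasCompactSupport.comp_smul (inv_ne_zero hr)).mul_right

lemma abs_cutoffWave_le (a : ℂ) (ξ : V) (r : ℝ) (x : V) : |cutoffWave a ξ r x| ≤ ‖a‖ := by
  rw [cutoffWave, abs_mul, abs_of_nonneg (originBump V).nonneg]
  exact (mul_le_of_le_one_left (abs_nonneg _) (originBump V).le_one).trans (abs_planeWave_le a ξ x)

lemma cutoffWave_eventuallyEq (a : ℂ) (ξ x : V) {r : ℝ} (hr : ‖x‖ < r) :
    cutoffWave a ξ r =ᶠ[𝓝 x] planeWave a ξ := by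
  have : ∀ᶠ y in 𝓝 x, ‖y‖ < r := (isOpen_lt continuous_norm continuous_const).mem_nhds hr
  filter_upwards [this] with y hy
  have h0 : 0 < r := (norm_nonneg y).trans_lt hy
  rw [cutoffWave, (originBump V).one_of_mem_closedBall, one_mul]
  rw [mem_closedBall_zero_iff, norm_smul, norm_inv, Real.norm_of_nonneg h0.le]
  rw [inv_mul_le_iff₀ h0]
  simpa [originBump] using hy.le

/-- Differentiating the cutoff costs a factor r⁻¹ ≤ 1, so the product rule gives a bound independent
of r. -/
lemma exists_norm_fderiv_cutoffWave_le (a : ℂ) (ξ : V) :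
    ∃ C, ∀ r : ℝ, 1 ≤ r → ∀ x, ‖fderiv ℝ (cutoffWave a ξ r) x‖ ≤ C := by
  have hχ : ContDiff ℝ ∞ (originBump V) := (originBump V).contDiff
  obtain ⟨B, hB⟩ := ((originBump V).hasCompactSupport.fderiv (𝕜 := ℝ)).exists_bound_of_continuous
    (hχ.continuous_fderiv (by simp))
  refine ⟨‖a‖ * (2 * Real.pi * ‖ξ‖) + ‖a‖ * B, fun r hr x => ?_⟩
  have hr0 : 0 < r := by linarith
  have h1 : DifferentiableAt ℝ (fun x => originBump V (r⁻¹ • x)) x :=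
    ((hχ.comp (contDiff_const_smul r⁻¹)).differentiable (by simp)).differentiableAt
  have h2 : DifferentiableAt ℝ (planeWave a ξ) x :=
    ((contDiff_planeWave a ξ).differentiable (by simp)).differentiableAt
  have h3 : fderiv ℝ (cutoffWave a ξ r) x = originBump V (r⁻¹ • x) • fderiv ℝ (planeWave a ξ) x
      + planeWave a ξ x • fderiv ℝ (fun x => originBump V (r⁻¹ • x)) x := fderiv_fun_mul h1 h2
  have h4 : ‖fderiv ℝ (fun x => originBump V (r⁻¹ • x)) x‖ ≤ B := by
    rw [fderiv_comp_smul, norm_smul, norm_inv, Real.norm_of_nonneg hr0.le]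
    exact (mul_le_of_le_one_left (norm_nonneg _) (inv_le_one_of_one_le₀ hr)).trans (hB _)
  rw [h3]
  refine (norm_add_le _ _).trans (add_le_add ?_ ?_)
  · rw [norm_smul, Real.norm_of_nonneg (originBump V).nonneg]
    exact (mul_le_of_le_one_left (norm_nonneg _) (originBump V).le_one).trans
      (norm_fderiv_planeWave_le a ξ x)
  · rw [norm_smul]
    exact mul_le_mul (abs_planeWave_le a ξ x) h4 (norm_nonneg _) (norm_nonneg _)

/-- The symbol `(2π‖ξ‖)^{2s}` of the fractional Laplacian. -/
noncomputable def fracSymbol (s : ℝ) (ξ : V) : ℝ := (2 * Real.pi * ‖ξ‖) ^ (2 * s)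

lemma fracSymbol_nonneg (s : ℝ) (ξ : V) : 0 ≤ fracSymbol s ξ :=
  Real.rpow_nonneg (by positivity) _

lemma continuous_fracSymbol {s : ℝ} (hs : 0 ≤ s) : Continuous (fracSymbol (V := V) s) :=
  (continuous_const.mul continuous_norm).rpow_const fun _ => Or.inr (by linarith)

lemma fracSymbol_neg (s : ℝ) (ξ : V) : fracSymbol s (-ξ) = fracSymbol s ξ := by
  simp [fracSymbol]

/-- The plane wave phase `e^{2πi⟪η, x⟫}`. -/
noncomputable def phase (η x : V) : ℂ :=
  Complex.exp (((2 * Real.pi * inner ℝ η x : ℝ) : ℂ) * Complex.I)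

lemma norm_phase (η x : V) : ‖phase η x‖ = 1 := Complex.norm_exp_ofReal_mul_I _

lemma continuous_phase : Continuous fun q : V × V => phase q.1 q.2 := by
  unfold phase; fun_prop

lemma phase_comm (η x : V) : phase η x = phase x η := by
  rw [phase, phase, real_inner_comm]

lemma fourier_eq_integral_phase (f : V → ℂ) (ξ : V) : 𝓕 f ξ = ∫ x, phase x (-ξ) * f x := by
  rw [Real.fourier_eq']
  refine integral_congr_ae (Eventually.of_forall fun x => ?_)
  simp only [phase, inner_neg_right, smul_eq_mul]
  congr 3; push_cast; ring

lemma fourierInv_eq_integral_phase (f : V → ℂ) (x : V) : 𝓕⁻ f x = ∫ ξ, phase ξ x * f ξ := by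
  rw [Real.fourierInv_eq']
  rfl

/-- The Fourier transform of a dilated and modulated function. -/
lemma fourier_dilation_mul_phase (f : V → ℂ) (ξ η : V) {r : ℝ} (hr : 0 < r) :
    𝓕 (fun x => f (r⁻¹ • x) * phase x ξ) η
      = ((r ^ Module.finrank ℝ V : ℝ) : ℂ) * 𝓕 f (r • (η - ξ)) := by
  rw [fourier_eq_integral_phase, fourier_eq_integral_phase]
  have h := Measure.integral_comp_inv_smul (volume : Measure V)
    (fun x => phase x (-(r • (η - ξ))) * f x) r
  rw [abs_of_pos (pow_pos hr _)] at h
  rw [Complex.real_smul] at h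
  rw [← h]
  refine integral_congr_ae (Eventually.of_forall fun x => ?_)
  have e : phase (r⁻¹ • x) (-(r • (η - ξ))) = phase x (-η) * phase x ξ := by
    rw [phase, phase, phase, ← Complex.exp_add]
    congr 1
    simp only [inner_smul_left, inner_neg_right, inner_smul_right, inner_sub_right]
    have : (r : ℂ) ≠ 0 := by exact_mod_cast hr.ne'
    simp only [conj_trivial]
    push_cast
    field_simp
    ring
  simp only [e]; ring

/-- The fractional Laplacian of the complex plane wave of frequency `ξ`, cut off by `g = 𝓕 χ`
at scale `r`. -/
noncomputable def cutoffSymbol (s : ℝ) (g : V → ℂ) (ξ : V) (r : ℝ) (x : V) : ℂ :=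
  ∫ ζ, phase (r⁻¹ • ζ + ξ) x * (((fracSymbol s (r⁻¹ • ζ + ξ) : ℝ) : ℂ) * g ζ)

lemma fracSymbol_le {s : ℝ} (hs0 : 0 ≤ s) (hs1 : s ≤ 1) (ξ : V) :
    fracSymbol s ξ ≤ 1 + (2 * Real.pi * ‖ξ‖) ^ 2 :=
  rpow_le_one_add_sq (by linarith) (by linarith) (by positivity)

/-- The bound depends neither on r ≥ 1 nor on x. It serves both as the uniform bound and as the
dominating function for r → ∞, since a symbol of order 2s ≤ 2 grows at most quadratically. -/
lemma norm_cutoffSymbol_integrand_le {s : ℝ} (hs0 : 0 ≤ s) (hs1 : s ≤ 1) (g : V → ℂ) (ξ ζ x : V)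
    {r : ℝ} (hr : 1 ≤ r) :
    ‖phase (r⁻¹ • ζ + ξ) x * (((fracSymbol s (r⁻¹ • ζ + ξ) : ℝ) : ℂ) * g ζ)‖
      ≤ (1 + 2 * (2 * Real.pi * ‖ξ‖) ^ 2) * ‖g ζ‖ + 2 * (2 * Real.pi) ^ 2 * (‖ζ‖ ^ 2 * ‖g ζ‖) := by
  rw [norm_mul, norm_phase, one_mul, norm_mul, Complex.norm_real,
    Real.norm_of_nonneg (fracSymbol_nonneg _ _)]
  have h1 : ‖r⁻¹ • ζ + ξ‖ ≤ ‖ζ‖ + ‖ξ‖ := by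
    refine (norm_add_le _ _).trans ?_
    gcongr
    rw [norm_smul, norm_inv, Real.norm_of_nonneg (by linarith)]
    exact mul_le_of_le_one_left (norm_nonneg _) (inv_le_one_of_one_le₀ hr)
  have h2 : ‖r⁻¹ • ζ + ξ‖ ^ 2 ≤ 2 * ‖ζ‖ ^ 2 + 2 * ‖ξ‖ ^ 2 := by
    have := pow_le_pow_left₀ (norm_nonneg _) h1 2
    nlinarith [sq_nonneg (‖ζ‖ - ‖ξ‖)]
  have h3 : fracSymbol s (r⁻¹ • ζ + ξ)
      ≤ (1 + 2 * (2 * Real.pi * ‖ξ‖) ^ 2) + 2 * (2 * Real.pi) ^ 2 * ‖ζ‖ ^ 2 := by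
    refine (fracSymbol_le hs0 hs1 _).trans ?_
    have := mul_le_mul_of_nonneg_left h2 (sq_nonneg (2 * Real.pi))
    nlinarith
  have := mul_le_mul_of_nonneg_right h3 (norm_nonneg (g ζ))
  linarith

lemma integrable_cutoffSymbol_bound (g : 𝓢(V, ℂ)) (ξ : V) :
    Integrable (fun ζ => (1 + 2 * (2 * Real.pi * ‖ξ‖) ^ 2) * ‖g ζ‖
      + 2 * (2 * Real.pi) ^ 2 * (‖ζ‖ ^ 2 * ‖g ζ‖)) :=
  (g.integrable.norm.const_mul _).add ((g.integrable_pow_mul volume 2).const_mul _)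

lemma continuous_cutoffSymbol_integrand {s : ℝ} (hs0 : 0 ≤ s) (g : 𝓢(V, ℂ)) (ξ x : V) (r : ℝ) :
    Continuous fun ζ =>
      phase (r⁻¹ • ζ + ξ) x * (((fracSymbol s (r⁻¹ • ζ + ξ) : ℝ) : ℂ) * g ζ) := by
  have h1 := (continuous_phase (V := V)).comp
    ((((continuous_const_smul r⁻¹).add (continuous_const (y := ξ)))).prodMk (continuous_const (y := x)))
  have h2 := (continuous_fracSymbol (V := V) hs0).comp
    ((continuous_const_smul r⁻¹).add (continuous_const (y := ξ)))
  exact h1.mul ((Complex.continuous_ofReal.comp h2).mul g.continuous)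

lemma integrable_cutoffSymbol_integrand {s : ℝ} (hs0 : 0 ≤ s) (hs1 : s ≤ 1) (g : 𝓢(V, ℂ))
    (ξ x : V) {r : ℝ} (hr : 1 ≤ r) :
    Integrable fun ζ =>
      phase (r⁻¹ • ζ + ξ) x * (((fracSymbol s (r⁻¹ • ζ + ξ) : ℝ) : ℂ) * g ζ) :=
  (integrable_cutoffSymbol_bound g ξ).mono'
    (continuous_cutoffSymbol_integrand hs0 g ξ x r).aestronglyMeasurable
    (Eventually.of_forall fun ζ => norm_cutoffSymbol_integrand_le hs0 hs1 g ξ ζ x hr)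

lemma exists_norm_cutoffSymbol_le {s : ℝ} (hs0 : 0 ≤ s) (hs1 : s ≤ 1) (g : 𝓢(V, ℂ)) (ξ : V) :
    ∃ C, ∀ r : ℝ, 1 ≤ r → ∀ x, ‖cutoffSymbol s g ξ r x‖ ≤ C :=
  ⟨_, fun _ hr x => norm_integral_le_of_norm_le (integrable_cutoffSymbol_bound g ξ)
    (Eventually.of_forall fun ζ => norm_cutoffSymbol_integrand_le hs0 hs1 g ξ ζ x hr)⟩

/-- As r → ∞ the frequencies r⁻¹ζ + ξ concentrate at ξ, so phase and symbol freeze there and only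
the mass of g remains. -/
lemma tendsto_cutoffSymbol {s : ℝ} (hs0 : 0 ≤ s) (hs1 : s ≤ 1) (g : 𝓢(V, ℂ)) (ξ x : V) :
    Tendsto (fun r => cutoffSymbol s g ξ r x) atTop
      (𝓝 (phase ξ x * (fracSymbol s ξ : ℂ) * ∫ ζ, g ζ)) := by
  rw [← integral_const_mul]
  refine tendsto_integral_filter_of_dominated_convergence _
    (Eventually.of_forall fun r =>
      (continuous_cutoffSymbol_integrand hs0 g ξ x r).aestronglyMeasurable)
    ((eventually_ge_atTop 1).mono fun r hr => Eventually.of_forall fun ζ =>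
      norm_cutoffSymbol_integrand_le hs0 hs1 g ξ ζ x hr)
    (integrable_cutoffSymbol_bound g ξ) (Eventually.of_forall fun ζ => ?_)
  have h0 : Tendsto (fun r : ℝ => r⁻¹ • ζ + ξ) atTop (𝓝 ξ) := by
    have := (tendsto_inv_atTop_zero (𝕜 := ℝ)).smul_const ζ
    simpa using this.add_const ξ
  have h1 : Tendsto (fun r : ℝ => phase (r⁻¹ • ζ + ξ) x) atTop (𝓝 (phase ξ x)) :=
    (((continuous_phase (V := V)).comp (continuous_id.prodMk (continuous_const (y := x)))).tendsto
      ξ).comp h0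
  have h2 : Tendsto (fun r : ℝ => ((fracSymbol s (r⁻¹ • ζ + ξ) : ℝ) : ℂ)) atTop
      (𝓝 (fracSymbol s ξ : ℂ)) :=
    ((Complex.continuous_ofReal.comp (continuous_fracSymbol (V := V) hs0)).tendsto ξ).comp h0
  rw [mul_assoc]
  exact h1.mul (h2.mul_const _)

/-- Change of variables η = r⁻¹ζ + ξ, whose Jacobian cancels the factor r^n. -/
lemma fourierInv_symbol_dilation (s : ℝ) (g : V → ℂ) (ξ x : V) {r : ℝ} (hr : 0 < r) :
    ∫ η, phase η x * (((fracSymbol s η : ℝ) : ℂ)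
      * (((r ^ Module.finrank ℝ V : ℝ) : ℂ) * g (r • (η - ξ)))) = cutoffSymbol s g ξ r x := by
  set H : V → ℂ := fun η => phase η x * (((fracSymbol s η : ℝ) : ℂ) * g (r • (η - ξ))) with hH
  have h := Measure.integral_comp_inv_smul (volume : Measure V) (fun ζ => H (ζ + ξ)) r
  rw [integral_add_right_eq_self H, abs_of_pos (pow_pos hr _), Complex.real_smul,
    ← integral_const_mul] at h
  have h2 : ∀ ζ, H (r⁻¹ • ζ + ξ)
      = phase (r⁻¹ • ζ + ξ) x * (((fracSymbol s (r⁻¹ • ζ + ξ) : ℝ) : ℂ) * g ζ) := by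
    intro ζ
    simp only [hH, add_sub_cancel_right, smul_smul, mul_inv_cancel₀ hr.ne', one_smul]
  simp only [h2] at h
  rw [cutoffSymbol, h]
  refine integral_congr_ae (Eventually.of_forall fun η => ?_)
  simp only [hH]; ring

lemma integrable_symbol_dilation {s : ℝ} (hs0 : 0 ≤ s) (hs1 : s ≤ 1) (g : 𝓢(V, ℂ))
    (ξ x : V) {r : ℝ} (hr : 1 ≤ r) :
    Integrable fun η => phase η x * (((fracSymbol s η : ℝ) : ℂ)
      * (((r ^ Module.finrank ℝ V : ℝ) : ℂ) * g (r • (η - ξ)))) := by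
  have hr0 : r ≠ 0 := by linarith
  have h := ((integrable_cutoffSymbol_integrand hs0 hs1 g ξ x hr).comp_smul hr0).comp_sub_right ξ
  refine (h.const_mul ((r ^ Module.finrank ℝ V : ℝ) : ℂ)).congr (Eventually.of_forall fun η => ?_)
  simp only [smul_smul, inv_mul_cancel₀ hr0, one_smul, sub_add_cancel]
  ring

end PlaneWaves

/-! ### The fractional Laplacian of cutoff plane waves and its limit. -/

section FracLaplacianWaves

variable {d : ℕ}

/-- A real wave is half the sum of a complex wave and its conjugate. After the cutoff their Fourier
transforms are rescaled copies of g centred at ξ and -ξ, to which the multiplier applies separately.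
-/
lemma fracLaplacian_cutoffWave {s : ℝ} (hs0 : 0 ≤ s) (hs1 : s ≤ 1) (a : ℂ)
    (ξ x : EuclideanSpace ℝ (Fin d)) {r : ℝ} (hr : 1 ≤ r) {g : 𝓢(EuclideanSpace ℝ (Fin d), ℂ)}
    (hg : 𝓕 (fun x => ((originBump (EuclideanSpace ℝ (Fin d)) x : ℝ) : ℂ)) = ⇑g) :
    fracLaplacian s (cutoffWave a ξ r) x = (2⁻¹ * (a * cutoffSymbol s g ξ r x
      + starRingEnd ℂ a * cutoffSymbol s g (-ξ) r x)).re := by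
  have hr0 : 0 < r := by linarith
  set χ : EuclideanSpace ℝ (Fin d) → ℂ :=
    fun x => ((originBump (EuclideanSpace ℝ (Fin d)) x : ℝ) : ℂ) with hχ
  have hconj : ∀ x, starRingEnd ℂ (phase x ξ) = phase x (-ξ) := by
    intro x
    rw [phase, phase, ← Complex.exp_conj, map_mul, Complex.conj_I, Complex.conj_ofReal,
      inner_neg_right]
    congr 1; push_cast; ring
  have h1 : (fun x => ((cutoffWave a ξ r x : ℝ) : ℂ))
      = fun x => (2⁻¹ * a) * (χ (r⁻¹ • x) * phase x ξ)
        + (2⁻¹ * starRingEnd ℂ a) * (χ (r⁻¹ • x) * phase x (-ξ)) := by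
    ext x
    have : ((planeWave a ξ x : ℝ) : ℂ)
        = 2⁻¹ * (a * phase x ξ + starRingEnd ℂ (a * phase x ξ)) := by
      rw [Complex.add_conj, planeWave_eq_re, phase]; push_cast; ring
    rw [cutoffWave, Complex.ofReal_mul, this, map_mul, hconj]
    simp only [hχ]; ring
  have hint : ∀ ξ, Integrable (fun x => χ (r⁻¹ • x) * phase x ξ) := by
    intro ξ
    have hcs : HasCompactSupport χ :=
      (originBump (EuclideanSpace ℝ (Fin d))).hasCompactSupport.comp_left Complex.ofReal_zero
    have hcs' : HasCompactSupport (fun x => χ (r⁻¹ • x) * phase x ξ) :=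
      (hcs.comp_smul (inv_ne_zero hr0.ne')).mul_right
    refine Continuous.integrable_of_hasCompactSupport ?_ hcs'
    have h1 : Continuous χ :=
      Complex.continuous_ofReal.comp (originBump (EuclideanSpace ℝ (Fin d))).continuous
    exact (h1.comp (continuous_const_smul _)).mul
      (continuous_phase.comp (continuous_id.prodMk continuous_const))
  have h2 : ∀ η, 𝓕 (fun x => ((cutoffWave a ξ r x : ℝ) : ℂ)) η
      = (2⁻¹ * a) * (((r ^ Module.finrank ℝ (EuclideanSpace ℝ (Fin d)) : ℝ) : ℂ)
          * g (r • (η - ξ)))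
        + (2⁻¹ * starRingEnd ℂ a) * (((r ^ Module.finrank ℝ (EuclideanSpace ℝ (Fin d)) : ℝ) : ℂ)
          * g (r • (η - -ξ))) := by
    intro η
    rw [← hg, ← fourier_dilation_mul_phase χ ξ η hr0, ← fourier_dilation_mul_phase χ (-ξ) η hr0,
      h1, fourier_eq_integral_phase, fourier_eq_integral_phase, fourier_eq_integral_phase,
      ← integral_const_mul, ← integral_const_mul, ← integral_add]
    · refine integral_congr_ae (Eventually.of_forall fun x => ?_)
      ring
    all_goals
      refine Integrable.const_mul ?_ _
      refine (hint _).bdd_mul (c := 1) ?_ (Eventually.of_forall fun x => (norm_phase _ _).le)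
      exact (continuous_phase.comp (continuous_id.prodMk continuous_const)).aestronglyMeasurable
  rw [fracLaplacian, fourierInv_eq_integral_phase]
  simp only [h2]
  congr 1
  rw [← fourierInv_symbol_dilation s g ξ x hr0, ← fourierInv_symbol_dilation s g (-ξ) x hr0,
    ← integral_const_mul, ← integral_const_mul, ← integral_add, ← integral_const_mul]
  · refine integral_congr_ae (Eventually.of_forall fun η => ?_)
    simp only [fracSymbol]; ring
  all_goals exact (integrable_symbol_dilation hs0 hs1 g _ x hr).const_mul _

/-- Plane waves are bounded limits of test functions, with convergence of gradients and of
fractional Laplacians. -/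
lemma fracLaplacian_cutoffWave_limit {s : ℝ} (hs0 : 0 ≤ s) (hs1 : s ≤ 1) (a : ℂ)
    (ξ : EuclideanSpace ℝ (Fin d)) :
    (∃ C, ∀ r : ℝ, 1 ≤ r → ∀ x, |fracLaplacian s (cutoffWave a ξ r) x| ≤ C) ∧
    ∀ x, Tendsto (fun r => fracLaplacian s (cutoffWave a ξ r) x) atTop
      (𝓝 (fracSymbol s ξ * planeWave a ξ x)) := by
  obtain ⟨g, hg, hgi⟩ := exists_schwartz_fourier_eq
    (ψ := originBump (EuclideanSpace ℝ (Fin d))) (originBump _).contDiff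
    (originBump _).hasCompactSupport
  -- Fourier inversion at 0: the mass of g is the value of the cutoff at the origin.
  have hg1 : ∫ ζ, g ζ = 1 := by
    have := hgi 0
    rw [fourierInv_eq_integral_phase, (originBump _).one_of_mem_closedBall] at this
    · simpa [phase] using this
    · simp [originBump]
  constructor
  · obtain ⟨C₁, h₁⟩ := exists_norm_cutoffSymbol_le hs0 hs1 g ξ
    obtain ⟨C₂, h₂⟩ := exists_norm_cutoffSymbol_le hs0 hs1 g (-ξ)
    refine ⟨2⁻¹ * (‖a‖ * C₁ + ‖a‖ * C₂), fun r hr x => ?_⟩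
    rw [fracLaplacian_cutoffWave hs0 hs1 a ξ x hr hg]
    refine (Complex.abs_re_le_norm _).trans ?_
    rw [norm_mul, norm_inv, Complex.norm_ofNat]
    gcongr
    refine (norm_add_le _ _).trans ?_
    rw [norm_mul, norm_mul, RCLike.norm_conj]
    gcongr
    · exact h₁ r hr x
    · exact h₂ r hr x
  · intro x
    have h1 := tendsto_cutoffSymbol hs0 hs1 g ξ x
    have h2 := tendsto_cutoffSymbol hs0 hs1 g (-ξ) x
    rw [hg1, mul_one] at h1 h2
    have h3 := (((h1.const_mul a).add (h2.const_mul (starRingEnd ℂ a))).const_mul (2⁻¹ : ℂ))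
    have h4 := (Complex.continuous_re.tendsto _).comp h3
    have hlim : (2⁻¹ * (a * (phase ξ x * (fracSymbol s ξ : ℂ))
        + starRingEnd ℂ a * (phase (-ξ) x * (fracSymbol s (-ξ) : ℂ)))).re
        = fracSymbol s ξ * planeWave a ξ x := by
      have e : phase (-ξ) x = starRingEnd ℂ (phase ξ x) := by
        rw [phase, phase, ← Complex.exp_conj, map_mul, Complex.conj_I, Complex.conj_ofReal,
          inner_neg_left]
        congr 1; push_cast; ring
      have e2 : (2⁻¹ * (a * (phase ξ x * (fracSymbol s ξ : ℂ))
        + starRingEnd ℂ a * (starRingEnd ℂ (phase ξ x) * (fracSymbol s ξ : ℂ))))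
          = ((fracSymbol s ξ * (a * phase ξ x).re : ℝ) : ℂ) := by
        have := Complex.add_conj (a * phase ξ x)
        rw [map_mul] at this
        rw [Complex.ofReal_mul]
        push_cast at this
        linear_combination (2⁻¹ * (fracSymbol s ξ : ℂ)) * this
      rw [e, fracSymbol_neg, e2, Complex.ofReal_re, planeWave_eq_re, phase_comm, phase]
    rw [← hlim]
    refine h4.congr' ((eventually_ge_atTop 1).mono fun r hr => ?_)
    exact (fracLaplacian_cutoffWave hs0 hs1 a ξ x hr hg).symm

end FracLaplacianWaves

/-! ### Weak derivatives in time, primitives, and the weighted energy inequality. -/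

section TimeDependence

lemma exists_Icc_subset_Ioo_of_isCompact {K : Set ℝ} {a b : ℝ} (hab : a < b) (hK : IsCompact K)
    (hKab : K ⊆ Ioo a b) : ∃ a' b', a < a' ∧ a' < b' ∧ b' < b ∧ K ⊆ Icc a' b' := by
  rcases K.eq_empty_or_nonempty with rfl | hne
  · exact ⟨(2 * a + b) / 3, (a + 2 * b) / 3, by linarith, by linarith, by linarith, empty_subset _⟩
  · have h1 := hKab (hK.sInf_mem hne)
    have h2 := hKab (hK.sSup_mem hne)
    have h3 : sInf K ≤ sSup K := csInf_le hK.bddBelow (hK.sSup_mem hne)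
    refine ⟨(a + sInf K) / 2, (b + sSup K) / 2, by linarith [h1.1], ?_, by linarith [h2.2], ?_⟩
    · linarith [h1.1, h2.2]
    · intro x hx
      have h4 := csInf_le hK.bddBelow hx
      have h5 := le_csSup hK.bddAbove hx
      constructor <;> linarith [h1.1, h2.2]

/-- A test function on `(0,T)` with zero mean has a primitive that is a test function. -/
lemma exists_primitive_test {T : ℝ} (hT : 0 < T) {θ : ℝ → ℝ} (hθ : ContDiff ℝ ∞ θ)
    (hc : HasCompactSupport θ) (hs : tsupport θ ⊆ Ioo 0 T) (h0 : ∫ t, θ t = 0) :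
    ∃ η : ℝ → ℝ, ContDiff ℝ ∞ η ∧ HasCompactSupport η ∧ tsupport η ⊆ Ioo 0 T ∧
      deriv η = θ := by
  obtain ⟨a, b, ha, hab, hb, hK⟩ := exists_Icc_subset_Ioo_of_isCompact hT hc.isCompact hs
  have hcont := hθ.continuous
  have hzero : ∀ t, t ∉ Icc a b → θ t = 0 := fun t ht =>
    image_eq_zero_of_notMem_tsupport fun h => ht (hK h)
  set η : ℝ → ℝ := fun t => ∫ r in (0 : ℝ)..t, θ r with hη
  have hderiv : ∀ t, HasDerivAt η (θ t) t := fun t =>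
    intervalIntegral.integral_hasDerivAt_right (hcont.intervalIntegrable _ _)
      hcont.aestronglyMeasurable.stronglyMeasurableAtFilter hcont.continuousAt
  have hd : deriv η = θ := funext fun t => (hderiv t).deriv
  have hsupp : Function.support η ⊆ Icc a b := by
    intro t ht
    by_contra hcon
    apply ht
    rcases lt_or_ge t a with h | h
    · simp only [hη]
      rw [intervalIntegral.integral_congr (g := fun _ => 0)]
      · simp
      · intro r hr
        refine hzero r fun h' => ?_
        rcases le_total 0 t with h0t | h0t
        · rw [uIcc_of_le h0t] at hr; linarith [hr.2, h'.1]
        · rw [uIcc_of_ge h0t] at hr; linarith [hr.2, h'.1]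
    · have htb : b < t := by
        by_contra h'; exact hcon ⟨h, not_lt.1 h'⟩
      simp only [hη]
      -- To the right of b the primitive has collected the whole integral of θ, which is zero.
      rw [intervalIntegral.integral_of_le (by linarith), ← h0]
      refine setIntegral_eq_integral_of_forall_compl_eq_zero fun r hr => hzero r fun h' => hr ?_
      exact ⟨by linarith [h'.1], by linarith [h'.2]⟩
  have htsupp : tsupport η ⊆ Icc a b := closure_minimal hsupp isClosed_Icc
  refine ⟨η, ?_, HasCompactSupport.of_support_subset_isCompact isCompact_Icc hsupp,
    htsupp.trans fun t ht => ⟨ha.trans_le ht.1, ht.2.trans_lt hb⟩, hd⟩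
  rw [contDiff_infty_iff_deriv, hd]
  exact ⟨fun t => (hderiv t).differentiableAt, hθ⟩

lemma exists_unit_mass_test {T : ℝ} (hT : 0 < T) : ∃ ρ : ℝ → ℝ, ContDiff ℝ ∞ ρ ∧
    HasCompactSupport ρ ∧ tsupport ρ ⊆ Ioo 0 T ∧ ∫ t, ρ t = 1 := by
  let B : ContDiffBump (T / 2) := ⟨T / 8, T / 4, by positivity, by linarith⟩
  refine ⟨B.normed volume, B.contDiff_normed, B.hasCompactSupport_normed, ?_, B.integral_normed⟩
  rw [B.tsupport_normed_eq, Real.closedBall_eq_Icc]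
  intro t ht
  constructor <;> simp only [B] at ht <;> linarith [ht.1, ht.2]

lemma intervalIntegrable_of_integrableOn_Ioo {E : Type*} [NormedAddCommGroup E] {T : ℝ}
    (hT : 0 < T) {v : ℝ → E} (hv : IntegrableOn v (Ioo 0 T)) : IntervalIntegrable v volume 0 T := by
  rw [intervalIntegrable_iff_integrableOn_Ioc_of_le hT.le]
  exact hv.congr_set_ae Ioo_ae_eq_Ioc.symm

lemma integral_Ioo_eq_intervalIntegral {T : ℝ} (hT : 0 < T) (f : ℝ → ℝ) :
    ∫ t in Ioo 0 T, f t = ∫ t in (0 : ℝ)..T, f t := by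
  rw [intervalIntegral.integral_of_le hT.le, integral_Ioc_eq_integral_Ioo]

lemma continuousOn_primitive_Icc {T : ℝ} (hT : 0 < T) {v : ℝ → ℝ} (hv : IntegrableOn v (Ioo 0 T)) :
    ContinuousOn (fun t => ∫ r in (0 : ℝ)..t, v r) (Icc 0 T) := by
  have := ((intervalIntegrable_of_integrableOn_Ioo hT hv).absolutelyContinuousOnInterval_intervalIntegral
    (c := 0) left_mem_uIcc).continuousOn
  rwa [uIcc_of_le hT.le] at this

lemma absolutelyContinuousOnInterval_primitive {T : ℝ} (hT : 0 < T) {v : ℝ → ℝ}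
    (hv : IntegrableOn v (Ioo 0 T)) :
    AbsolutelyContinuousOnInterval (fun t => ∫ r in (0 : ℝ)..t, v r) 0 T :=
  (intervalIntegrable_of_integrableOn_Ioo hT hv).absolutelyContinuousOnInterval_intervalIntegral
    left_mem_uIcc

lemma ae_hasDerivAt_primitive {T : ℝ} (hT : 0 < T) {v : ℝ → ℝ} (hv : IntegrableOn v (Ioo 0 T)) :
    ∀ᵐ t, t ∈ Ioo 0 T → HasDerivAt (fun t => ∫ r in (0 : ℝ)..t, v r) (v t) t := by
  filter_upwards [(intervalIntegrable_of_integrableOn_Ioo hT hv).ae_hasDerivAt_integral] with t ht h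
  refine ht ?_ 0 left_mem_uIcc
  rw [uIcc_of_le hT.le]; exact Ioo_subset_Icc_self h

/-- Integration by parts of a primitive against a test function. -/
lemma integral_primitive_mul_deriv_test {T : ℝ} (hT : 0 < T) {v : ℝ → ℝ}
    (hv : IntegrableOn v (Ioo 0 T)) {η : ℝ → ℝ} (hη : ContDiff ℝ ∞ η)
    (hs : tsupport η ⊆ Ioo 0 T) :
    ∫ t in Ioo 0 T, (∫ r in (0 : ℝ)..t, v r) * deriv η t = -∫ t in Ioo 0 T, v t * η t := by
  have hη' : AbsolutelyContinuousOnInterval η 0 T :=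
    (hη.of_le (by simp)).contDiffOn.absolutelyContinuousOnInterval
  have h := AbsolutelyContinuousOnInterval.integral_mul_deriv_eq_deriv_mul
    (absolutelyContinuousOnInterval_primitive hT hv) hη'
  have e1 : η T = 0 := image_eq_zero_of_notMem_tsupport fun h => lt_irrefl T (hs h).2
  rw [e1, intervalIntegral.integral_same] at h
  simp only [mul_zero, zero_mul, sub_zero, zero_sub] at h
  rw [integral_Ioo_eq_intervalIntegral hT, h, ← integral_Ioo_eq_intervalIntegral hT, neg_inj]
  refine setIntegral_congr_ae measurableSet_Ioo ?_
  filter_upwards [ae_hasDerivAt_primitive hT hv] with t ht hmem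
  rw [(ht hmem).deriv]

/-- If `f' = v` weakly on `(0,T)` and `f` has essential limit `0` at `0+`, then `f` is the primitive
of `v` vanishing at `0`. -/
lemma ae_eq_primitive_of_weak_deriv {T : ℝ} (hT : 0 < T) {f v : ℝ → ℝ}
    (hf : IntegrableOn f (Ioo 0 T)) (hv : IntegrableOn v (Ioo 0 T))
    (hweak : ∀ η : ℝ → ℝ, ContDiff ℝ ∞ η → HasCompactSupport η → tsupport η ⊆ Ioo 0 T →
      ∫ t in Ioo 0 T, (f t * deriv η t + v t * η t) = 0)
    (h0 : Tendsto (fun t : ℝ => essSup (fun r : ℝ => ‖f r‖ₑ) (volume.restrict (Ioo 0 t)))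
      (𝓝[>] 0) (𝓝 0)) :
    ∀ᵐ t, t ∈ Ioo 0 T → f t = ∫ r in (0 : ℝ)..t, v r := by
  set Q : ℝ → ℝ := fun t => ∫ r in (0 : ℝ)..t, v r with hQ
  have hQc : ContinuousOn Q (Icc 0 T) := continuousOn_primitive_Icc hT hv
  have hQi : IntegrableOn Q (Ioo 0 T) := (hQc.integrableOn_Icc).mono_set Ioo_subset_Icc_self
  set g : ℝ → ℝ := fun t => f t - Q t with hg
  have hgi : IntegrableOn g (Ioo 0 T) := hf.sub hQi
  have hmul : ∀ {h η : ℝ → ℝ}, IntegrableOn h (Ioo 0 T) → Continuous η → HasCompactSupport η →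
      IntegrableOn (fun t => h t * η t) (Ioo 0 T) := by
    intro h η hh hη hc
    obtain ⟨C, hC⟩ := hc.exists_bound_of_continuous hη
    exact hh.mul_bdd (c := C) hη.aestronglyMeasurable (Eventually.of_forall hC)
  have hg0 : ∀ η : ℝ → ℝ, ContDiff ℝ ∞ η → HasCompactSupport η → tsupport η ⊆ Ioo 0 T →
      ∫ t in Ioo 0 T, g t * deriv η t = 0 := by
    intro η h1 h2 h3
    have hd : Continuous (deriv η) := h1.continuous_deriv (by simp)
    have e := hweak η h1 h2 h3
    rw [integral_add (hmul hf hd h2.deriv) (hmul hv h1.continuous h2)] at e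
    have e2 := integral_primitive_mul_deriv_test hT hv h1 h3
    simp only [hg, sub_mul]
    rw [integral_sub (hmul hf hd h2.deriv) (hmul hQi hd h2.deriv)]
    simp only [hQ]
    rw [e2]; linarith
  obtain ⟨ρ, hρ, hρc, hρs, hρ1⟩ := exists_unit_mass_test hT
  set c : ℝ := ∫ t in Ioo 0 T, g t * ρ t with hcdef
  -- The du Bois-Reymond argument: subtracting from a test function θ its mass times ρ leaves the
  -- derivative of a test function, to which g is orthogonal; hence g - c is orthogonal to every θ.
  have hgc : ∀ᵐ t, t ∈ Ioo 0 T → g t - c = 0 := by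
    refine isOpen_Ioo.ae_eq_zero_of_integral_contDiff_smul_eq_zero
      ((hgi.sub (integrableOn_const (by simp))).locallyIntegrableOn) fun θ h1 h2 h3 => ?_
    have hθi : Integrable θ := h1.continuous.integrable_of_hasCompactSupport h2
    have hρi : Integrable ρ := hρ.continuous.integrable_of_hasCompactSupport hρc
    obtain ⟨η, k1, k2, k3, k4⟩ := exists_primitive_test hT
      (θ := fun t => θ t - (∫ r, θ r) * ρ t) (h1.sub (contDiff_const.mul hρ))
      (h2.sub (hρc.mul_left)) ((tsupport_sub _ _).trans (union_subset h3
        ((tsupport_mul_subset_right).trans hρs)))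
      (by rw [integral_sub hθi (hρi.const_mul _), integral_const_mul, hρ1]; ring)
    have e := hg0 η k1 k2 k3
    rw [k4] at e
    have e1 : ∀ t, g t * (θ t - (∫ r, θ r) * ρ t) = g t * θ t - (∫ r, θ r) * (g t * ρ t) :=
      fun t => by ring
    simp only [e1] at e
    rw [integral_sub (hmul hgi h1.continuous h2) ((hmul hgi hρ.continuous hρc).const_mul _),
      integral_const_mul] at e
    have e2 : ∫ t, θ t = ∫ t in Ioo 0 T, θ t :=
      (setIntegral_eq_integral_of_forall_compl_eq_zero fun r hr =>
        image_eq_zero_of_notMem_tsupport fun h => hr (h3 h)).symm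
    have e3 : ∫ t, θ t • (g t - c) = ∫ t in Ioo 0 T, θ t • (g t - c) :=
      (setIntegral_eq_integral_of_forall_compl_eq_zero fun r hr => by
        rw [image_eq_zero_of_notMem_tsupport fun h => hr (h3 h), zero_smul]).symm
    have e4 : ∀ t, θ t • (g t - c) = g t * θ t - c * θ t := fun t => by
      rw [smul_eq_mul]; ring
    rw [e3]
    simp only [e4]
    rw [integral_sub (hmul hgi h1.continuous h2) (hθi.integrableOn.const_mul _),
      integral_const_mul, ← e2]
    linarith
  -- If c ≠ 0, then for small t both |f| and |Q| are below |c|/3 at almost every point of (0, t),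
  -- contradicting f - Q = c there.
  have hc0 : c = 0 := by
    by_contra hne
    set ε := |c| / 3 with hε
    have hcpos : 0 < |c| := abs_pos.2 hne
    have hε0 : 0 < ε := by positivity
    have h1 : ∀ᶠ t in 𝓝[>] (0 : ℝ), essSup (fun r : ℝ => ‖f r‖ₑ) (volume.restrict (Ioo 0 t))
        < ENNReal.ofReal ε := h0.eventually_lt_const (by simpa using hε0)
    have hQ0 : Q 0 = 0 := by simp [hQ]
    have h2 : ∀ᶠ t in 𝓝[Icc 0 T] (0 : ℝ), |Q t| < ε := by
      have h : Tendsto (fun t => |Q t|) (𝓝[Icc 0 T] 0) (𝓝 |Q 0|) := (hQc 0 ⟨le_rfl, hT.le⟩).abs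
      exact h.eventually_lt_const (by simpa [hQ0] using hε0)
    obtain ⟨δ, hδ, hδ2⟩ := Metric.mem_nhdsWithin_iff.1 h2
    obtain ⟨t, ht, htpos, htT, htδ⟩ := (h1.and ((eventually_mem_nhdsWithin).and
      ((((eventually_lt_nhds hT).and (eventually_lt_nhds hδ)).filter_mono
        nhdsWithin_le_nhds)))).exists
    have htpos : 0 < t := htpos
    have h3 : ∀ᵐ r ∂(volume.restrict (Ioo 0 t)), ‖f r‖ₑ < ENNReal.ofReal ε :=
      ae_lt_of_essSup_lt ht
    have h4 : ∀ᵐ r ∂(volume.restrict (Ioo 0 t)), g r - c = 0 := by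
      rw [ae_restrict_iff' measurableSet_Ioo]
      filter_upwards [hgc] with r hr h
      exact hr ⟨h.1, h.2.trans htT⟩
    have hne' : NeBot (ae (volume.restrict (Ioo (0 : ℝ) t))) := by
      rw [ae_neBot, Ne, Measure.restrict_eq_zero, Real.volume_Ioo]
      simpa using htpos
    obtain ⟨r, hr1, hr2, hr3⟩ := (h3.and (h4.and (ae_restrict_mem measurableSet_Ioo))).exists
    have hr4 : |Q r| < ε := hδ2 ⟨by
      rw [Metric.mem_ball, Real.dist_eq, sub_zero, abs_of_pos hr3.1]; linarith [hr3.2],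
      hr3.1.le, by linarith [hr3.2]⟩
    have hr5 : |f r| < ε := by
      rwa [← ofReal_norm, ENNReal.ofReal_lt_ofReal_iff hε0, Real.norm_eq_abs] at hr1
    have : |c| ≤ |f r| + |Q r| := by
      have : c = f r - Q r := by simp only [hg] at hr2; linarith
      rw [this]; exact abs_sub _ _
    linarith
  filter_upwards [hgc] with t ht h
  have := ht h
  rw [hc0] at this
  simp only [hg] at this
  linarith

lemma integrableOn_exp_mul_of_continuousOn {T : ℝ} {f h : ℝ → ℝ} (lam : ℝ)
    (hf : ContinuousOn f (Icc 0 T)) (hh : IntegrableOn h (Ioo 0 T)) :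
    IntegrableOn (fun t => Real.exp (-lam * t) * (f t * h t)) (Ioo 0 T) := by
  have hc : ContinuousOn (fun t => Real.exp (-lam * t) * f t) (Icc 0 T) := by fun_prop
  obtain ⟨C, hC⟩ := isCompact_Icc.exists_bound_of_continuousOn hc
  have := hh.bdd_mul (c := C) (f := fun t => Real.exp (-lam * t) * f t)
    ((hc.mono Ioo_subset_Icc_self).aestronglyMeasurable measurableSet_Ioo)
    ((ae_restrict_mem measurableSet_Ioo).mono fun t ht => hC t (Ioo_subset_Icc_self ht))
  refine this.congr (Eventually.of_forall fun t => ?_)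
  ring

/-- Exponentially weighted energy inequality for a primitive vanishing at `0`. -/
lemma energy_primitive_real {T : ℝ} (hT : 0 < T) {v Z : ℝ → ℝ} (hv : IntegrableOn v (Ioo 0 T))
    (hZ : ∀ᵐ t, t ∈ Ioo 0 T → Z t = ∫ r in (0 : ℝ)..t, v r) (lam : ℝ) :
    IntegrableOn (fun t => Real.exp (-lam * t) * Z t ^ 2) (Ioo 0 T) ∧
    IntegrableOn (fun t => Real.exp (-lam * t) * (Z t * v t)) (Ioo 0 T) ∧
    lam * ∫ t in Ioo 0 T, Real.exp (-lam * t) * Z t ^ 2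
      ≤ ∫ t in Ioo 0 T, 2 * (Real.exp (-lam * t) * (Z t * v t)) := by
  set Q : ℝ → ℝ := fun t => ∫ r in (0 : ℝ)..t, v r with hQ
  have hQc : ContinuousOn Q (Icc 0 T) := continuousOn_primitive_Icc hT hv
  have hQi : IntegrableOn Q (Ioo 0 T) := (hQc.integrableOn_Icc).mono_set Ioo_subset_Icc_self
  have i1 := integrableOn_exp_mul_of_continuousOn lam hQc hQi
  have i2 := integrableOn_exp_mul_of_continuousOn lam hQc hv
  have hZ' : ∀ᵐ t ∂(volume.restrict (Ioo 0 T)), Z t = Q t :=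
    (ae_restrict_iff' measurableSet_Ioo).2 hZ
  have c1 : (fun t => Real.exp (-lam * t) * Z t ^ 2) =ᵐ[volume.restrict (Ioo 0 T)]
      fun t => Real.exp (-lam * t) * (Q t * Q t) := by
    filter_upwards [hZ'] with t ht; rw [ht, sq]
  have c2 : (fun t => Real.exp (-lam * t) * (Z t * v t)) =ᵐ[volume.restrict (Ioo 0 T)]
      fun t => Real.exp (-lam * t) * (Q t * v t) := by
    filter_upwards [hZ'] with t ht; rw [ht]
  refine ⟨i1.congr c1.symm, i2.congr c2.symm, ?_⟩
  rw [integral_congr_ae c1, integral_const_mul, integral_congr_ae c2]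
  -- Absolute continuity lets the fundamental theorem of calculus be applied to e^{-λt}Q², although
  -- Q is differentiable only almost everywhere.
  have hac : AbsolutelyContinuousOnInterval (fun t => Real.exp (-lam * t) * (Q t * Q t)) 0 T := by
    have h1 : AbsolutelyContinuousOnInterval (fun t => Real.exp (-lam * t)) 0 T := by
      refine ContDiffOn.absolutelyContinuousOnInterval (ContDiff.contDiffOn ?_)
      fun_prop
    have h2 := absolutelyContinuousOnInterval_primitive hT hv
    exact h1.fun_mul (h2.fun_mul h2)
  have h := hac.integral_deriv_eq_sub
  have hQ0 : Q 0 = 0 := by simp [hQ]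
  rw [← integral_Ioo_eq_intervalIntegral hT] at h
  have hcongr : ∫ t in Ioo 0 T, deriv (fun t => Real.exp (-lam * t) * (Q t * Q t)) t
      = ∫ t in Ioo 0 T, (2 * (Real.exp (-lam * t) * (Q t * v t))
          - lam * (Real.exp (-lam * t) * (Q t * Q t))) := by
    refine setIntegral_congr_ae measurableSet_Ioo ?_
    filter_upwards [ae_hasDerivAt_primitive hT hv] with t ht h
    have d1 : HasDerivAt (fun t => Real.exp (-lam * t)) (Real.exp (-lam * t) * (-lam)) t := by
      have := ((hasDerivAt_id t).const_mul (-lam)).exp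
      simpa using this
    have d2 := d1.mul ((ht h).mul (ht h))
    rw [show deriv (fun t => Real.exp (-lam * t) * (Q t * Q t)) t = _ from d2.deriv]
    simp only [hQ, Pi.mul_apply]; ring
  rw [hcongr, integral_sub (i2.const_mul 2) (i1.const_mul lam), integral_const_mul,
    integral_const_mul] at h
  -- The boundary term at T has a favourable sign and is dropped; the one at 0 vanishes.
  have : 0 ≤ Real.exp (-lam * T) * (Q T * Q T) :=
    mul_nonneg (Real.exp_nonneg _) (mul_self_nonneg _)
  rw [hQ0] at h
  linarith

lemma energy_primitive_complex {T : ℝ} (hT : 0 < T) {v Z : ℝ → ℂ} (hv : IntegrableOn v (Ioo 0 T))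
    (hre : ∀ᵐ t, t ∈ Ioo 0 T → (Z t).re = ∫ r in (0 : ℝ)..t, (v r).re)
    (him : ∀ᵐ t, t ∈ Ioo 0 T → (Z t).im = ∫ r in (0 : ℝ)..t, (v r).im) (lam : ℝ) :
    lam * ∫ t in Ioo 0 T, Real.exp (-lam * t) * ‖Z t‖ ^ 2
      ≤ ∫ t in Ioo 0 T, 2 * (Real.exp (-lam * t) * (starRingEnd ℂ (Z t) * v t).re) := by
  obtain ⟨a1, a2, a3⟩ := energy_primitive_real hT (v := fun t => (v t).re) hv.re hre lam
  obtain ⟨b1, b2, b3⟩ := energy_primitive_real hT (v := fun t => (v t).im) hv.im him lam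
  have e1 : ∀ t, Real.exp (-lam * t) * ‖Z t‖ ^ 2 = Real.exp (-lam * t) * (Z t).re ^ 2
      + Real.exp (-lam * t) * (Z t).im ^ 2 := by
    intro t; rw [← Complex.normSq_eq_norm_sq, Complex.normSq_apply]; ring
  have e2 : ∀ t, 2 * (Real.exp (-lam * t) * (starRingEnd ℂ (Z t) * v t).re)
      = 2 * (Real.exp (-lam * t) * ((Z t).re * (v t).re))
      + 2 * (Real.exp (-lam * t) * ((Z t).im * (v t).im)) := by
    intro t; rw [Complex.mul_re, Complex.conj_re, Complex.conj_im]; ring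
  simp only [e1, e2]
  rw [integral_add a1 b1, integral_add (a2.const_mul 2) (b2.const_mul 2), mul_add]
  exact add_le_add a3 b3

end TimeDependence

/-! ### Plancherel's theorem for Fourier integrals and for the partial Fourier transform in space.
-/

section Plancherel

variable {V : Type*} [NormedAddCommGroup V] [InnerProductSpace ℝ V] [FiniteDimensional ℝ V]
  [MeasurableSpace V] [BorelSpace V]

lemma continuous_fourier_of_integrable {f : V → ℂ} (hf : Integrable f) : Continuous (𝓕 f) :=
  VectorFourier.fourierIntegral_continuous Real.continuous_fourierChar
    (by exact continuous_inner) hf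

/-- The `L²` Fourier transform of `f ∈ L¹ ∩ L²` is given by the Fourier integral. -/
lemma coeFn_fourier_toLp {f : V → ℂ} (hf : Integrable f) (hf2 : MemLp f 2) :
    ⇑(𝓕 (hf2.toLp f) : Lp ℂ 2 (volume : Measure V)) =ᵐ[volume] 𝓕 f := by
  refine ae_eq_of_integral_contDiff_smul_eq
    ((Lp.memLp _).locallyIntegrable (by norm_num))
    (continuous_fourier_of_integrable hf).locallyIntegrable fun φ hφ hc => ?_
  set φS : 𝓢(V, ℂ) := realToSchwartz φ hφ hc
  -- Both transforms are compared as tempered distributions: against a test function, the Fourier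
  -- transform can be moved onto it in either definition.
  have h := congrArg (fun (u : 𝓢'(V, ℂ)) => u φS) (Lp.fourier_toTemperedDistribution_eq (hf2.toLp f))
  simp only [TemperedDistribution.fourier_apply, Lp.toTemperedDistribution_apply] at h
  have e1 : ∫ x, (𝓕 φS) x • (hf2.toLp f) x = ∫ x, (𝓕 φS) x • f x := by
    refine integral_congr_ae ?_
    filter_upwards [hf2.coeFn_toLp] with x hx
    rw [hx]
  have e2 : ∫ x, (𝓕 φS) x • f x = ∫ x, φS x • 𝓕 f x := by
    have := VectorFourier.integral_fourierIntegral_smul_eq_flip (L := innerₗ V)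
      (μ := volume) (ν := volume) Real.continuous_fourierChar continuous_inner φS.integrable hf
    rw [flip_innerₗ] at this
    exact this
  rw [e1, e2] at h
  simp only [φS, coe_realToSchwartz] at h
  have key : ∀ F : V → ℂ, ∫ x, φ x • F x = ∫ x, (φ x : ℂ) • F x := fun F => by
    simp only [Complex.real_smul, smul_eq_mul]
  rw [key, key]
  exact h.symm

lemma memLp_fourier {f : V → ℂ} (hf : Integrable f) (hf2 : MemLp f 2) : MemLp (𝓕 f) 2 :=
  (memLp_congr_ae (coeFn_fourier_toLp hf hf2)).1 (Lp.memLp _)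

/-- Plancherel's theorem for Fourier integrals of functions in `L¹ ∩ L²`. -/
lemma integral_conj_fourier_mul_fourier {f g : V → ℂ} (hf : Integrable f) (hf2 : MemLp f 2)
    (hg : Integrable g) (hg2 : MemLp g 2) :
    ∫ ξ, starRingEnd ℂ (𝓕 f ξ) * 𝓕 g ξ = ∫ x, starRingEnd ℂ (f x) * g x := by
  have h := Lp.inner_fourier_eq (hf2.toLp f) (hg2.toLp g)
  rw [L2.inner_def, L2.inner_def] at h
  have e1 : ∫ ξ, starRingEnd ℂ (𝓕 f ξ) * 𝓕 g ξ
      = ∫ ξ, inner ℂ ((𝓕 (hf2.toLp f) : Lp ℂ 2 (volume : Measure V)) ξ)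
        ((𝓕 (hg2.toLp g) : Lp ℂ 2 (volume : Measure V)) ξ) := by
    refine integral_congr_ae ?_
    filter_upwards [coeFn_fourier_toLp hf hf2, coeFn_fourier_toLp hg hg2] with ξ h1 h2
    rw [h1, h2, RCLike.inner_apply, mul_comm]
  have e2 : ∫ x, starRingEnd ℂ (f x) * g x
      = ∫ x, inner ℂ ((hf2.toLp f : Lp ℂ 2 (volume : Measure V)) x)
        ((hg2.toLp g : Lp ℂ 2 (volume : Measure V)) x) := by
    refine integral_congr_ae ?_
    filter_upwards [hf2.coeFn_toLp, hg2.coeFn_toLp] with ξ h1 h2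
    rw [h1, h2, RCLike.inner_apply, mul_comm]
  rw [e1, e2, h]

/-- The partial Fourier transform in the space variable. -/
noncomputable def partialFourier (f : ℝ × V → ℝ) (p : ℝ × V) : ℂ :=
  𝓕 (fun x => ((f (p.1, x) : ℝ) : ℂ)) p.2

/-- Joint measurability in (t, ξ), as a parameter integral of a jointly measurable integrand; the
later exchanges of time and frequency rely on it. -/
lemma stronglyMeasurable_partialFourier {f : ℝ × V → ℝ} (hf : StronglyMeasurable f) :
    StronglyMeasurable (partialFourier f) := by
  have h : StronglyMeasurable fun q : (ℝ × V) × V =>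
      phase q.2 (-q.1.2) * ((f (q.1.1, q.2) : ℝ) : ℂ) := by
    refine StronglyMeasurable.mul ?_ ?_
    · exact (continuous_phase.comp
        (continuous_snd.prodMk (continuous_snd.comp continuous_fst).neg)).stronglyMeasurable
    · exact Complex.continuous_ofReal.comp_stronglyMeasurable (hf.comp_measurable
        ((measurable_fst.comp measurable_fst).prodMk measurable_snd))
  have h2 : partialFourier f = fun p => ∫ x, phase x (-p.2) * ((f (p.1, x) : ℝ) : ℂ) := by
    ext p; rw [partialFourier, fourier_eq_integral_phase]
  rw [h2]
  exact h.integral_prod_right'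

variable {τ : Measure ℝ} [SFinite τ]

lemma ae_slice_memLp {f : ℝ × V → ℝ} (hf : StronglyMeasurable f)
    (h2 : MemLp f 2 (τ.prod volume)) : ∀ᵐ t ∂τ, MemLp (fun x => f (t, x)) 2 volume := by
  have h := h2.integrable_sq
  filter_upwards [h.prod_right_ae] with t ht
  exact (memLp_two_iff_integrable_sq
    (hf.comp_measurable measurable_prodMk_left).aestronglyMeasurable).2 ht

lemma integral_sq_partialFourier_slice {f : ℝ × V → ℝ} {t : ℝ}
    (h1 : Integrable (fun x => f (t, x))) (h2 : MemLp (fun x => f (t, x)) 2 volume) :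
    MemLp (fun ξ => partialFourier f (t, ξ)) 2 volume ∧
      ∫ ξ, ‖partialFourier f (t, ξ)‖ ^ 2 = ∫ x, f (t, x) ^ 2 := by
  have i1 : Integrable (fun x => ((f (t, x) : ℝ) : ℂ)) := h1.ofReal
  have i2 : MemLp (fun x => ((f (t, x) : ℝ) : ℂ)) 2 volume := h2.ofReal
  refine ⟨memLp_fourier i1 i2, ?_⟩
  have h := integral_conj_fourier_mul_fourier i1 i2 i1 i2
  have e1 : ∀ ξ, starRingEnd ℂ (𝓕 (fun x => ((f (t, x) : ℝ) : ℂ)) ξ)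
      * 𝓕 (fun x => ((f (t, x) : ℝ) : ℂ)) ξ = ((‖partialFourier f (t, ξ)‖ ^ 2 : ℝ) : ℂ) := by
    intro ξ
    rw [Complex.conj_mul']; push_cast; rfl
  have e2 : ∀ x, starRingEnd ℂ ((f (t, x) : ℝ) : ℂ) * ((f (t, x) : ℝ) : ℂ)
      = ((f (t, x) ^ 2 : ℝ) : ℂ) := by
    intro x; rw [Complex.conj_ofReal]; push_cast; ring
  simp only [e1, e2] at h
  rw [integral_complex_ofReal, integral_complex_ofReal] at h
  exact_mod_cast h

/-- Plancherel on almost every time slice, followed by Fubini. -/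
lemma memLp_partialFourier {f : ℝ × V → ℝ} (hf : StronglyMeasurable f)
    (h1 : Integrable f (τ.prod volume)) (h2 : MemLp f 2 (τ.prod volume)) :
    MemLp (partialFourier f) 2 (τ.prod volume) := by
  have hm := (stronglyMeasurable_partialFourier hf)
  refine (memLp_two_iff_integrable_sq_norm hm.aestronglyMeasurable).2 ?_
  have hm2 : AEStronglyMeasurable (fun p => ‖partialFourier f p‖ ^ 2) (τ.prod volume) :=
    (hm.norm.pow 2).aestronglyMeasurable
  rw [integrable_prod_iff hm2]
  have hs : ∀ᵐ t ∂τ, MemLp (fun ξ => partialFourier f (t, ξ)) 2 volume ∧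
      ∫ ξ, ‖partialFourier f (t, ξ)‖ ^ 2 = ∫ x, f (t, x) ^ 2 := by
    filter_upwards [h1.prod_right_ae, ae_slice_memLp hf h2] with t a b
    exact integral_sq_partialFourier_slice a b
  constructor
  · filter_upwards [hs] with t ht
    exact ht.1.integrable_norm_pow (by norm_num)
  · refine h2.integrable_sq.integral_prod_left.congr ?_
    filter_upwards [hs] with t ht
    rw [← ht.2]
    simp

/-- Plancherel's theorem in the space variable, with a weight depending on time. -/
lemma integral_re_conj_partialFourier_mul {f g : ℝ × V → ℝ} (hf : StronglyMeasurable f)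
    (hg : StronglyMeasurable g)
    (hf1 : Integrable f (τ.prod volume)) (hf2 : MemLp f 2 (τ.prod volume))
    (hg1 : Integrable g (τ.prod volume)) (hg2 : MemLp g 2 (τ.prod volume))
    {κ : ℝ → ℝ} (hκ : Measurable κ) {B : ℝ} (hB : ∀ᵐ t ∂τ, |κ t| ≤ B) :
    ∫ p, κ p.1 * (starRingEnd ℂ (partialFourier f p) * partialFourier g p).re ∂(τ.prod volume)
      = ∫ p, κ p.1 * (f p * g p) ∂(τ.prod volume) := by
  have hB' : ∀ᵐ p ∂(τ.prod (volume : Measure V)), ‖κ p.1‖ ≤ B :=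
    Measure.quasiMeasurePreserving_fst.ae hB
  have hκm : AEStronglyMeasurable (fun p : ℝ × V => κ p.1) (τ.prod volume) :=
    (hκ.comp measurable_fst).aestronglyMeasurable
  have I1 : Integrable (fun p => κ p.1 * (f p * g p)) (τ.prod volume) :=
    (hf2.integrable_mul hg2).bdd_mul hκm hB'
  have I2 : Integrable (fun p => κ p.1 *
      (starRingEnd ℂ (partialFourier f p) * partialFourier g p).re) (τ.prod volume) := by
    refine Integrable.bdd_mul ?_ hκm hB'
    have := (memLp_partialFourier hf hf1 hf2).star.integrable_mul (memLp_partialFourier hg hg1 hg2)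
    exact this.re
  rw [integral_prod _ I1, integral_prod _ I2]
  refine integral_congr_ae ?_
  filter_upwards [hf1.prod_right_ae, hg1.prod_right_ae, ae_slice_memLp hf hf2,
    ae_slice_memLp hg hg2] with t a b c e
  simp only [integral_const_mul]
  congr 1
  have i1 : Integrable (fun x => ((f (t, x) : ℝ) : ℂ)) := a.ofReal
  have i2 : MemLp (fun x => ((f (t, x) : ℝ) : ℂ)) 2 volume := c.ofReal
  have j1 : Integrable (fun x => ((g (t, x) : ℝ) : ℂ)) := b.ofReal
  have j2 : MemLp (fun x => ((g (t, x) : ℝ) : ℂ)) 2 volume := e.ofReal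
  have h := congrArg Complex.re (integral_conj_fourier_mul_fourier i1 i2 j1 j2)
  have hI : Integrable (fun ξ => starRingEnd ℂ (partialFourier f (t, ξ))
      * partialFourier g (t, ξ)) :=
    (memLp_fourier i1 i2).star.integrable_mul (memLp_fourier j1 j2)
  have hr : ∫ ξ, (starRingEnd ℂ (partialFourier f (t, ξ)) * partialFourier g (t, ξ)).re
      = (∫ ξ, starRingEnd ℂ (partialFourier f (t, ξ)) * partialFourier g (t, ξ)).re :=
    integral_re hI
  rw [hr]
  refine h.trans ?_
  have : ∀ x, starRingEnd ℂ ((f (t, x) : ℝ) : ℂ) * ((g (t, x) : ℝ) : ℂ)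
      = ((f (t, x) * g (t, x) : ℝ) : ℂ) := by
    intro x; rw [Complex.conj_ofReal]; push_cast; ring
  simp only [this]
  rw [integral_complex_ofReal, Complex.ofReal_re]

lemma integral_norm_sq_partialFourier {f : ℝ × V → ℝ} (hf : StronglyMeasurable f)
    (hf1 : Integrable f (τ.prod volume)) (hf2 : MemLp f 2 (τ.prod volume))
    {κ : ℝ → ℝ} (hκ : Measurable κ) {B : ℝ} (hB : ∀ᵐ t ∂τ, |κ t| ≤ B) :
    ∫ p, κ p.1 * ‖partialFourier f p‖ ^ 2 ∂(τ.prod volume)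
      = ∫ p, κ p.1 * f p ^ 2 ∂(τ.prod volume) := by
  have h := integral_re_conj_partialFourier_mul hf hf hf1 hf2 hf1 hf2 hκ hB
  have e : ∀ z : ℂ, (starRingEnd ℂ z * z).re = ‖z‖ ^ 2 := by
    intro z; rw [Complex.conj_mul']; norm_cast
  simp only [e] at h
  rw [h]
  simp only [sq]

end Plancherel

/-! ### The linear equation at a fixed frequency. -/

section FourierSide

variable {d : ℕ}

lemma slabMeasure_eq_prod (d : ℕ) (T : ℝ) : slabMeasure d T
    = (volume.restrict (Ioo (0 : ℝ) T)).prod (volume : Measure (EuclideanSpace ℝ (Fin d))) := by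
  rw [slabMeasure, Measure.volume_eq_prod, ← Measure.prod_restrict, Measure.restrict_univ]

/-- `z_t + (-Δ)^s w + div F = 0` weakly on the slab, tested with products `η(t) ψ(x)`. -/
structure IsWeakLinearSolution (s T : ℝ) (z w : ℝ × EuclideanSpace ℝ (Fin d) → ℝ)
    (F : ℝ × EuclideanSpace ℝ (Fin d) → EuclideanSpace ℝ (Fin d)) : Prop where
  measurable_z : StronglyMeasurable z
  measurable_w : StronglyMeasurable w
  measurable_F : StronglyMeasurable F
  integrable_z : Integrable z (slabMeasure d T)
  integrable_w : Integrable w (slabMeasure d T)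
  integrable_F : Integrable F (slabMeasure d T)
  weak : ∀ (η : ℝ → ℝ) (ψ : EuclideanSpace ℝ (Fin d) → ℝ), ContDiff ℝ ∞ η → HasCompactSupport η →
    tsupport η ⊆ Ioo 0 T → ContDiff ℝ ∞ ψ → HasCompactSupport ψ →
    ∫ p, (z p * (deriv η p.1 * ψ p.2) - w p * (η p.1 * fracLaplacian s ψ p.2)
      + η p.1 * fderiv ℝ ψ p.2 (F p)) ∂(slabMeasure d T) = 0
  init : VanishesWeaklyAtZero z

/-- The spatial pairing of the flux `(w, F)` with a test function. -/
noncomputable def fluxPairing (s : ℝ) (w : ℝ × EuclideanSpace ℝ (Fin d) → ℝ)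
    (F : ℝ × EuclideanSpace ℝ (Fin d) → EuclideanSpace ℝ (Fin d))
    (ψ : EuclideanSpace ℝ (Fin d) → ℝ) (p : ℝ × EuclideanSpace ℝ (Fin d)) : ℝ :=
  -(w p * fracLaplacian s ψ p.2) + fderiv ℝ ψ p.2 (F p)

lemma norm_fluxPairing_le {s : ℝ} (w : ℝ × EuclideanSpace ℝ (Fin d) → ℝ)
    (F : ℝ × EuclideanSpace ℝ (Fin d) → EuclideanSpace ℝ (Fin d))
    {ψ : EuclideanSpace ℝ (Fin d) → ℝ} {C₁ C₂ : ℝ} (h1 : ∀ x, |fracLaplacian s ψ x| ≤ C₁)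
    (h2 : ∀ x, ‖fderiv ℝ ψ x‖ ≤ C₂) (p : ℝ × EuclideanSpace ℝ (Fin d)) :
    ‖fluxPairing s w F ψ p‖ ≤ C₁ * ‖w p‖ + C₂ * ‖F p‖ := by
  refine (norm_add_le _ _).trans (add_le_add ?_ ?_)
  · rw [norm_neg, norm_mul, mul_comm]
    exact mul_le_mul_of_nonneg_right (h1 _) (norm_nonneg _)
  · exact ((fderiv ℝ ψ p.2).le_opNorm _).trans (mul_le_mul_of_nonneg_right (h2 _) (norm_nonneg _))

lemma aestronglyMeasurable_fluxPairing {s T : ℝ} {w : ℝ × EuclideanSpace ℝ (Fin d) → ℝ}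
    {F : ℝ × EuclideanSpace ℝ (Fin d) → EuclideanSpace ℝ (Fin d)}
    (hw : StronglyMeasurable w) (hF : StronglyMeasurable F)
    {ψ : EuclideanSpace ℝ (Fin d) → ℝ} (hψ : ContDiff ℝ ∞ ψ)
    (hL : AEStronglyMeasurable (fracLaplacian s ψ) volume) :
    AEStronglyMeasurable (fluxPairing s w F ψ) (slabMeasure d T) := by
  rw [slabMeasure_eq_prod]
  refine AEStronglyMeasurable.add ?_ ?_
  · exact (hw.aestronglyMeasurable.mul hL.comp_snd).neg
  · have h1 : Continuous fun q : EuclideanSpace ℝ (Fin d) × EuclideanSpace ℝ (Fin d) =>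
        fderiv ℝ ψ q.1 q.2 :=
      ((hψ.continuous_fderiv (by simp)).comp continuous_fst).clm_apply continuous_snd
    exact (h1.comp_stronglyMeasurable
      (measurable_snd.stronglyMeasurable.prodMk hF)).aestronglyMeasurable

/-- By Fubini, product test functions turn the equation into a scalar weak ODE for the pairing of z
with ψ; the initial condition fixes the constant of integration. -/
lemma IsWeakLinearSolution.pairing_eq_primitive {s T : ℝ} (hT : 0 < T)
    {z w : ℝ × EuclideanSpace ℝ (Fin d) → ℝ}
    {F : ℝ × EuclideanSpace ℝ (Fin d) → EuclideanSpace ℝ (Fin d)}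
    (h : IsWeakLinearSolution s T z w F) {ψ : EuclideanSpace ℝ (Fin d) → ℝ}
    (hψ : ContDiff ℝ ∞ ψ) (hc : HasCompactSupport ψ)
    (hL : AEStronglyMeasurable (fracLaplacian s ψ) volume)
    {C : ℝ} (hLC : ∀ x, |fracLaplacian s ψ x| ≤ C) :
    ∀ᵐ t, t ∈ Ioo 0 T → ∫ x, z (t, x) * ψ x
      = ∫ r in (0 : ℝ)..t, ∫ x, fluxPairing s w F ψ (r, x) := by
  have hz := h.integrable_z
  have hw := h.integrable_w
  have hF := h.integrable_F
  obtain ⟨C₀, hC₀⟩ := hc.exists_bound_of_continuous hψ.continuous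
  obtain ⟨C₂, hC₂⟩ := (hc.fderiv (𝕜 := ℝ)).exists_bound_of_continuous
    (hψ.continuous_fderiv (by simp))
  have i1 : Integrable (fun p => z p * ψ p.2) (slabMeasure d T) :=
    hz.mul_bdd (c := C₀) (hψ.continuous.comp continuous_snd).aestronglyMeasurable
      (Eventually.of_forall fun p => hC₀ p.2)
  have i2 : Integrable (fluxPairing s w F ψ) (slabMeasure d T) :=
    ((hw.norm.const_mul C).add (hF.norm.const_mul C₂)).mono'
      (aestronglyMeasurable_fluxPairing h.measurable_w h.measurable_F hψ hL)
      (Eventually.of_forall fun p => norm_fluxPairing_le w F hLC hC₂ p)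
  have i1' := i1
  have i2' := i2
  rw [slabMeasure_eq_prod] at i1 i2
  refine ae_eq_primitive_of_weak_deriv hT i1.integral_prod_left i2.integral_prod_left ?_
    (h.init ψ hψ hc)
  intro η h1 h2 h3
  have hd : Continuous (deriv η) := h1.continuous_deriv (by simp)
  obtain ⟨B₀, hB₀⟩ := h2.exists_bound_of_continuous h1.continuous
  obtain ⟨B₁, hB₁⟩ := h2.deriv.exists_bound_of_continuous hd
  have j1 : Integrable (fun p => z p * ψ p.2 * deriv η p.1)
      ((volume.restrict (Ioo (0 : ℝ) T)).prod volume) :=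
    i1.mul_bdd (c := B₁) (hd.comp continuous_fst).aestronglyMeasurable
      (Eventually.of_forall fun p => hB₁ p.1)
  have j2 : Integrable (fun p => fluxPairing s w F ψ p * η p.1)
      ((volume.restrict (Ioo (0 : ℝ) T)).prod volume) :=
    i2.mul_bdd (c := B₀) (h1.continuous.comp continuous_fst).aestronglyMeasurable
      (Eventually.of_forall fun p => hB₀ p.1)
  have e := h.weak η ψ h1 h2 h3 hψ hc
  have e1 : ∀ p : ℝ × EuclideanSpace ℝ (Fin d),
      z p * (deriv η p.1 * ψ p.2) - w p * (η p.1 * fracLaplacian s ψ p.2)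
      + η p.1 * fderiv ℝ ψ p.2 (F p)
      = z p * ψ p.2 * deriv η p.1 + fluxPairing s w F ψ p * η p.1 := by
    intro p; simp only [fluxPairing]; ring
  simp only [e1] at e
  rw [slabMeasure_eq_prod] at e
  have e2 := integral_prod _ (j1.add j2)
  simp only [Pi.add_apply] at e2
  rw [e2] at e
  refine Eq.trans (integral_congr_ae ?_) e
  filter_upwards [j1.prod_right_ae, j2.prod_right_ae] with t k1 k2
  have := (integral_add k1 k2).symm
  simp only [integral_mul_const] at this
  exact this

/-- The sign in -ξ matches the kernel e^{-2πi⟪x, ξ⟫} of `𝓕`. -/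
lemma integral_mul_planeWave {f : EuclideanSpace ℝ (Fin d) → ℝ} (hf : Integrable f) (a : ℂ)
    (ξ : EuclideanSpace ℝ (Fin d)) :
    ∫ x, f x * planeWave a (-ξ) x = (a * 𝓕 (fun x => ((f x : ℝ) : ℂ)) ξ).re := by
  have hi : Integrable (fun x => phase x (-ξ) * ((f x : ℝ) : ℂ)) := by
    refine hf.ofReal.bdd_mul (c := 1) ?_ (Eventually.of_forall fun x => (norm_phase _ _).le)
    exact (continuous_phase.comp (continuous_id.prodMk continuous_const)).aestronglyMeasurable
  rw [fourier_eq_integral_phase, ← integral_const_mul]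
  have := integral_re (hi.const_mul a)
  refine Eq.trans ?_ this
  refine integral_congr_ae (Eventually.of_forall fun x => ?_)
  simp only [planeWave_eq_re, RCLike.re_eq_complex_re]
  rw [show a * (phase x (-ξ) * ((f x : ℝ) : ℂ)) = ((f x : ℝ) : ℂ) * (a * phase x (-ξ)) by ring,
    Complex.re_ofReal_mul, phase]

/-- The Fourier-side velocity: `∂ₜ ẑ(t,ξ) = -(2π|ξ|)^{2s} ŵ(t,ξ) - 2πi ξ · F̂(t,ξ)`. -/
noncomputable def fourierVelocity (s : ℝ) (w : ℝ × EuclideanSpace ℝ (Fin d) → ℝ)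
    (F : ℝ × EuclideanSpace ℝ (Fin d) → EuclideanSpace ℝ (Fin d))
    (p : ℝ × EuclideanSpace ℝ (Fin d)) : ℂ :=
  -((fracSymbol s p.2 : ℝ) : ℂ) * partialFourier w p
    - 2 * Real.pi * Complex.I * partialFourier (fun q => inner ℝ (F q) p.2) p

/-- Test with cut-off plane waves and remove the cutoff by dominated convergence, first in x and
then in time. The bounds on gradients and fractional Laplacians are uniform in the cutoff, so the L¹
norms of w and F supply the majorants. The factor a gives access to both real and imaginary parts.
-/
lemma IsWeakLinearSolution.re_mul_partialFourier {s T : ℝ} (hd : 1 ≤ d) (hs0 : 0 < s)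
    (hs1 : s ≤ 1) (hT : 0 < T) {z w : ℝ × EuclideanSpace ℝ (Fin d) → ℝ}
    {F : ℝ × EuclideanSpace ℝ (Fin d) → EuclideanSpace ℝ (Fin d)}
    (h : IsWeakLinearSolution s T z w F) (a : ℂ) (ξ : EuclideanSpace ℝ (Fin d)) :
    ∀ᵐ t, t ∈ Ioo 0 T → (a * partialFourier z (t, ξ)).re
      = ∫ r in (0 : ℝ)..t, (a * fourierVelocity s w F (r, ξ)).re := by
  set ψ : ℕ → EuclideanSpace ℝ (Fin d) → ℝ := fun n => cutoffWave a (-ξ) (n + 1 : ℝ) with hψ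
  have hn1 : ∀ n : ℕ, (1 : ℝ) ≤ n + 1 := fun n => by linarith [(Nat.cast_nonneg n : (0 : ℝ) ≤ n)]
  have hn : Tendsto (fun n : ℕ => (n + 1 : ℝ)) atTop atTop :=
    tendsto_atTop_add_const_right _ _ tendsto_natCast_atTop_atTop
  obtain ⟨⟨C₁, hC₁⟩, hlim⟩ := fracLaplacian_cutoffWave_limit hs0.le hs1 a (-ξ)
  obtain ⟨C₂, hC₂⟩ := exists_norm_fderiv_cutoffWave_le a (-ξ)
  have hcd : ∀ n, ContDiff ℝ ∞ (ψ n) := fun n => contDiff_cutoffWave _ _ _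
  have hcs : ∀ n, HasCompactSupport (ψ n) := fun n =>
    hasCompactSupport_cutoffWave _ _ (by linarith [hn1 n])
  have hL : ∀ n, AEStronglyMeasurable (fracLaplacian s (ψ n)) volume := fun n =>
    (integrable_fracLaplacian hd hs0 hs1 (hcd n) (hcs n)).aestronglyMeasurable
  -- The null set of exceptional times depends on the test function, which is why the cutoff scale
  -- runs through a sequence.
  have hmain : ∀ᵐ t, t ∈ Ioo 0 T → ∀ n, ∫ x, z (t, x) * ψ n x
      = ∫ r in (0 : ℝ)..t, ∫ x, fluxPairing s w F (ψ n) (r, x) := by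
    have := ae_all_iff.2 fun n => h.pairing_eq_primitive hT (hcd n) (hcs n) (hL n)
      (hC₁ _ (hn1 n))
    filter_upwards [this] with t ht hm n
    exact ht n hm
  have hloc : ∀ x, ∀ᶠ n : ℕ in atTop, ψ n =ᶠ[𝓝 x] planeWave a (-ξ) := by
    intro x
    filter_upwards [hn.eventually_gt_atTop ‖x‖] with n hx
    exact cutoffWave_eventuallyEq _ _ _ hx
  have hz := h.integrable_z
  have hw := h.integrable_w
  have hF := h.integrable_F
  rw [slabMeasure_eq_prod] at hz hw hF
  have hz' : ∀ᵐ t, t ∈ Ioo 0 T → Integrable (fun x => z (t, x)) :=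
    (ae_restrict_iff' measurableSet_Ioo).1 hz.prod_right_ae
  have hflux : ∀ᵐ r ∂(volume.restrict (Ioo (0 : ℝ) T)),
      Tendsto (fun n => ∫ x, fluxPairing s w F (ψ n) (r, x)) atTop
        (𝓝 (a * fourierVelocity s w F (r, ξ)).re) := by
    have hm : ∀ᵐ r ∂(volume.restrict (Ioo (0 : ℝ) T)), ∀ n, AEStronglyMeasurable
        (fun x => fluxPairing s w F (ψ n) (r, x)) volume := by
      refine ae_all_iff.2 fun n => ?_
      have := aestronglyMeasurable_fluxPairing (T := T) h.measurable_w h.measurable_F (hcd n) (hL n)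
      rw [slabMeasure_eq_prod] at this
      exact this.prodMk_left
    filter_upwards [hw.prod_right_ae, hF.prod_right_ae, hm] with r hwr hFr hmr
    have hlimit : (a * fourierVelocity s w F (r, ξ)).re
        = ∫ x, (-(w (r, x) * (fracSymbol s ξ * planeWave a (-ξ) x))
          + fderiv ℝ (planeWave a (-ξ)) x (F (r, x))) := by
      have hFi : Integrable (fun x => (inner ℝ (F (r, x)) ξ : ℝ)) := hFr.inner_const ξ
      have b1 : Integrable (fun x => w (r, x) * planeWave a (-ξ) x) :=
        hwr.mul_bdd (c := ‖a‖) (contDiff_planeWave _ _).continuous.aestronglyMeasurable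
          (Eventually.of_forall fun x => abs_planeWave_le _ _ _)
      have b2 : Integrable (fun x => (inner ℝ (F (r, x)) ξ : ℝ)
          * planeWave (a * Complex.I) (-ξ) x) :=
        hFi.mul_bdd (c := ‖a * Complex.I‖)
          (contDiff_planeWave _ _).continuous.aestronglyMeasurable
          (Eventually.of_forall fun x => abs_planeWave_le _ _ _)
      have e1 : ∀ x, (-(w (r, x) * (fracSymbol s ξ * planeWave a (-ξ) x))
          + fderiv ℝ (planeWave a (-ξ)) x (F (r, x)))
          = (-fracSymbol s ξ) * (w (r, x) * planeWave a (-ξ) x)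
            + (-(2 * Real.pi)) * ((inner ℝ (F (r, x)) ξ : ℝ)
              * planeWave (a * Complex.I) (-ξ) x) := by
        intro x
        rw [fderiv_planeWave, inner_neg_right]; ring
      simp only [e1]
      rw [integral_add (b1.const_mul _) (b2.const_mul _), integral_const_mul, integral_const_mul,
        integral_mul_planeWave hwr, integral_mul_planeWave hFi, fourierVelocity,
        ← Complex.re_ofReal_mul, ← Complex.re_ofReal_mul, ← Complex.add_re]
      congr 1
      simp only [partialFourier]
      push_cast
      ring
    rw [hlimit]
    refine tendsto_integral_of_dominated_convergence
      (fun x => C₁ * ‖w (r, x)‖ + C₂ * ‖F (r, x)‖) hmr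
      ((hwr.norm.const_mul _).add (hFr.norm.const_mul _))
      (fun n => Eventually.of_forall fun x =>
        norm_fluxPairing_le w F (hC₁ _ (hn1 n)) (hC₂ _ (hn1 n)) (r, x))
      (Eventually.of_forall fun x => ?_)
    refine Tendsto.add ?_ ?_
    · have := (hlim x).comp hn
      rw [fracSymbol_neg] at this
      exact (this.const_mul _).neg
    · refine tendsto_const_nhds.congr' ?_
      filter_upwards [hloc x] with n hx
      rw [hx.fderiv_eq]
  set bound : ℝ → ℝ := fun r => ∫ x, (C₁ * ‖w (r, x)‖ + C₂ * ‖F (r, x)‖) with hbound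
  have hboundi : IntegrableOn bound (Ioo 0 T) :=
    ((hw.norm.const_mul C₁).add (hF.norm.const_mul C₂)).integral_prod_left
  have hslice : ∀ᵐ r ∂(volume.restrict (Ioo (0 : ℝ) T)),
      ∀ n, ‖∫ x, fluxPairing s w F (ψ n) (r, x)‖ ≤ bound r := by
    filter_upwards [hw.prod_right_ae, hF.prod_right_ae] with r hwr hFr n
    exact norm_integral_le_of_norm_le ((hwr.norm.const_mul _).add (hFr.norm.const_mul _))
      (Eventually.of_forall fun x =>
        norm_fluxPairing_le w F (hC₁ _ (hn1 n)) (hC₂ _ (hn1 n)) (r, x))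
  filter_upwards [hmain, hz'] with t ht htz hmem
  have hsub : uIoc 0 t ⊆ Ioo 0 T := by
    rw [uIoc_of_le hmem.1.le]; exact fun r hr => ⟨hr.1, hr.2.trans_lt hmem.2⟩
  have hr : volume.restrict (uIoc 0 t) ≤ volume.restrict (Ioo 0 T) :=
    Measure.restrict_mono hsub le_rfl
  have lim1 : Tendsto (fun n => ∫ x, z (t, x) * ψ n x) atTop
      (𝓝 (a * partialFourier z (t, ξ)).re) := by
    rw [partialFourier, ← integral_mul_planeWave (htz hmem)]
    refine tendsto_integral_of_dominated_convergence (fun x => ‖z (t, x)‖ * ‖a‖)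
      (fun n => (htz hmem).aestronglyMeasurable.mul (hcd n).continuous.aestronglyMeasurable)
      ((htz hmem).norm.mul_const _) (fun n => Eventually.of_forall fun x => ?_)
      (Eventually.of_forall fun x => ?_)
    · rw [norm_mul]
      exact mul_le_mul_of_nonneg_left (abs_cutoffWave_le _ _ _ _) (norm_nonneg _)
    · refine tendsto_const_nhds.congr' ?_
      filter_upwards [hloc x] with n hx
      rw [hx.eq_of_nhds]
  have lim2 : Tendsto (fun n => ∫ r in (0 : ℝ)..t, ∫ x, fluxPairing s w F (ψ n) (r, x)) atTop
      (𝓝 (∫ r in (0 : ℝ)..t, (a * fourierVelocity s w F (r, ξ)).re)) := by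
    refine intervalIntegral.tendsto_integral_filter_of_dominated_convergence bound
      (Eventually.of_forall fun n => ?_) (Eventually.of_forall fun n => ?_) ?_ ?_
    · have := aestronglyMeasurable_fluxPairing (T := T) h.measurable_w h.measurable_F (hcd n) (hL n)
      rw [slabMeasure_eq_prod] at this
      exact this.integral_prod_right'.mono_measure hr
    · filter_upwards [(ae_restrict_iff' measurableSet_uIoc).1 (ae_mono hr hslice)] with r hr' hm
      exact hr' hm n
    · rw [intervalIntegrable_iff]
      exact hboundi.mono_set hsub
    · exact (ae_restrict_iff' measurableSet_uIoc).1 (ae_mono hr hflux)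
  refine tendsto_nhds_unique lim1 (lim2.congr fun n => (ht hmem n).symm)

lemma IsWeakLinearSolution.integrableOn_fourierVelocity {s T : ℝ}
    {z w : ℝ × EuclideanSpace ℝ (Fin d) → ℝ}
    {F : ℝ × EuclideanSpace ℝ (Fin d) → EuclideanSpace ℝ (Fin d)}
    (h : IsWeakLinearSolution s T z w F) (ξ : EuclideanSpace ℝ (Fin d)) :
    IntegrableOn (fun t => fourierVelocity s w F (t, ξ)) (Ioo 0 T) := by
  have hkey : ∀ f : ℝ × EuclideanSpace ℝ (Fin d) → ℝ, Integrable f (slabMeasure d T) →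
      IntegrableOn (fun t => partialFourier f (t, ξ)) (Ioo 0 T) := by
    intro f hf
    rw [slabMeasure_eq_prod] at hf
    have hi : Integrable (fun p : ℝ × EuclideanSpace ℝ (Fin d) =>
        phase p.2 (-ξ) * ((f p : ℝ) : ℂ)) ((volume.restrict (Ioo (0 : ℝ) T)).prod volume) := by
      refine hf.ofReal.bdd_mul (c := 1) ?_ (Eventually.of_forall fun x => (norm_phase _ _).le)
      exact (continuous_phase.comp (continuous_snd.prodMk continuous_const)).aestronglyMeasurable
    refine hi.integral_prod_left.congr (Eventually.of_forall fun t => ?_)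
    simp only [partialFourier]
    rw [fourier_eq_integral_phase]
  exact ((hkey w h.integrable_w).const_mul (-((fracSymbol s ξ : ℝ) : ℂ))).sub
    ((hkey _ (h.integrable_F.inner_const ξ)).const_mul (2 * Real.pi * Complex.I))

/-- Weighted energy inequality at a fixed frequency. -/
lemma IsWeakLinearSolution.energy_le {s T : ℝ} (hd : 1 ≤ d) (hs0 : 0 < s)
    (hs1 : s ≤ 1) (hT : 0 < T) {z w : ℝ × EuclideanSpace ℝ (Fin d) → ℝ}
    {F : ℝ × EuclideanSpace ℝ (Fin d) → EuclideanSpace ℝ (Fin d)}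
    (h : IsWeakLinearSolution s T z w F) (lam : ℝ) (ξ : EuclideanSpace ℝ (Fin d)) :
    lam * ∫ t in Ioo 0 T, Real.exp (-lam * t) * ‖partialFourier z (t, ξ)‖ ^ 2
      ≤ ∫ t in Ioo 0 T, 2 * (Real.exp (-lam * t) *
        (starRingEnd ℂ (partialFourier z (t, ξ)) * fourierVelocity s w F (t, ξ)).re) := by
  refine energy_primitive_complex hT (h.integrableOn_fourierVelocity ξ) ?_ ?_ lam
  · simpa using h.re_mul_partialFourier hd hs0 hs1 hT 1 ξ
  -- Re(-i ζ) = Im ζ.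
  · simpa using h.re_mul_partialFourier hd hs0 hs1 hT (-Complex.I) ξ

end FourierSide

/-! ### The resolvent symbol and its bounds against the drift symbol. -/

section ResolventSymbol

variable {V : Type*} [NormedAddCommGroup V] [InnerProductSpace ℝ V]

/-- The symbol `1 / (1 + (2π‖ξ‖)^{2s})` of the resolvent `(1 + (-Δ)^s)⁻¹`. -/
noncomputable def resolventSymbol (s : ℝ) (ξ : V) : ℝ := (1 + (2 * Real.pi * ‖ξ‖) ^ (2 * s))⁻¹

lemma one_le_one_add_rpow (s : ℝ) (ξ : V) : 1 ≤ 1 + (2 * Real.pi * ‖ξ‖) ^ (2 * s) := by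
  have : 0 ≤ (2 * Real.pi * ‖ξ‖) ^ (2 * s) := Real.rpow_nonneg (by positivity) _
  linarith

lemma resolventSymbol_pos (s : ℝ) (ξ : V) : 0 < resolventSymbol s ξ :=
  inv_pos.2 (zero_lt_one.trans_le (one_le_one_add_rpow s ξ))

lemma resolventSymbol_le_one (s : ℝ) (ξ : V) : resolventSymbol s ξ ≤ 1 :=
  inv_le_one_of_one_le₀ (one_le_one_add_rpow s ξ)

/-- This identity splits the weighted diffusion into an unweighted term, accessible to Plancherel
and monotonicity, and a term of order zero carrying the weight. -/
lemma resolventSymbol_mul_rpow (s : ℝ) (ξ : V) :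
    resolventSymbol s ξ * (2 * Real.pi * ‖ξ‖) ^ (2 * s) = 1 - resolventSymbol s ξ := by
  have h := one_le_one_add_rpow s ξ
  have : resolventSymbol s ξ * (1 + (2 * Real.pi * ‖ξ‖) ^ (2 * s)) = 1 :=
    inv_mul_cancel₀ (by linarith)
  linarith

lemma continuous_resolventSymbol {s : ℝ} (hs : 0 ≤ s) :
    Continuous (resolventSymbol s : V → ℝ) := by
  have h : Continuous fun ξ : V => 1 + (2 * Real.pi * ‖ξ‖) ^ (2 * s) :=
    continuous_const.add
      ((continuous_const.mul continuous_norm).rpow_const fun _ => Or.inr (by linarith))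
  exact h.inv₀ fun ξ => by linarith [one_le_one_add_rpow s ξ]

/-- For s ≥ 1/2 the first-order drift symbol does not exceed 1 + (2π‖ξ‖)^{2s}: low frequencies are
below 1, high ones below the power. -/
lemma norm_mul_resolventSymbol_le_one {s : ℝ} (hs : 1 / 2 ≤ s) (ξ : V) :
    2 * Real.pi * ‖ξ‖ * resolventSymbol s ξ ≤ 1 := by
  rw [resolventSymbol, ← div_eq_mul_inv, div_le_one (by linarith [one_le_one_add_rpow s ξ])]
  have h0 : 0 ≤ 2 * Real.pi * ‖ξ‖ := by positivity
  rcases le_total (2 * Real.pi * ‖ξ‖) 1 with h | h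
  · exact h.trans (one_le_one_add_rpow s ξ)
  · have := Real.rpow_le_rpow_of_exponent_le h (show 1 ≤ 2 * s by linarith)
    rw [Real.rpow_one] at this
    linarith

/-- For `s > 1/2` the drift symbol is a small perturbation, up to the resolvent symbol. -/
lemma exists_sq_norm_mul_resolventSymbol_le {s : ℝ} (hs : 1 / 2 < s) {δ : ℝ} (hδ : 0 < δ) :
    ∃ C, 0 ≤ C ∧ ∀ ξ : V, (2 * Real.pi * ‖ξ‖ * resolventSymbol s ξ) ^ 2
      ≤ δ + C * resolventSymbol s ξ := by
  have hlim : Tendsto (fun r : ℝ => r ^ (-(2 * s - 1))) atTop (𝓝 0) :=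
    tendsto_rpow_neg_atTop (by linarith)
  -- Beyond R the drift symbol times the resolvent symbol is at most r^{1-2s} ≤ √δ. Below R it is
  -- bounded through R², and this becomes the constant C.
  obtain ⟨R, hR1, hR⟩ := ((eventually_ge_atTop (1 : ℝ)).and
    (hlim.eventually_lt_const (Real.sqrt_pos.2 hδ))).exists
  refine ⟨R ^ 2, sq_nonneg _, fun ξ => ?_⟩
  set ρ := 2 * Real.pi * ‖ξ‖ with hρ
  have hρ0 : 0 ≤ ρ := by positivity
  have hω := resolventSymbol_pos s ξ
  have hω1 := resolventSymbol_le_one s ξ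
  rcases le_total ρ R with h | h
  · have h1 : ρ ^ 2 ≤ R ^ 2 := by gcongr
    have h2 : resolventSymbol s ξ ^ 2 ≤ resolventSymbol s ξ := by nlinarith
    calc (ρ * resolventSymbol s ξ) ^ 2 = ρ ^ 2 * resolventSymbol s ξ ^ 2 := by ring
      _ ≤ R ^ 2 * resolventSymbol s ξ := by gcongr
      _ ≤ _ := by linarith
  · have hρpos : 0 < ρ := by linarith
    have h1 : ρ * resolventSymbol s ξ ≤ ρ ^ (-(2 * s - 1)) := by
      have e : ρ ^ (-(2 * s - 1)) = ρ * (ρ ^ (2 * s))⁻¹ := by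
        rw [show -(2 * s - 1) = 1 + -(2 * s) by ring, Real.rpow_add hρpos, Real.rpow_one,
          Real.rpow_neg hρ0]
      rw [e]
      refine mul_le_mul_of_nonneg_left ?_ hρ0
      exact inv_anti₀ (Real.rpow_pos_of_pos hρpos _) (by linarith)
    have h2 : ρ ^ (-(2 * s - 1)) ≤ R ^ (-(2 * s - 1)) :=
      Real.rpow_le_rpow_of_nonpos (by linarith) h (by linarith)
    have h3 : ρ * resolventSymbol s ξ ≤ √δ := (h1.trans h2).trans hR.le
    have h4 := pow_le_pow_left₀ (by positivity) h3 2
    rw [Real.sq_sqrt hδ.le] at h4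
    have : 0 ≤ R ^ 2 * resolventSymbol s ξ := by positivity
    linarith

end ResolventSymbol

/-! ### The energy estimate in the resolvent norm and uniqueness for the linear problem. -/

section EnergyEstimate

variable {d : ℕ}

/-- The sum of the norms of the Fourier transforms of the components of `F`. -/
noncomputable def fourierNormSum
    (F : ℝ × EuclideanSpace ℝ (Fin d) → EuclideanSpace ℝ (Fin d))
    (p : ℝ × EuclideanSpace ℝ (Fin d)) : ℝ :=
  ∑ i, ‖partialFourier (fun q => F q i) p‖

lemma fourierNormSum_nonneg (F : ℝ × EuclideanSpace ℝ (Fin d) → EuclideanSpace ℝ (Fin d))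
    (p : ℝ × EuclideanSpace ℝ (Fin d)) : 0 ≤ fourierNormSum F p :=
  Finset.sum_nonneg fun _ _ => norm_nonneg _

variable {τ : Measure ℝ} [SFinite τ]

lemma stronglyMeasurable_component
    {F : ℝ × EuclideanSpace ℝ (Fin d) → EuclideanSpace ℝ (Fin d)} (hF : StronglyMeasurable F)
    (i : Fin d) : StronglyMeasurable fun q => F q i :=
  (EuclideanSpace.proj (𝕜 := ℝ) i).continuous.comp_stronglyMeasurable hF

lemma integrable_component
    {F : ℝ × EuclideanSpace ℝ (Fin d) → EuclideanSpace ℝ (Fin d)} {X : Measure (ℝ × EuclideanSpace ℝ (Fin d))}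
    (hF : Integrable F X) (i : Fin d) : Integrable (fun q => F q i) X :=
  (EuclideanSpace.proj (𝕜 := ℝ) i).integrable_comp hF

lemma memLp_component
    {F : ℝ × EuclideanSpace ℝ (Fin d) → EuclideanSpace ℝ (Fin d)}
    {X : Measure (ℝ × EuclideanSpace ℝ (Fin d))} (hF : MemLp F 2 X) (i : Fin d) :
    MemLp (fun q => F q i) 2 X :=
  (EuclideanSpace.proj (𝕜 := ℝ) i).comp_memLp' hF

/-- The frequency enters both as a fixed vector in the inner product and as the point of evaluation.
Expanding in components separates the two roles, so that the scalar Plancherel theorem and joint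
measurability apply. -/
lemma partialFourier_inner {F : ℝ × EuclideanSpace ℝ (Fin d) → EuclideanSpace ℝ (Fin d)}
    (hF : Integrable F (τ.prod volume)) :
    ∀ᵐ p ∂(τ.prod (volume : Measure (EuclideanSpace ℝ (Fin d)))),
      partialFourier (fun q => inner ℝ (F q) p.2) p
        = ∑ i, ((p.2 i : ℝ) : ℂ) * partialFourier (fun q => F q i) p := by
  have h : ∀ᵐ t ∂τ, Integrable (fun x => F (t, x)) := hF.prod_right_ae
  filter_upwards [Measure.quasiMeasurePreserving_fst.ae h] with p hp
  simp only [partialFourier, fourier_eq_integral_phase]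
  simp only [← integral_const_mul]
  rw [← integral_finsetSum]
  · refine integral_congr_ae (Eventually.of_forall fun x => ?_)
    simp only [PiLp.inner_apply, RCLike.inner_apply, conj_trivial]
    push_cast
    rw [Finset.mul_sum]
    exact Finset.sum_congr rfl fun i _ => by ring
  · intro i _
    refine Integrable.const_mul ?_ _
    have hi : Integrable (fun x => F (p.1, x) i) :=
      (EuclideanSpace.proj (𝕜 := ℝ) i).integrable_comp hp
    refine hi.ofReal.bdd_mul (c := 1) ?_ (Eventually.of_forall fun x => (norm_phase _ _).le)
    exact (continuous_phase.comp (continuous_id.prodMk continuous_const)).aestronglyMeasurable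

lemma norm_partialFourier_inner_le
    {F : ℝ × EuclideanSpace ℝ (Fin d) → EuclideanSpace ℝ (Fin d)}
    (hF : Integrable F (τ.prod volume)) :
    ∀ᵐ p ∂(τ.prod (volume : Measure (EuclideanSpace ℝ (Fin d)))),
      ‖partialFourier (fun q => inner ℝ (F q) p.2) p‖ ≤ ‖p.2‖ * fourierNormSum F p := by
  filter_upwards [partialFourier_inner hF] with p hp
  rw [hp, fourierNormSum, Finset.mul_sum]
  refine (norm_sum_le _ _).trans (Finset.sum_le_sum fun i _ => ?_)
  rw [norm_mul, Complex.norm_real]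
  exact mul_le_mul_of_nonneg_right (PiLp.norm_apply_le p.2 i) (norm_nonneg _)

lemma memLp_fourierNormSum {F : ℝ × EuclideanSpace ℝ (Fin d) → EuclideanSpace ℝ (Fin d)}
    (hm : StronglyMeasurable F) (hF : Integrable F (τ.prod volume))
    (hF2 : MemLp F 2 (τ.prod volume)) : MemLp (fourierNormSum F) 2 (τ.prod volume) :=
  memLp_finsetSum _ fun i _ => (memLp_partialFourier (stronglyMeasurable_component hm i)
    (integrable_component hF i) (memLp_component hF2 i)).norm

/-- Cauchy–Schwarz over the d components gives the factor d; Plancherel is then applied to each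
component. -/
lemma integral_fourierNormSum_sq_le
    {F : ℝ × EuclideanSpace ℝ (Fin d) → EuclideanSpace ℝ (Fin d)}
    (hm : StronglyMeasurable F) (hF : Integrable F (τ.prod volume))
    (hF2 : MemLp F 2 (τ.prod volume)) {κ : ℝ → ℝ} (hκ : Measurable κ) (hκ0 : ∀ t, 0 ≤ κ t)
    {B : ℝ} (hB : ∀ᵐ t ∂τ, |κ t| ≤ B) :
    ∫ p, κ p.1 * fourierNormSum F p ^ 2 ∂(τ.prod volume)
      ≤ d * ∫ p, κ p.1 * ‖F p‖ ^ 2 ∂(τ.prod volume) := by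
  have hB' : ∀ᵐ p ∂(τ.prod (volume : Measure (EuclideanSpace ℝ (Fin d)))), ‖κ p.1‖ ≤ B :=
    Measure.quasiMeasurePreserving_fst.ae hB
  have hκm : AEStronglyMeasurable (fun p : ℝ × EuclideanSpace ℝ (Fin d) => κ p.1)
      (τ.prod volume) := (hκ.comp measurable_fst).aestronglyMeasurable
  have c1 := fun i => stronglyMeasurable_component hm i
  have c2 := fun i => integrable_component hF i
  have c3 := fun i => memLp_component hF2 i
  have i1 : ∀ i, Integrable (fun p => κ p.1 * ‖partialFourier (fun q => F q i) p‖ ^ 2)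
      (τ.prod volume) := fun i =>
    ((memLp_partialFourier (c1 i) (c2 i) (c3 i)).integrable_norm_pow (by norm_num)).bdd_mul hκm hB'
  have i2 : ∀ i, Integrable (fun p => κ p.1 * F p i ^ 2) (τ.prod volume) := fun i =>
    ((c3 i).integrable_sq).bdd_mul hκm hB'
  calc ∫ p, κ p.1 * fourierNormSum F p ^ 2 ∂(τ.prod volume)
      ≤ ∫ p, d * ∑ i, κ p.1 * ‖partialFourier (fun q => F q i) p‖ ^ 2 ∂(τ.prod volume) := by
        refine integral_mono
          ((memLp_fourierNormSum hm hF hF2).integrable_sq.bdd_mul hκm hB')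
          ((integrable_finsetSum _ fun i _ => i1 i).const_mul _) fun p => ?_
        simp only
        rw [← Finset.mul_sum, mul_left_comm]
        refine mul_le_mul_of_nonneg_left ?_ (hκ0 _)
        have := sq_sum_le_card_mul_sum_sq (s := (Finset.univ : Finset (Fin d)))
          (f := fun i => ‖partialFourier (fun q => F q i) p‖)
        simpa [fourierNormSum] using this
    _ = d * ∑ i, ∫ p, κ p.1 * F p i ^ 2 ∂(τ.prod volume) := by
        rw [integral_const_mul, integral_finsetSum _ fun i _ => i1 i]
        congr 1
        exact Finset.sum_congr rfl fun i _ =>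
          integral_norm_sq_partialFourier (c1 i) (c2 i) (c3 i) hκ hB
    _ = d * ∫ p, κ p.1 * ‖F p‖ ^ 2 ∂(τ.prod volume) := by
        rw [← integral_finsetSum _ fun i _ => i2 i]
        congr 1
        refine integral_congr_ae (Eventually.of_forall fun p => ?_)
        simp only
        rw [← Finset.mul_sum, EuclideanSpace.real_norm_sq_eq]

/-- Completing the square with weight k, followed by the bound on A². -/
lemma drift_young {A x S k δ C ρ : ℝ} (hk : 0 < k) (hA : A ^ 2 ≤ δ + C * ρ) :
    2 * A * x * S ≤ k * S ^ 2 + (δ / k) * x ^ 2 + (C / k) * (ρ * x ^ 2) := by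
  have h1 : 2 * A * x * S ≤ k * S ^ 2 + A ^ 2 * x ^ 2 / k := by
    have : k * S ^ 2 + A ^ 2 * x ^ 2 / k - 2 * A * x * S = (k * S - A * x) ^ 2 / k := by
      field_simp; ring
    have h : 0 ≤ (k * S - A * x) ^ 2 / k := by positivity
    linarith
  have h2 : A ^ 2 * x ^ 2 / k ≤ (δ + C * ρ) * x ^ 2 / k := by gcongr
  have h3 : (δ + C * ρ) * x ^ 2 / k = (δ / k) * x ^ 2 + (C / k) * (ρ * x ^ 2) := by
    field_simp
  linarith

/-- The drift contribution is absorbed by the dissipation, up to the resolvent energy. -/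
lemma exists_drift_bound {s : ℝ} {z : ℝ × EuclideanSpace ℝ (Fin d) → ℝ}
    {F : ℝ × EuclideanSpace ℝ (Fin d) → EuclideanSpace ℝ (Fin d)}
    (hz : StronglyMeasurable z) (hz1 : Integrable z (τ.prod volume))
    (hz2 : MemLp z 2 (τ.prod volume))
    (hm : StronglyMeasurable F) (hF1 : Integrable F (τ.prod volume))
    (hF2 : MemLp F 2 (τ.prod volume)) {c L : ℝ} (hc : 0 ≤ c)
    (hF : (∀ᵐ p ∂(τ.prod volume), F p = 0) ∨
      (1 / 2 < s ∧ 0 < c ∧ 0 ≤ L ∧ ∀ᵐ p ∂(τ.prod volume), ‖F p‖ ^ 2 ≤ L * z p ^ 2)) :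
    ∃ K : ℝ, 0 ≤ K ∧ ∀ κ : ℝ → ℝ, Measurable κ → (∀ t, 0 ≤ κ t) → (∀ᵐ t ∂τ, |κ t| ≤ 1) →
      ∫ p, κ p.1 * (2 * (2 * Real.pi * ‖p.2‖ * resolventSymbol s p.2) * ‖partialFourier z p‖
        * fourierNormSum F p) ∂(τ.prod volume)
      ≤ 2 * c * (∫ p, κ p.1 * z p ^ 2 ∂(τ.prod volume))
        + K * ∫ p, κ p.1 * (resolventSymbol s p.2 * ‖partialFourier z p‖ ^ 2)
          ∂(τ.prod volume) := by
  rcases hF with hF | ⟨hs', hc', hL, hF⟩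
  · refine ⟨0, le_rfl, fun κ hκ hκ0 hκ1 => ?_⟩
    have h1 : ∫ p, κ p.1 * fourierNormSum F p ^ 2 ∂(τ.prod volume) ≤ 0 := by
      refine (integral_fourierNormSum_sq_le hm hF1 hF2 hκ hκ0 hκ1).trans ?_
      rw [integral_eq_zero_of_ae, mul_zero]
      filter_upwards [hF] with p hp
      simp [hp]
    have h2 : ∀ᵐ p ∂(τ.prod (volume : Measure (EuclideanSpace ℝ (Fin d)))),
        κ p.1 * fourierNormSum F p ^ 2 = 0 := by
      have hnn : ∀ p : ℝ × EuclideanSpace ℝ (Fin d), 0 ≤ κ p.1 * fourierNormSum F p ^ 2 :=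
        fun p => mul_nonneg (hκ0 _) (sq_nonneg _)
      refine (integral_eq_zero_iff_of_nonneg hnn ?_).1 (le_antisymm h1 (integral_nonneg hnn))
      exact (memLp_fourierNormSum hm hF1 hF2).integrable_sq.bdd_mul
        (hκ.comp measurable_fst).aestronglyMeasurable
        (Measure.quasiMeasurePreserving_fst.ae hκ1)
    have h3 : ∫ p, κ p.1 * (2 * (2 * Real.pi * ‖p.2‖ * resolventSymbol s p.2)
        * ‖partialFourier z p‖ * fourierNormSum F p) ∂(τ.prod volume) = 0 := by
      refine integral_eq_zero_of_ae ?_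
      filter_upwards [h2] with p hp
      rcases mul_eq_zero.1 hp with h | h
      · simp [h]
      · simp [pow_eq_zero_iff (two_ne_zero) |>.1 h]
    rw [h3, zero_mul, add_zero]
    exact mul_nonneg (by linarith) (integral_nonneg fun p => mul_nonneg (hκ0 _) (sq_nonneg _))
  -- With this k, k · dL ≤ c, so the F̂ term costs at most c∫κz²; with δ = ck the ẑ term of Young's
  -- inequality costs another c∫κz². Together they make up the allowed 2c.
  · have hk : 0 < c / (d * L + 1) := by positivity
    set k := c / (d * L + 1) with hkdef
    obtain ⟨C, hC0, hC⟩ := exists_sq_norm_mul_resolventSymbol_le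
      (V := EuclideanSpace ℝ (Fin d)) hs' (mul_pos hc' hk)
    refine ⟨C / k, by positivity, fun κ hκ hκ0 hκ1 => ?_⟩
    have hκ1' : ∀ᵐ p ∂(τ.prod (volume : Measure (EuclideanSpace ℝ (Fin d)))), ‖κ p.1‖ ≤ 1 :=
      Measure.quasiMeasurePreserving_fst.ae hκ1
    have hκm : AEStronglyMeasurable (fun p : ℝ × EuclideanSpace ℝ (Fin d) => κ p.1)
        (τ.prod volume) := (hκ.comp measurable_fst).aestronglyMeasurable
    have hωc : Continuous fun p : ℝ × EuclideanSpace ℝ (Fin d) => resolventSymbol s p.2 :=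
      (continuous_resolventSymbol (by linarith)).comp continuous_snd
    have mz := memLp_partialFourier hz hz1 hz2
    have mS := memLp_fourierNormSum hm hF1 hF2
    have j1 : Integrable (fun p => κ p.1 * fourierNormSum F p ^ 2) (τ.prod volume) :=
      mS.integrable_sq.bdd_mul hκm hκ1'
    have jz : Integrable (fun p => ‖partialFourier z p‖ ^ 2) (τ.prod volume) :=
      mz.integrable_norm_pow (by norm_num)
    have j2 : Integrable (fun p => κ p.1 * ‖partialFourier z p‖ ^ 2) (τ.prod volume) :=
      jz.bdd_mul hκm hκ1'
    have j3 : Integrable (fun p => κ p.1 * (resolventSymbol s p.2 * ‖partialFourier z p‖ ^ 2))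
        (τ.prod volume) := by
      refine Integrable.bdd_mul ?_ hκm hκ1'
      refine jz.bdd_mul (c := 1) hωc.aestronglyMeasurable (Eventually.of_forall fun p => ?_)
      rw [Real.norm_of_nonneg (resolventSymbol_pos _ _).le]
      exact resolventSymbol_le_one _ _
    have hS := integral_fourierNormSum_sq_le hm hF1 hF2 hκ hκ0 hκ1
    have hFz : ∫ p, κ p.1 * ‖F p‖ ^ 2 ∂(τ.prod volume)
        ≤ L * ∫ p, κ p.1 * z p ^ 2 ∂(τ.prod volume) := by
      rw [← integral_const_mul]
      refine integral_mono_ae ((hF2.integrable_norm_pow (by norm_num)).bdd_mul hκm hκ1')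
        ((hz2.integrable_sq.bdd_mul hκm hκ1').const_mul _) ?_
      filter_upwards [hF] with p hp
      have := mul_le_mul_of_nonneg_left hp (hκ0 p.1)
      linarith
    have hPl := integral_norm_sq_partialFourier hz hz1 hz2 hκ hκ1
    set Iz := ∫ p, κ p.1 * z p ^ 2 ∂(τ.prod volume) with hIz
    have hIz0 : 0 ≤ Iz := integral_nonneg fun p => mul_nonneg (hκ0 _) (sq_nonneg _)
    calc ∫ p, κ p.1 * (2 * (2 * Real.pi * ‖p.2‖ * resolventSymbol s p.2) * ‖partialFourier z p‖
        * fourierNormSum F p) ∂(τ.prod volume)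
        ≤ ∫ p, (k * (κ p.1 * fourierNormSum F p ^ 2)
          + (c * k / k) * (κ p.1 * ‖partialFourier z p‖ ^ 2)
          + (C / k) * (κ p.1 * (resolventSymbol s p.2 * ‖partialFourier z p‖ ^ 2)))
          ∂(τ.prod volume) := by
          refine integral_mono_of_nonneg (Eventually.of_forall fun p => ?_)
            (((j1.const_mul k).add (j2.const_mul (c * k / k))).add (j3.const_mul (C / k)))
            (Eventually.of_forall fun p => ?_)
          · have := resolventSymbol_pos s p.2
            have := fourierNormSum_nonneg F p
            have := hκ0 p.1
            simp only [Pi.zero_apply]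
            positivity
          · have := mul_le_mul_of_nonneg_left
              (drift_young (x := ‖partialFourier z p‖) (S := fourierNormSum F p) hk (hC p.2))
              (hκ0 p.1)
            simp only; linarith
      _ = k * (∫ p, κ p.1 * fourierNormSum F p ^ 2 ∂(τ.prod volume)) + (c * k / k) * Iz
          + (C / k) * ∫ p, κ p.1 * (resolventSymbol s p.2 * ‖partialFourier z p‖ ^ 2)
            ∂(τ.prod volume) := by
          have e1 := integral_add ((j1.const_mul k).add (j2.const_mul (c * k / k)))
            (j3.const_mul (C / k))
          have e2 := integral_add (j1.const_mul k) (j2.const_mul (c * k / k))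
          simp only [Pi.add_apply] at e1 e2
          rw [e1, e2, integral_const_mul, integral_const_mul, integral_const_mul, hPl]
      _ ≤ _ := by
          have e1 : c * k / k = c := by field_simp
          have e2 : k * (∫ p, κ p.1 * fourierNormSum F p ^ 2 ∂(τ.prod volume)) ≤ c * Iz := by
            calc k * (∫ p, κ p.1 * fourierNormSum F p ^ 2 ∂(τ.prod volume))
                ≤ k * (d * (L * Iz)) := by
                  gcongr
                  exact hS.trans (by gcongr)
              _ = c * Iz * (d * L / (d * L + 1)) := by rw [hkdef]; ring
              _ ≤ c * Iz * 1 := by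
                  gcongr
                  rw [div_le_one (by positivity)]; linarith
              _ = _ := mul_one _
          rw [e1]; linarith

/-- Use ρm = 1 - ρ to extract -2 Re(conj x · w). The leftover 2ρ Re(conj x · w) is split by Young's
inequality, with ρ² ≤ ρ keeping the weight on |x|²; the drift is estimated by its modulus. -/
lemma re_conj_mul_velocity_le {x w P : ℂ} {m ρ α A S : ℝ} (hω0 : 0 ≤ ρ) (hω1 : ρ ≤ 1)
    (hα : 0 < α) (hωm : ρ * m = 1 - ρ) (hP : 2 * Real.pi * ρ * ‖P‖ ≤ A * S) :
    2 * (ρ * (starRingEnd ℂ x * (-(m : ℂ) * w - 2 * Real.pi * Complex.I * P)).re)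
      ≤ -2 * (starRingEnd ℂ x * w).re + 2 * α * ‖w‖ ^ 2 + (2 * α)⁻¹ * (ρ * ‖x‖ ^ 2)
        + 2 * A * ‖x‖ * S := by
  have e1 : (starRingEnd ℂ x * (-(m : ℂ) * w - 2 * Real.pi * Complex.I * P)).re
      = -m * (starRingEnd ℂ x * w).re - (starRingEnd ℂ x * (2 * Real.pi * Complex.I * P)).re := by
    rw [← Complex.re_ofReal_mul, ← Complex.sub_re]
    congr 1; push_cast; ring
  have h1 : |(starRingEnd ℂ x * w).re| ≤ ‖x‖ * ‖w‖ := by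
    refine (Complex.abs_re_le_norm _).trans ?_
    rw [norm_mul, RCLike.norm_conj]
  have h2 : |(starRingEnd ℂ x * (2 * Real.pi * Complex.I * P)).re|
      ≤ ‖x‖ * (2 * Real.pi * ‖P‖) := by
    refine (Complex.abs_re_le_norm _).trans ?_
    rw [norm_mul, RCLike.norm_conj, norm_mul, norm_mul, norm_mul, Complex.norm_I,
      Complex.norm_real, Real.norm_of_nonneg Real.pi_pos.le, Complex.norm_ofNat, mul_one]
  set R := (starRingEnd ℂ x * w).re
  set Q := (starRingEnd ℂ x * (2 * Real.pi * Complex.I * P)).re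
  have h3 : ρ * (-Q) ≤ A * ‖x‖ * S := by
    calc ρ * (-Q) ≤ ρ * (‖x‖ * (2 * Real.pi * ‖P‖)) := by
          gcongr; exact (neg_le_abs Q).trans h2
      _ = ‖x‖ * (2 * Real.pi * ρ * ‖P‖) := by ring
      _ ≤ ‖x‖ * (A * S) := by gcongr
      _ = _ := by ring
  have h4 : 2 * (ρ * R) ≤ 2 * α * ‖w‖ ^ 2 + (2 * α)⁻¹ * (ρ * ‖x‖ ^ 2) := by
    have a1 : ρ * R ≤ ρ * (‖x‖ * ‖w‖) := by gcongr; exact (le_abs_self R).trans h1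
    have a2 : 2 * (ρ * (‖x‖ * ‖w‖)) ≤ 2 * α * ‖w‖ ^ 2 + (2 * α)⁻¹ * (ρ ^ 2 * ‖x‖ ^ 2) := by
      have : 2 * α * ‖w‖ ^ 2 + (2 * α)⁻¹ * (ρ ^ 2 * ‖x‖ ^ 2) - 2 * (ρ * (‖x‖ * ‖w‖))
          = (2 * α)⁻¹ * (2 * α * ‖w‖ - ρ * ‖x‖) ^ 2 := by field_simp; ring
      have : 0 ≤ (2 * α)⁻¹ * (2 * α * ‖w‖ - ρ * ‖x‖) ^ 2 := by positivity
      linarith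
    have a3 : (2 * α)⁻¹ * (ρ ^ 2 * ‖x‖ ^ 2) ≤ (2 * α)⁻¹ * (ρ * ‖x‖ ^ 2) := by
      gcongr; nlinarith
    linarith
  rw [e1]
  have e2 : ρ * (-m * R - Q) = -(1 - ρ) * R + ρ * (-Q) := by rw [← hωm]; ring
  rw [e2]
  linarith

/-- Uniqueness for the linearized problem with a monotone constitutive relation. -/
theorem IsWeakLinearSolution.ae_eq_zero {s T : ℝ} (hd : 1 ≤ d) (hs : 1 / 2 ≤ s) (hs1 : s ≤ 1)
    (hT : 0 < T) {z w : ℝ × EuclideanSpace ℝ (Fin d) → ℝ}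
    {F : ℝ × EuclideanSpace ℝ (Fin d) → EuclideanSpace ℝ (Fin d)}
    (h : IsWeakLinearSolution s T z w F) (hz2 : MemLp z 2 (slabMeasure d T))
    (hw2 : MemLp w 2 (slabMeasure d T)) (hF2 : MemLp F 2 (slabMeasure d T))
    {α c L : ℝ} (hα : 0 < α) (hc : 0 ≤ c)
    (hmono : ∀ᵐ p ∂(slabMeasure d T), α * w p ^ 2 + c * z p ^ 2 ≤ z p * w p)
    (hF : (∀ᵐ p ∂(slabMeasure d T), F p = 0) ∨
      (1 / 2 < s ∧ 0 < c ∧ 0 ≤ L ∧ ∀ᵐ p ∂(slabMeasure d T), ‖F p‖ ^ 2 ≤ L * z p ^ 2)) :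
    z =ᵐ[slabMeasure d T] 0 := by
  have hz1 := h.integrable_z
  have hw1 := h.integrable_w
  have hF1 := h.integrable_F
  have hzm := h.measurable_z
  have hwm := h.measurable_w
  have hFm := h.measurable_F
  have henergy := h.energy_le hd (by linarith) hs1 hT
  rw [slabMeasure_eq_prod] at *
  set τ : Measure ℝ := volume.restrict (Ioo (0 : ℝ) T) with hτ
  obtain ⟨K, hK0, hK⟩ := exists_drift_bound hzm hz1 hz2 hFm hF1 hF2 hc hF
  -- One more than the constant in `step3`, so that the final inequality forces the energy to
  -- vanish.
  set lam : ℝ := (2 * α)⁻¹ + K + 1 with hlam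
  have hlam0 : 0 < lam := by positivity
  set κ : ℝ → ℝ := fun t => Real.exp (-lam * t) with hκdef
  have hκ : Measurable κ := by fun_prop
  have hκ0 : ∀ t, 0 < κ t := fun t => Real.exp_pos _
  have hκ1 : ∀ᵐ t ∂τ, |κ t| ≤ 1 := by
    filter_upwards [ae_restrict_mem measurableSet_Ioo] with t ht
    rw [abs_of_pos (hκ0 t)]
    exact Real.exp_le_one_iff.2 (by nlinarith [ht.1])
  have hκ1' : ∀ᵐ p ∂(τ.prod (volume : Measure (EuclideanSpace ℝ (Fin d)))), ‖κ p.1‖ ≤ 1 :=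
    Measure.quasiMeasurePreserving_fst.ae hκ1
  have hκm : AEStronglyMeasurable (fun p : ℝ × EuclideanSpace ℝ (Fin d) => κ p.1)
      (τ.prod volume) := (hκ.comp measurable_fst).aestronglyMeasurable
  have hωc : Continuous fun p : ℝ × EuclideanSpace ℝ (Fin d) => resolventSymbol s p.2 :=
    (continuous_resolventSymbol (by linarith)).comp continuous_snd
  have hωb : ∀ p : ℝ × EuclideanSpace ℝ (Fin d), ‖resolventSymbol s p.2‖ ≤ 1 := fun p => by
    rw [Real.norm_of_nonneg (resolventSymbol_pos _ _).le]
    exact resolventSymbol_le_one _ _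
  have mz := memLp_partialFourier hzm hz1 hz2
  have mw := memLp_partialFourier hwm hw1 hw2
  have mS := memLp_fourierNormSum hFm hF1 hF2
  have jz : Integrable (fun p => ‖partialFourier z p‖ ^ 2) (τ.prod volume) :=
    mz.integrable_norm_pow (by norm_num)
  have i1 : Integrable (fun p => κ p.1 * (starRingEnd ℂ (partialFourier z p)
      * partialFourier w p).re) (τ.prod volume) := by
    refine Integrable.bdd_mul ?_ hκm hκ1'
    have := mz.star.integrable_mul mw
    exact this.re
  have i2 : Integrable (fun p => κ p.1 * ‖partialFourier w p‖ ^ 2) (τ.prod volume) :=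
    (mw.integrable_norm_pow (by norm_num)).bdd_mul hκm hκ1'
  have i3 : Integrable (fun p => κ p.1 * (resolventSymbol s p.2 * ‖partialFourier z p‖ ^ 2))
      (τ.prod volume) := by
    refine Integrable.bdd_mul ?_ hκm hκ1'
    exact jz.bdd_mul (c := 1) hωc.aestronglyMeasurable (Eventually.of_forall hωb)
  have i4 : Integrable (fun p => κ p.1 * (2 * (2 * Real.pi * ‖p.2‖ * resolventSymbol s p.2)
      * ‖partialFourier z p‖ * fourierNormSum F p)) (τ.prod volume) := by
    refine Integrable.bdd_mul ?_ hκm hκ1'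
    have hA : Continuous fun p : ℝ × EuclideanSpace ℝ (Fin d) =>
        2 * (2 * Real.pi * ‖p.2‖ * resolventSymbol s p.2) := by fun_prop
    have := (mz.norm.integrable_mul mS).bdd_mul (c := 2) hA.aestronglyMeasurable
      (Eventually.of_forall fun p => by
        have := norm_mul_resolventSymbol_le_one hs p.2
        have := resolventSymbol_pos s p.2
        rw [Real.norm_of_nonneg (by positivity)]; linarith)
    refine this.congr (Eventually.of_forall fun p => ?_)
    simp only [Pi.mul_apply]; ring
  have hP := norm_partialFourier_inner_le hF1
  -- The velocity grows with the frequency; multiplied by ρ it is bounded by |ŵ| plus the norms of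
  -- the components of F̂, because ρm ≤ 1 and 2π‖ξ‖ρ ≤ 1.
  have i5 : Integrable (fun p => resolventSymbol s p.2 * (2 * (κ p.1 *
      (starRingEnd ℂ (partialFourier z p) * fourierVelocity s w F p).re))) (τ.prod volume) := by
    have hm : AEStronglyMeasurable (fun p => resolventSymbol s p.2 * (2 * (κ p.1 *
      (starRingEnd ℂ (partialFourier z p) * fourierVelocity s w F p).re))) (τ.prod volume) := by
      refine hωc.aestronglyMeasurable.mul ((hκm.mul ?_).const_mul 2)
      refine Complex.continuous_re.comp_aestronglyMeasurable (mz.1.star.mul ?_)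
      refine AEStronglyMeasurable.sub ?_ (AEStronglyMeasurable.const_mul ?_ _)
      · have : Continuous fun p : ℝ × EuclideanSpace ℝ (Fin d) =>
            -((fracSymbol s p.2 : ℝ) : ℂ) := (Complex.continuous_ofReal.comp
          ((continuous_fracSymbol (by linarith)).comp continuous_snd)).neg
        exact this.aestronglyMeasurable.mul mw.1
      · refine AEStronglyMeasurable.congr ?_ ((partialFourier_inner hF1).mono fun _ h => h.symm)
        refine Finset.aestronglyMeasurable_fun_sum _ fun i _ => ?_
        refine AEStronglyMeasurable.mul ?_
          (stronglyMeasurable_partialFourier (stronglyMeasurable_component hFm i)).aestronglyMeasurable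
        exact (Complex.continuous_ofReal.comp ((EuclideanSpace.proj (𝕜 := ℝ) i).continuous.comp
          continuous_snd)).aestronglyMeasurable
    have hdom : Integrable (fun p => 2 * (‖partialFourier z p‖ * ‖partialFourier w p‖)
        + 2 * (‖partialFourier z p‖ * fourierNormSum F p)) (τ.prod volume) :=
      ((mz.norm.integrable_mul mw.norm).const_mul 2).add ((mz.norm.integrable_mul mS).const_mul 2)
    refine hdom.mono' hm ?_
    filter_upwards [hP, hκ1'] with p hp hk
    have hω := resolventSymbol_pos s p.2
    have hv : resolventSymbol s p.2 * ‖fourierVelocity s w F p‖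
        ≤ ‖partialFourier w p‖ + fourierNormSum F p := by
      have a1 : ‖fourierVelocity s w F p‖ ≤ fracSymbol s p.2 * ‖partialFourier w p‖
          + 2 * Real.pi * (‖p.2‖ * fourierNormSum F p) := by
        refine (norm_sub_le _ _).trans (add_le_add ?_ ?_)
        · rw [norm_mul, norm_neg, Complex.norm_real,
            Real.norm_of_nonneg (fracSymbol_nonneg _ _)]
        · rw [norm_mul, norm_mul, norm_mul, Complex.norm_I, Complex.norm_real,
            Real.norm_of_nonneg Real.pi_pos.le, Complex.norm_ofNat, mul_one]
          gcongr
      have a2 : resolventSymbol s p.2 * fracSymbol s p.2 ≤ 1 := by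
        have := resolventSymbol_mul_rpow s p.2
        rw [fracSymbol]; linarith
      have a3 := norm_mul_resolventSymbol_le_one hs p.2
      calc resolventSymbol s p.2 * ‖fourierVelocity s w F p‖
          ≤ resolventSymbol s p.2 * (fracSymbol s p.2 * ‖partialFourier w p‖
          + 2 * Real.pi * (‖p.2‖ * fourierNormSum F p)) := by gcongr
        _ = (resolventSymbol s p.2 * fracSymbol s p.2) * ‖partialFourier w p‖
          + (2 * Real.pi * ‖p.2‖ * resolventSymbol s p.2) * fourierNormSum F p := by ring
        _ ≤ 1 * ‖partialFourier w p‖ + 1 * fourierNormSum F p := by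
          have := fourierNormSum_nonneg F p
          gcongr
        _ = _ := by ring
    have hre : |(starRingEnd ℂ (partialFourier z p) * fourierVelocity s w F p).re|
        ≤ ‖partialFourier z p‖ * ‖fourierVelocity s w F p‖ := by
      refine (Complex.abs_re_le_norm _).trans ?_
      rw [norm_mul, RCLike.norm_conj]
    rw [norm_mul, norm_mul, norm_mul, Real.norm_of_nonneg hω.le, Real.norm_ofNat,
      Real.norm_eq_abs (Complex.re _)]
    calc resolventSymbol s p.2 * (2 * (‖κ p.1‖
          * |(starRingEnd ℂ (partialFourier z p) * fourierVelocity s w F p).re|))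
        ≤ resolventSymbol s p.2 * (2 * (1
          * (‖partialFourier z p‖ * ‖fourierVelocity s w F p‖))) := by gcongr
      _ = 2 * ‖partialFourier z p‖
          * (resolventSymbol s p.2 * ‖fourierVelocity s w F p‖) := by ring
      _ ≤ 2 * ‖partialFourier z p‖ * (‖partialFourier w p‖ + fourierNormSum F p) := by gcongr
      _ = _ := by ring
  set I := ∫ p, κ p.1 * (resolventSymbol s p.2 * ‖partialFourier z p‖ ^ 2)
    ∂(τ.prod volume) with hI
  have hI0 : 0 ≤ I := integral_nonneg fun p =>
    mul_nonneg (hκ0 _).le (mul_nonneg (resolventSymbol_pos _ _).le (sq_nonneg _))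
  -- The fixed-frequency energy inequality, multiplied by ρ(ξ) and integrated over ξ.
  have step1 : lam * I ≤ ∫ p, resolventSymbol s p.2 * (2 * (κ p.1 *
      (starRingEnd ℂ (partialFourier z p) * fourierVelocity s w F p).re)) ∂(τ.prod volume) := by
    rw [hI, integral_prod_symm _ i3, integral_prod_symm _ i5, ← integral_const_mul]
    refine integral_mono (i3.integral_prod_right.const_mul _) i5.integral_prod_right fun ξ => ?_
    simp only
    rw [integral_const_mul]
    have e : ∫ t, κ t * (resolventSymbol s ξ * ‖partialFourier z (t, ξ)‖ ^ 2) ∂τ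
        = resolventSymbol s ξ * ∫ t, κ t * ‖partialFourier z (t, ξ)‖ ^ 2 ∂τ := by
      rw [← integral_const_mul]
      exact integral_congr_ae (Eventually.of_forall fun t => by ring)
    rw [e, mul_left_comm]
    exact mul_le_mul_of_nonneg_left (henergy lam ξ) (resolventSymbol_pos s ξ).le
  have step2 : ∫ p, resolventSymbol s p.2 * (2 * (κ p.1 *
      (starRingEnd ℂ (partialFourier z p) * fourierVelocity s w F p).re)) ∂(τ.prod volume)
      ≤ ∫ p, (-2 * (κ p.1 * (starRingEnd ℂ (partialFourier z p) * partialFourier w p).re)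
        + 2 * α * (κ p.1 * ‖partialFourier w p‖ ^ 2)
        + (2 * α)⁻¹ * (κ p.1 * (resolventSymbol s p.2 * ‖partialFourier z p‖ ^ 2))
        + κ p.1 * (2 * (2 * Real.pi * ‖p.2‖ * resolventSymbol s p.2) * ‖partialFourier z p‖
          * fourierNormSum F p)) ∂(τ.prod volume) := by
    refine integral_mono_ae i5
      ((((i1.const_mul _).add (i2.const_mul _)).add (i3.const_mul _)).add i4) ?_
    filter_upwards [hP] with p hp
    have hω := resolventSymbol_pos s p.2
    have key := re_conj_mul_velocity_le (x := partialFourier z p) (w := partialFourier w p)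
      (P := partialFourier (fun q => inner ℝ (F q) p.2) p) (m := fracSymbol s p.2) (α := α)
      (A := 2 * Real.pi * ‖p.2‖ * resolventSymbol s p.2) (S := fourierNormSum F p)
      hω.le (resolventSymbol_le_one s p.2) hα (resolventSymbol_mul_rpow s p.2) (by
        calc 2 * Real.pi * resolventSymbol s p.2
              * ‖partialFourier (fun q => inner ℝ (F q) p.2) p‖
            ≤ 2 * Real.pi * resolventSymbol s p.2 * (‖p.2‖ * fourierNormSum F p) := by gcongr
          _ = _ := by ring)
    have := mul_le_mul_of_nonneg_left key (hκ0 p.1).le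
    simp only [fourierVelocity]
    linarith
  -- Back in physical space, monotonicity bounds -2∫κzw by -2α∫κw² - 2c∫κz². The first part cancels
  -- the Young term in w, the second the drift term.
  have step3 : ∫ p, (-2 * (κ p.1 * (starRingEnd ℂ (partialFourier z p) * partialFourier w p).re)
        + 2 * α * (κ p.1 * ‖partialFourier w p‖ ^ 2)
        + (2 * α)⁻¹ * (κ p.1 * (resolventSymbol s p.2 * ‖partialFourier z p‖ ^ 2))
        + κ p.1 * (2 * (2 * Real.pi * ‖p.2‖ * resolventSymbol s p.2) * ‖partialFourier z p‖
          * fourierNormSum F p)) ∂(τ.prod volume)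
      ≤ ((2 * α)⁻¹ + K) * I := by
    have e1 := integral_add (((i1.const_mul (-2)).add (i2.const_mul (2 * α))).add
      (i3.const_mul ((2 * α)⁻¹))) i4
    have e2 := integral_add ((i1.const_mul (-2)).add (i2.const_mul (2 * α)))
      (i3.const_mul ((2 * α)⁻¹))
    have e3 := integral_add (i1.const_mul (-2)) (i2.const_mul (2 * α))
    simp only [Pi.add_apply] at e1 e2 e3
    rw [e1, e2, e3, integral_const_mul, integral_const_mul, integral_const_mul,
      integral_re_conj_partialFourier_mul hzm hwm hz1 hz2 hw1 hw2 hκ hκ1,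
      integral_norm_sq_partialFourier hwm hw1 hw2 hκ hκ1]
    have k1 := hK κ hκ (fun t => (hκ0 t).le) hκ1
    have k2 : α * (∫ p, κ p.1 * w p ^ 2 ∂(τ.prod volume))
        + c * (∫ p, κ p.1 * z p ^ 2 ∂(τ.prod volume))
        ≤ ∫ p, κ p.1 * (z p * w p) ∂(τ.prod volume) := by
      have a1 : Integrable (fun p => κ p.1 * w p ^ 2) (τ.prod volume) :=
        hw2.integrable_sq.bdd_mul hκm hκ1'
      have a2 : Integrable (fun p => κ p.1 * z p ^ 2) (τ.prod volume) :=
        hz2.integrable_sq.bdd_mul hκm hκ1'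
      rw [← integral_const_mul, ← integral_const_mul, ← integral_add (a1.const_mul α)
        (a2.const_mul c)]
      refine integral_mono_ae ((a1.const_mul α).add (a2.const_mul c))
        ((hz2.integrable_mul hw2).bdd_mul hκm hκ1') ?_
      filter_upwards [hmono] with p hp
      have := mul_le_mul_of_nonneg_left hp (hκ0 p.1).le
      linarith
    rw [← hI]
    linarith
  have hI00 : I = 0 := by
    have : lam * I ≤ ((2 * α)⁻¹ + K) * I := (step1.trans step2).trans step3
    rw [hlam] at this
    nlinarith
  have hzero : ∀ᵐ p ∂(τ.prod (volume : Measure (EuclideanSpace ℝ (Fin d)))),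
      partialFourier z p = 0 := by
    have := (integral_eq_zero_iff_of_nonneg (fun p => mul_nonneg (hκ0 _).le
      (mul_nonneg (resolventSymbol_pos _ _).le (sq_nonneg _))) i3).1 hI00
    filter_upwards [this] with p hp
    rcases mul_eq_zero.1 hp with h1 | h1
    · exact absurd h1 (hκ0 _).ne'
    · rcases mul_eq_zero.1 h1 with h2 | h2
      · exact absurd h2 (resolventSymbol_pos _ _).ne'
      · simpa using h2
  -- Plancherel with constant weight carries the vanishing of ẑ back to z.
  have hfin := integral_norm_sq_partialFourier hzm hz1 hz2 (κ := fun _ => 1) measurable_const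
    (B := 1) (by simp)
  rw [integral_eq_zero_of_ae (by filter_upwards [hzero] with p hp; simp [hp])] at hfin
  simp only [one_mul] at hfin
  have := (integral_eq_zero_iff_of_nonneg (fun p => sq_nonneg _) hz2.integrable_sq).1 hfin.symm
  filter_upwards [this] with p hp
  simpa using hp

end EnergyEstimate

/-! ### From the nonlinear equation to the linear one. -/

section Reduction

variable {d : ℕ}

lemma fracLaplacian_const_mul (s c : ℝ) (ψ : EuclideanSpace ℝ (Fin d) → ℝ)
    (x : EuclideanSpace ℝ (Fin d)) :
    fracLaplacian s (fun x => c * ψ x) x = c * fracLaplacian s ψ x := by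
  rw [fracLaplacian, fracLaplacian, ← Complex.re_ofReal_mul, fourierInv_eq_integral_phase,
    fourierInv_eq_integral_phase, ← integral_const_mul]
  congr 2
  ext ξ
  have : 𝓕 (fun x' : EuclideanSpace ℝ (Fin d) => ((c * ψ x' : ℝ) : ℂ)) ξ
      = c * 𝓕 (fun x' : EuclideanSpace ℝ (Fin d) => (ψ x' : ℂ)) ξ := by
    rw [fourier_eq_integral_phase, fourier_eq_integral_phase, ← integral_const_mul]
    congr 1
    ext x'; push_cast; ring
  rw [this]; ring

lemma inner_gradient_eq_fderiv (f : EuclideanSpace ℝ (Fin d) → ℝ) (x v : EuclideanSpace ℝ (Fin d)) :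
    inner ℝ v (gradient f x) = fderiv ℝ f x v := by
  rw [gradient, real_inner_comm, InnerProductSpace.toDual_symm_apply]

lemma isSlabTestFunction_mul {T : ℝ} {η : ℝ → ℝ} {ψ : EuclideanSpace ℝ (Fin d) → ℝ}
    (h1 : ContDiff ℝ ∞ η) (h2 : HasCompactSupport η) (h3 : tsupport η ⊆ Ioo 0 T)
    (h4 : ContDiff ℝ ∞ ψ) (h5 : HasCompactSupport ψ) :
    IsSlabTestFunction T fun p : ℝ × EuclideanSpace ℝ (Fin d) => η p.1 * ψ p.2 := by
  have hsupp : tsupport (fun p : ℝ × EuclideanSpace ℝ (Fin d) => η p.1 * ψ p.2)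
      ⊆ tsupport η ×ˢ tsupport ψ := by
    refine closure_minimal (fun p hp => ?_) ((isClosed_tsupport _).prod (isClosed_tsupport _))
    exact ⟨subset_tsupport _ (left_ne_zero_of_mul hp), subset_tsupport _ (right_ne_zero_of_mul hp)⟩
  refine ⟨(h1.comp contDiff_fst).mul (h4.comp contDiff_snd), ?_, fun p hp => ?_⟩
  · exact (h2.isCompact.prod h5.isCompact).of_isClosed_subset (isClosed_tsupport _) hsupp
  · exact ⟨h3 (hsupp hp).1, mem_univ _⟩

lemma MemLp.exists_ae_norm_le {X E : Type*} [MeasurableSpace X] [NormedAddCommGroup E]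
    {μ : Measure X} {f : X → E} (hf : MemLp f ∞ μ) : ∃ M : ℝ, 0 ≤ M ∧ ∀ᵐ x ∂μ, ‖f x‖ ≤ M := by
  refine ⟨(eLpNormEssSup f μ).toReal, ENNReal.toReal_nonneg, ?_⟩
  have hlt : eLpNormEssSup f μ < ⊤ := by simpa [eLpNorm_exponent_top] using hf.2
  filter_upwards [ae_le_eLpNormEssSup (f := f) (μ := μ)] with x hx
  rw [← toReal_enorm]
  exact ENNReal.toReal_mono hlt.ne hx

/-- The mean value theorem with the intermediate point kept in the interval where bounds on the
derivative are uniform; if x = y, any such point serves. -/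
lemma exists_sub_eq_deriv_mul {f : ℝ → ℝ} (hf : Differentiable ℝ f) {M x y : ℝ} (hx : |x| ≤ M)
    (hy : |y| ≤ M) : ∃ r ∈ Icc (-M) M, f x - f y = deriv f r * (x - y) := by
  wlog hxy : y ≤ x generalizing x y
  · obtain ⟨r, hr, h⟩ := this hy hx (not_le.1 hxy).le
    exact ⟨r, hr, by linarith⟩
  rw [abs_le] at hx hy
  rcases hxy.eq_or_lt with rfl | hlt
  · exact ⟨y, hy, by simp⟩
  · obtain ⟨r, hr, h⟩ := exists_deriv_eq_slope f hlt hf.continuous.continuousOn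
      hf.differentiableOn
    refine ⟨r, ⟨by linarith [hr.1], by linarith [hr.2]⟩, ?_⟩
    rw [h, div_mul_cancel₀ _ (by linarith)]

lemma exists_abs_deriv_le {f : ℝ → ℝ} (hf : ContDiff ℝ 1 f) (M : ℝ) :
    ∃ L : ℝ, 0 < L ∧ ∀ r ∈ Icc (-M) M, |deriv f r| ≤ L := by
  obtain ⟨C, hC⟩ := isCompact_Icc.exists_bound_of_continuousOn
    (hf.continuous_deriv le_rfl).continuousOn (s := Icc (-M) M)
  exact ⟨|C| + 1, by positivity, fun r hr => (hC r hr).trans (by linarith [le_abs_self C])⟩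

lemma exists_pos_le_deriv {f : ℝ → ℝ} (hf : ContDiff ℝ 1 f) (hpos : ∀ r, 0 < deriv f r) {M : ℝ}
    (hM : 0 ≤ M) : ∃ c : ℝ, 0 < c ∧ ∀ r ∈ Icc (-M) M, c ≤ deriv f r := by
  obtain ⟨r₀, -, h⟩ := isCompact_Icc.exists_isMinOn (s := Icc (-M) M) ⟨0, by simpa using hM⟩
    (hf.continuous_deriv le_rfl).continuousOn
  exact ⟨_, hpos r₀, fun r hr => h hr⟩

/-- Coercivity of a monotone constitutive relation on bounded sets. -/
lemma coercivity_of_deriv {k L c z : ℝ} (hL : 0 < L) (hk0 : 0 ≤ k) (hkL : k ≤ L) (hck : c ≤ k) :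
    (2 * L)⁻¹ * (k * z) ^ 2 + c / 2 * z ^ 2 ≤ z * (k * z) := by
  -- Half of kz² pays for the term in (kz)², since k² ≤ Lk; the other half dominates (c/2)z².
  have h1 : (2 * L)⁻¹ * k ^ 2 ≤ k / 2 := by
    rw [inv_mul_le_iff₀ (by positivity)]; nlinarith
  have h2 : ((2 * L)⁻¹ * k ^ 2 + c / 2) * z ^ 2 ≤ k * z ^ 2 := by
    gcongr; linarith
  nlinarith

lemma memLp_two_of_integrable_of_bounded {X : Type*} [MeasurableSpace X] {μ : Measure X}
    {f : X → ℝ} (hf : Integrable f μ) {M : ℝ} (hM : ∀ᵐ x ∂μ, ‖f x‖ ≤ M) : MemLp f 2 μ := by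
  rw [memLp_two_iff_integrable_sq hf.aestronglyMeasurable]
  refine (hf.mul_bdd hf.aestronglyMeasurable hM).congr (Eventually.of_forall fun x => ?_)
  simp only [sq]

/-- The distributional formulation, tested with a product `η(t) ψ(x)`, together with the
integrability of its integrand. -/
lemma IsDistributionalSolution.product_test {s T : ℝ} (hd : 1 ≤ d) (hs0 : 0 < s) (hs1 : s ≤ 1)
    {β b : ℝ → ℝ} (hβ : Continuous β) (hb : Continuous b)
    {D : EuclideanSpace ℝ (Fin d) → EuclideanSpace ℝ (Fin d)} (hD : MemLp D ∞ volume)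
    {u : ℝ × EuclideanSpace ℝ (Fin d) → ℝ} (hu : MemLp u ∞ (slabMeasure d T))
    (hsol : IsDistributionalSolution s T β b D u) {η : ℝ → ℝ}
    {ψ : EuclideanSpace ℝ (Fin d) → ℝ}
    (h1 : ContDiff ℝ ∞ η) (h2 : HasCompactSupport η) (h3 : tsupport η ⊆ Ioo 0 T)
    (h4 : ContDiff ℝ ∞ ψ) (h5 : HasCompactSupport ψ) :
    Integrable (fun p => u p * (deriv η p.1 * ψ p.2)
      - β (u p) * (η p.1 * fracLaplacian s ψ p.2)
      + b (u p) * u p * (η p.1 * fderiv ℝ ψ p.2 (D p.2))) (slabMeasure d T) ∧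
    ∫ p, (u p * (deriv η p.1 * ψ p.2) - β (u p) * (η p.1 * fracLaplacian s ψ p.2)
      + b (u p) * u p * (η p.1 * fderiv ℝ ψ p.2 (D p.2))) ∂(slabMeasure d T) = 0 := by
  have hηi : Integrable η := h1.continuous.integrable_of_hasCompactSupport h2
  have hη'i : Integrable (deriv η) :=
    (h1.continuous_deriv (by simp)).integrable_of_hasCompactSupport h2.deriv
  have hψi : Integrable ψ := h4.continuous.integrable_of_hasCompactSupport h5
  have hLi := integrable_fracLaplacian hd hs0 hs1 h4 h5
  obtain ⟨M, hM0, hM⟩ := MemLp.exists_ae_norm_le hu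
  obtain ⟨MD, hMD0, hMD⟩ := MemLp.exists_ae_norm_le hD
  have hfd : Continuous (fderiv ℝ ψ) := h4.continuous_fderiv (by simp)
  have hDi : Integrable (fun x => fderiv ℝ ψ x (D x)) := by
    have hi : Integrable (fderiv ℝ ψ) :=
      hfd.integrable_of_hasCompactSupport (h5.fderiv (𝕜 := ℝ))
    have hm : AEStronglyMeasurable (fun x => fderiv ℝ ψ x (D x)) volume := by
      have hc : Continuous fun q : (EuclideanSpace ℝ (Fin d) →L[ℝ] ℝ)
        × EuclideanSpace ℝ (Fin d) => q.1 q.2 := continuous_fst.clm_apply continuous_snd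
      exact hc.comp_aestronglyMeasurable (hfd.aestronglyMeasurable.prodMk hD.1)
    refine (hi.norm.mul_const MD).mono' hm ?_
    filter_upwards [hMD] with x hx
    exact ((fderiv ℝ ψ x).le_opNorm _).trans (by gcongr)
  have hbd : ∀ {g : ℝ → ℝ}, Continuous g → ∃ C : ℝ, ∀ᵐ p ∂(slabMeasure d T), ‖g (u p)‖ ≤ C := by
    intro g hg
    obtain ⟨C, hC⟩ := isCompact_Icc.exists_bound_of_continuousOn hg.continuousOn (s := Icc (-M) M)
    refine ⟨C, ?_⟩
    filter_upwards [hM] with p hp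
    exact hC _ (abs_le.1 hp)
  obtain ⟨C1, hC1⟩ := hbd continuous_id
  obtain ⟨C2, hC2⟩ := hbd hβ
  obtain ⟨C3, hC3⟩ := hbd (hb.mul continuous_id)
  have hprod : ∀ {f : ℝ → ℝ} {g : EuclideanSpace ℝ (Fin d) → ℝ}, Integrable f → Integrable g →
      Integrable (fun p : ℝ × EuclideanSpace ℝ (Fin d) => f p.1 * g p.2) (slabMeasure d T) := by
    intro f g hf hg
    rw [slabMeasure_eq_prod]
    exact hf.integrableOn.mul_prod hg
  have i1 := (hprod hη'i hψi).bdd_mul (continuous_id.comp_aestronglyMeasurable hu.1) hC1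
  have i2 := (hprod hηi hLi).bdd_mul (hβ.comp_aestronglyMeasurable hu.1) hC2
  have i3 := (hprod hηi hDi).bdd_mul ((hb.mul continuous_id).comp_aestronglyMeasurable hu.1) hC3
  refine ⟨(i1.sub i2).add i3, ?_⟩
  have h := hsol _ (isSlabTestFunction_mul h1 h2 h3 h4 h5)
  rw [← h]
  refine integral_congr_ae (Eventually.of_forall fun p => ?_)
  have e1 : deriv (fun t => η t * ψ p.2) p.1 = deriv η p.1 * ψ p.2 := deriv_mul_const_field _
  have e2 : fderiv ℝ (fun x => η p.1 * ψ x) p.2 (D p.2) = η p.1 * fderiv ℝ ψ p.2 (D p.2) := by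
    have : fderiv ℝ (fun x => η p.1 * ψ x) p.2 = η p.1 • fderiv ℝ ψ p.2 :=
      fderiv_const_mul ((h4.differentiable (by simp)).differentiableAt) _
    rw [this]; rfl
  simp only [inner_gradient_eq_fderiv, fracLaplacian_const_mul]
  rw [e1, e2]; ring

/-- A null set of the slab is null in almost every time slice, and the essential supremum ignores
the remaining slices. -/
lemma VanishesWeaklyAtZero.congr_ae {T : ℝ} (hT : 0 < T)
    {z z' : ℝ × EuclideanSpace ℝ (Fin d) → ℝ} (hz : VanishesWeaklyAtZero z)
    (h : z =ᵐ[slabMeasure d T] z') : VanishesWeaklyAtZero z' := by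
  intro φ h1 h2
  refine (hz φ h1 h2).congr' ?_
  have hsl : ∀ᵐ r ∂(volume.restrict (Ioo (0 : ℝ) T)), ∀ᵐ x, z (r, x) = z' (r, x) := by
    rw [slabMeasure_eq_prod] at h
    exact Measure.ae_ae_of_ae_prod h
  filter_upwards [nhdsWithin_le_nhds (eventually_lt_nhds hT)] with t ht
  refine essSup_congr_ae ?_
  filter_upwards [ae_mono (Measure.restrict_mono (Ioo_subset_Ioo_right ht.le) le_rfl) hsl]
    with r hr
  have : ∫ x, z (r, x) * φ x = ∫ x, z' (r, x) * φ x := by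
    refine integral_congr_ae ?_
    filter_upwards [hr] with x hx
    rw [hx]
  rw [this]

end Reduction

/-! ### Uniqueness for the nonlinear equation. -/

theorem theorem3p1 (d : ℕ) (hd : 1 ≤ d) (s T : ℝ) (hs1 : s ≤ 1) (hT : 0 < T)
    (β b : ℝ → ℝ) (D : EuclideanSpace ℝ (Fin d) → EuclideanSpace ℝ (Fin d))
    (hβ : ContDiff ℝ 1 β) (hβ0 : β 0 = 0)
    (hD : MemLp D ∞ volume) (hb : ContDiff ℝ 1 b)
    (hcase : (1 / 2 < s ∧ ∀ r : ℝ, 0 < deriv β r) ∨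
      (1 / 2 ≤ s ∧ D =ᵐ[volume] 0 ∧ ∀ r : ℝ, 0 ≤ deriv β r))
    (y₁ y₂ : ℝ × EuclideanSpace ℝ (Fin d) → ℝ)
    (hy₁ : MemLp y₁ ∞ (slabMeasure d T)) (hy₂ : MemLp y₂ ∞ (slabMeasure d T))
    (hsol₁ : IsDistributionalSolution s T β b D y₁)
    (hsol₂ : IsDistributionalSolution s T β b D y₂)
    (hL1 : MemLp (y₁ - y₂) 1 (slabMeasure d T))
    (hL2 : MemLinftyL2 T (y₁ - y₂))
    (h0 : VanishesWeaklyAtZero (y₁ - y₂)) :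
    y₁ =ᵐ[slabMeasure d T] y₂ := by
  have hs : 1 / 2 ≤ s := by rcases hcase with h | h; exacts [h.1.le, h.1]
  have hs0 : 0 < s := by linarith
  obtain ⟨M₁, hM₁0, hM₁⟩ := MemLp.exists_ae_norm_le hy₁
  obtain ⟨M₂, hM₂0, hM₂⟩ := MemLp.exists_ae_norm_le hy₂
  obtain ⟨MD, hMD0, hMD⟩ := MemLp.exists_ae_norm_le hD
  set M := max M₁ M₂ with hMdef
  have hM0 : 0 ≤ M := hM₁0.trans (le_max_left _ _)
  have hB : ContDiff ℝ 1 fun r => b r * r := hb.mul contDiff_id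
  obtain ⟨L, hL0, hL⟩ := exists_abs_deriv_le hβ M
  obtain ⟨N, hN0, hN⟩ := exists_abs_deriv_le hB M
  have hMD' : ∀ᵐ p ∂(slabMeasure d T), ‖D p.2‖ ≤ MD := by
    rw [slabMeasure_eq_prod]; exact Measure.quasiMeasurePreserving_snd.ae hMD
  have hDm : AEStronglyMeasurable (fun p : ℝ × EuclideanSpace ℝ (Fin d) => D p.2)
      (slabMeasure d T) := by
    rw [slabMeasure_eq_prod]; exact hD.1.comp_snd
  -- measurable representatives of the differences
  have hzm : AEStronglyMeasurable (y₁ - y₂) (slabMeasure d T) := hL1.1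
  have hwm : AEStronglyMeasurable (fun p => β (y₁ p) - β (y₂ p)) (slabMeasure d T) :=
    (hβ.continuous.comp_aestronglyMeasurable hy₁.1).sub
      (hβ.continuous.comp_aestronglyMeasurable hy₂.1)
  have hFm : AEStronglyMeasurable (fun p => (b (y₁ p) * y₁ p - b (y₂ p) * y₂ p) • D p.2)
      (slabMeasure d T) :=
    ((hB.continuous.comp_aestronglyMeasurable hy₁.1).sub
      (hB.continuous.comp_aestronglyMeasurable hy₂.1)).smul hDm
  set z := hzm.mk with hz
  set w := hwm.mk with hw
  set F := hFm.mk with hF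
  have hz1 : Integrable z (slabMeasure d T) :=
    (memLp_one_iff_integrable.1 hL1).congr hzm.ae_eq_mk
  -- The differences of β and of r ↦ b(r)r are each a derivative value on [-M, M] times z, so w and
  -- F are both controlled linearly by z.
  have hpt : ∀ᵐ p ∂(slabMeasure d T), (∃ r ∈ Icc (-M) M, w p = deriv β r * z p) ∧
      ‖F p‖ ≤ N * MD * ‖z p‖ ∧ ‖z p‖ ≤ 2 * M := by
    filter_upwards [hzm.ae_eq_mk, hwm.ae_eq_mk, hFm.ae_eq_mk, hM₁, hM₂, hMD']
      with p e1 e2 e3 k1 k2 k3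
    have a1 : |y₁ p| ≤ M := k1.trans (le_max_left _ _)
    have a2 : |y₂ p| ≤ M := k2.trans (le_max_right _ _)
    rw [← hz] at e1
    rw [← hw] at e2
    rw [← hF] at e3
    rw [← e1, ← e2, ← e3, Pi.sub_apply]
    refine ⟨exists_sub_eq_deriv_mul (hβ.differentiable one_ne_zero) a1 a2, ?_, ?_⟩
    · obtain ⟨r, hr, h⟩ := exists_sub_eq_deriv_mul (hB.differentiable one_ne_zero) a1 a2
      rw [norm_smul, h, norm_mul]
      calc ‖deriv (fun r => b r * r) r‖ * ‖y₁ p - y₂ p‖ * ‖D p.2‖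
          ≤ N * ‖y₁ p - y₂ p‖ * MD := by gcongr; exact hN r hr
        _ = _ := by ring
    · exact (norm_sub_le _ _).trans (by rw [Real.norm_eq_abs, Real.norm_eq_abs]; linarith)
  have hwz : ∀ᵐ p ∂(slabMeasure d T), ‖w p‖ ≤ L * ‖z p‖ := by
    filter_upwards [hpt] with p hp
    obtain ⟨r, hr, h⟩ := hp.1
    rw [h, norm_mul]
    exact mul_le_mul_of_nonneg_right (hL r hr) (norm_nonneg _)
  -- Square integrability on the slab by interpolating between L¹ and L^∞.
  have hz2 : MemLp z 2 (slabMeasure d T) :=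
    memLp_two_of_integrable_of_bounded hz1 (hpt.mono fun p hp => hp.2.2)
  have hw2 : MemLp w 2 (slabMeasure d T) :=
    hz2.of_le_mul hwm.stronglyMeasurable_mk.aestronglyMeasurable hwz
  have hF2 : MemLp F 2 (slabMeasure d T) :=
    hz2.of_le_mul hFm.stronglyMeasurable_mk.aestronglyMeasurable (hpt.mono fun p hp => hp.2.1)
  have hw1 : Integrable w (slabMeasure d T) :=
    memLp_one_iff_integrable.1 ((memLp_one_iff_integrable.2 hz1).of_le_mul
      hwm.stronglyMeasurable_mk.aestronglyMeasurable hwz)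
  have hF1 : Integrable F (slabMeasure d T) :=
    memLp_one_iff_integrable.1 ((memLp_one_iff_integrable.2 hz1).of_le_mul
      hFm.stronglyMeasurable_mk.aestronglyMeasurable (hpt.mono fun p hp => hp.2.1))
  have hlin : IsWeakLinearSolution s T z w F := by
    refine ⟨hzm.stronglyMeasurable_mk, hwm.stronglyMeasurable_mk, hFm.stronglyMeasurable_mk,
      hz1, hw1, hF1, fun η ψ h1 h2 h3 h4 h5 => ?_, h0.congr_ae hT hzm.ae_eq_mk⟩
    obtain ⟨i1, e1⟩ := hsol₁.product_test hd hs0 hs1 hβ.continuous hb.continuous hD hy₁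
      h1 h2 h3 h4 h5
    obtain ⟨i2, e2⟩ := hsol₂.product_test hd hs0 hs1 hβ.continuous hb.continuous hD hy₂
      h1 h2 h3 h4 h5
    -- Each formulation is separately integrable because the test factors are in L¹ and the
    -- solutions are bounded; this makes the subtraction legitimate.
    have e := integral_sub i1 i2
    rw [e1, e2, sub_zero] at e
    refine Eq.trans (integral_congr_ae ?_) e
    filter_upwards [hzm.ae_eq_mk, hwm.ae_eq_mk, hFm.ae_eq_mk] with p k1 k2 k3
    rw [← hz] at k1
    rw [← hw] at k2
    rw [← hF] at k3
    rw [← k1, ← k2, ← k3, Pi.sub_apply, map_smul, smul_eq_mul]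
    ring
  have hzero : z =ᵐ[slabMeasure d T] 0 := by
    rcases hcase with ⟨hs', hpos⟩ | ⟨-, hD0, hnn⟩
    · obtain ⟨c, hc0, hc⟩ := exists_pos_le_deriv hβ hpos hM0
      refine hlin.ae_eq_zero hd hs hs1 hT hz2 hw2 hF2 (α := (2 * L)⁻¹) (c := c / 2)
        (L := (N * MD) ^ 2) (by positivity) (by positivity) ?_
        (Or.inr ⟨hs', by positivity, by positivity, ?_⟩)
      · filter_upwards [hpt] with p hp
        obtain ⟨r, hr, h⟩ := hp.1
        rw [h]
        exact coercivity_of_deriv hL0 (hpos r).le ((le_abs_self _).trans (hL r hr)) (hc r hr)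
      · filter_upwards [hpt] with p hp
        have := pow_le_pow_left₀ (norm_nonneg _) hp.2.1 2
        rwa [mul_pow, Real.norm_eq_abs, sq_abs] at this
    -- Degenerate case: coercivity in z is lost (c = 0, written to match `coercivity_of_deriv`), but
    -- F = 0 leaves no drift to absorb.
    · refine hlin.ae_eq_zero hd hs hs1 hT hz2 hw2 hF2 (α := (2 * L)⁻¹) (c := 0 / 2) (L := 0)
        (by positivity) (by norm_num) ?_ (Or.inl ?_)
      · filter_upwards [hpt] with p hp
        obtain ⟨r, hr, h⟩ := hp.1
        rw [h]
        exact coercivity_of_deriv hL0 (hnn r) ((le_abs_self _).trans (hL r hr)) (hnn r)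
      · have hD0' : ∀ᵐ p ∂(slabMeasure d T), D p.2 = 0 := by
          rw [slabMeasure_eq_prod]; exact Measure.quasiMeasurePreserving_snd.ae hD0
        filter_upwards [hFm.ae_eq_mk, hD0'] with p k1 k2
        rw [← hF] at k1
        rw [← k1, k2, smul_zero]
  filter_upwards [hzm.ae_eq_mk, hzero] with p k1 k2
  rw [← hz, k2] at k1
  exact sub_eq_zero.1 k1
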